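/- **Setting.** A domain is a nonempty connected open subset of $\mathbb R^2$. For a bounded domain $\Omega\subset\mathbb R^2$ and $\beta>0$ let $A=\frac{\beta}{2}(-x_2,x_1)$, $\nabla^A u=\nabla u-iuA$, and let $\lambda_1(\Omega,\beta)$ be the first eigenvalue of the magnetic Laplacian $-(\nabla-iA)^2$ on $\Omega$ with magnetic Neumann conditions, given variationally by $$\lambda_1(\Omega,\beta)=\inf_{0\neq u\in H^1(\Omega;\mathbb C)}\frac{\int_\Omega|\nabla^A u|^2}{\int_\Omega|u|^2}.$$ For $\xi\in\mathbb R$ let $\mu_1(\xi)$ be the least $\mu$ for which $-f''(t)+(\xi+t)^2f(t)=\mu f(t)$ on $(0,\infty)$, $f'(0)=0$, has a nonzero solution $f\in L^2(0,\infty)$, and let $\Theta_0=\min_{\xi\in\mathbb R}\mu_1(\xi)$ be the de Gennes constant. A bounded domain $\Omega$ is a *curvilinear polygon* if $\partial\Omega=\bigcup_{s=1}^N\gamma_s$, $N\ge1$, where the $\gamma_s$ are regular $C^\infty$ arcs (smooth up to their endpoints), disjoint except at the endpoints, where $\gamma_{s-1}$ and $\gamma_s$ (with $\gamma_0=\gamma_N$)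 meet with an angle $\alpha_s\in(0,2\pi)$. It is *self-tiling* if there is an integer $m\ge2$ such that $\Omega=\mathrm{Int}\big(\bigcup_{i=1}^m\overline{\omega_i}\big)$, where each $\omega_i$ is isometric to $\frac1{\sqrt m}\Omega$. **Theorem.** (A) Let $\Omega$ be a bounded domain in $\mathbb R^2$ and $\beta>0$. Assume that, up to an isometry of $\mathbb R^2$, one of the following holds: 1. $\Omega=\{(x_1,x_2): a<x_1<b,\ 0<x_2<g(x_1)\}$ for some $-\infty<a<b<\infty$ and some smooth $g:(a,b)\to[0,\infty)$; 2. for some $-\infty<a<b<\infty$, $\Omega$ is contained in $(a,b)\times(0,\infty)$ and contains $(a,b)\times(0,2\sqrt{\Theta_0/\beta})$. Then $\lambda_1(\Omega,\beta)<\Theta_0\beta$. (B) Let $\Omega$ be a bounded self-tiling curvilinear polygon. Then the limit $\Lambda(\Omega)=\lim_{\beta\to+\infty}\lambda_1(\Omega,\beta)/\beta$ exists and, for all $\beta>0$, $$\lambda_1(\Omega,\beta)\le\Lambda(\Omega)\,\beta\le\Theta_0\,\beta.$$ -/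

import Mathlib

open MeasureTheory Set Filter Topology
open scoped ContDiff Pointwise

/-- The Euclidean plane; the coordinates `(x₁, x₂)` of `x` are `x 0` and `x 1`. -/
abbrev Plane : Type := EuclideanSpace ℝ (Fin 2)

/-- `ℂ²` with its Hermitian norm (the values of gradients of complex functions). -/
abbrev CVec : Type := EuclideanSpace ℂ (Fin 2)

/-- A bounded domain: a nonempty connected bounded open subset of the plane. -/
structure IsBoundedDomain (Ω : Set Plane) : Prop where
  isOpen : IsOpen Ω
  isConnected : IsConnected Ω
  isBounded : Bornology.IsBounded Ω

/-! ### The Sobolev space `H¹(Ω)` and the magnetic Neumann eigenvalue problem -/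

/-- `v` is a weak gradient of the complex function `u` on `Ω`. -/
def IsWeakGradient (Ω : Set Plane) (u : Plane → ℂ) (v : Plane → CVec) : Prop :=
  ∀ φ : Plane → ℝ, ContDiff ℝ ∞ φ → HasCompactSupport φ → tsupport φ ⊆ Ω → ∀ j : Fin 2,
    ∫ x in Ω, ((fderiv ℝ φ x (EuclideanSpace.single j 1) : ℝ) : ℂ) * u x
      = -∫ x in Ω, (φ x : ℂ) * v x j

/-- `u ∈ H¹(Ω)` (complex valued), with weak gradient `v`. -/
structure IsH1 (Ω : Set Plane) (u : Plane → ℂ) (v : Plane → CVec) : Prop where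
  memLp : MemLp u 2 (volume.restrict Ω)
  memLp_grad : MemLp v 2 (volume.restrict Ω)
  isWeakGradient : IsWeakGradient Ω u v

/-- The standard potential `A = (β/2) (-x₂, x₁)` (with its values seen in `ℂ²`). -/
noncomputable def stdPotential (β : ℝ) (x : Plane) : CVec :=
  !₂[((-(β / 2 * x 1) : ℝ) : ℂ), ((β / 2 * x 0 : ℝ) : ℂ)]

/-- The magnetic gradient `∇ᴬ u = ∇u - i u A`, where `v = ∇u`. -/
noncomputable def magGrad (β : ℝ) (u : Plane → ℂ) (v : Plane → CVec) (x : Plane) : CVec :=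
  v x - (Complex.I * u x) • stdPotential β x

/-- `μ` is an eigenvalue of the magnetic Laplacian on `Ω` with magnetic Neumann conditions and
`u` (with weak gradient `v`) is an eigenfunction, in the weak sense:
`∫ ⟨∇ᴬu, conj (∇ᴬφ)⟩ = μ ∫ u conj φ` for every `φ ∈ H¹(Ω)`. -/
structure IsNeumannEigenpair (Ω : Set Plane) (β μ : ℝ) (u : Plane → ℂ) (v : Plane → CVec) :
    Prop where
  isH1 : IsH1 Ω u v
  ne_zero : ¬ u =ᵐ[volume.restrict Ω] 0
  weak_eq : ∀ (φ : Plane → ℂ) (ψ : Plane → CVec), IsH1 Ω φ ψ →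
    ∫ x in Ω, inner ℂ (magGrad β φ ψ x) (magGrad β u v x)
      = (μ : ℂ) * ∫ x in Ω, inner ℂ (φ x) (u x)

/-- The eigenvalues of the magnetic Neumann Laplacian on `Ω`. -/
def neumannEigenvalues (Ω : Set Plane) (β : ℝ) : Set ℝ :=
  {μ | ∃ u v, IsNeumannEigenpair Ω β μ u v}

/-- The first eigenvalue `λ₁(Ω, β)`, through its variational characterization: the infimum of
`∫ |∇ᴬu|² / ∫ |u|²` over `0 ≠ u ∈ H¹(Ω)`. That this is the least eigenvalue of the
weak problem when the spectrum is discrete is shown below (`isLeast_lambda1`). -/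
noncomputable def lambda1 (Ω : Set Plane) (β : ℝ) : ℝ :=
  sInf {r | ∃ u v, IsH1 Ω u v ∧ ¬ u =ᵐ[volume.restrict Ω] 0 ∧
    r = (∫ x in Ω, ‖magGrad β u v x‖ ^ 2) / ∫ x in Ω, ‖u x‖ ^ 2}

/-- The spectrum is discrete: there is a Hilbert basis of `L²(Ω)` of eigenfunctions, the
eigenvalues forming a nondecreasing sequence that diverges to `+∞`. -/
def HasDiscreteSpectrum (Ω : Set Plane) (β : ℝ) : Prop :=
  ∃ (b : HilbertBasis ℕ ℂ (Lp ℂ 2 (volume.restrict Ω))) (μ : ℕ → ℝ),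
    Monotone μ ∧ Tendsto μ atTop atTop ∧ ∀ k, ∃ v, IsNeumannEigenpair Ω β (μ k) (b k) v

theorem memLp_magGrad {Ω : Set Plane} (hΩ : IsBoundedDomain Ω) (β : ℝ) {u : Plane → ℂ}
    {v : Plane → CVec} (h : IsH1 Ω u v) : MemLp (magGrad β u v) 2 (volume.restrict Ω) := by
  have hcont : Continuous (stdPotential β) := by
    unfold stdPotential
    refine (PiLp.continuous_toLp 2 _).comp (continuous_pi fun j => ?_)
    fin_cases j <;> simp <;> fun_prop
  obtain ⟨C, hC⟩ := (hΩ.isBounded.isCompact_closure.image hcont).isBounded.exists_norm_le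
  refine h.memLp_grad.sub (h.memLp.of_le_mul (c := C) ?_ ?_)
  · exact ((aestronglyMeasurable_const.mul h.memLp.1).smul hcont.aestronglyMeasurable)
  · filter_upwards [ae_restrict_mem hΩ.isOpen.measurableSet] with x hx
    have := hC _ ⟨x, subset_closure hx, rfl⟩
    rw [norm_smul, norm_mul, Complex.norm_I, one_mul, mul_comm]
    gcongr

theorem inner_toLp {F : Type*} [NormedAddCommGroup F] [InnerProductSpace ℂ F] {Ω : Set Plane}
    {f g : Plane → F} (hf : MemLp f 2 (volume.restrict Ω)) (hg : MemLp g 2 (volume.restrict Ω)) :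
    inner ℂ hf.toLp hg.toLp = ∫ x in Ω, inner ℂ (f x) (g x) := by
  rw [L2.inner_def]
  refine integral_congr_ae ?_
  filter_upwards [hf.coeFn_toLp, hg.coeFn_toLp] with x h1 h2
  rw [h1, h2]

theorem inner_self_complex {F : Type*} [NormedAddCommGroup F] [InnerProductSpace ℂ F] (x : F) :
    inner ℂ x x = ((‖x‖ ^ 2 : ℝ) : ℂ) := by
  rw [inner_self_eq_norm_sq_to_K]
  simp

theorem norm_sq_toLp {F : Type*} [NormedAddCommGroup F] [InnerProductSpace ℂ F] {Ω : Set Plane}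
    {f : Plane → F} (hf : MemLp f 2 (volume.restrict Ω)) :
    ‖hf.toLp‖ ^ 2 = ∫ x in Ω, ‖f x‖ ^ 2 := by
  have h := inner_toLp hf hf
  simp only [inner_self_complex] at h
  rw [integral_complex_ofReal] at h
  exact Complex.ofReal_injective h

/-- If the spectrum is discrete, `lambda1` is the least eigenvalue of the weak problem. -/
theorem isLeast_lambda1 {Ω : Set Plane} (hΩ : IsBoundedDomain Ω) {β : ℝ}
    (h : HasDiscreteSpectrum Ω β) : IsLeast (neumannEigenvalues Ω β) (lambda1 Ω β) := by
  obtain ⟨b, μ, hmono, -, hb⟩ := h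
  choose w hw using hb
  have key : ∀ u v, IsH1 Ω u v →
      μ 0 * ∫ x in Ω, ‖u x‖ ^ 2 ≤ ∫ x in Ω, ‖magGrad β u v x‖ ^ 2 := by
    intro u v hu
    rcases le_or_gt (μ 0) 0 with h0 | h0
    · exact (mul_nonpos_of_nonpos_of_nonneg h0 (integral_nonneg fun _ => by positivity)).trans
        (integral_nonneg fun _ => by positivity)
    have hμ : ∀ k, 0 < μ k := fun k => h0.trans_le (hmono (Nat.zero_le k))
    let G := fun k => (memLp_magGrad hΩ β (hw k).isH1).toLp
    have hGin : ∀ (u : Plane → ℂ) (v : Plane → CVec) (hu : IsH1 Ω u v) (k : ℕ),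
        inner ℂ (memLp_magGrad hΩ β hu).toLp (G k)
          = (μ k : ℂ) * inner ℂ hu.memLp.toLp (b k) := by
      intro u v hu k
      have e : b k = (hw k).isH1.memLp.toLp := (Lp.toLp_coeFn (b k) _).symm
      rw [inner_toLp, (hw k).weak_eq u v hu]
      conv_rhs => rw [e]
      rw [inner_toLp]
    let e := fun k => (((Real.sqrt (μ k))⁻¹ : ℝ) : ℂ) • G k
    have hsq : ∀ k, ((Real.sqrt (μ k) : ℝ) : ℂ) ≠ 0 := fun k =>
      Complex.ofReal_ne_zero.2 (Real.sqrt_pos.2 (hμ k)).ne'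
    have hss : ∀ k, ((Real.sqrt (μ k) : ℝ) : ℂ) * ((Real.sqrt (μ k) : ℝ) : ℂ) = μ k := fun k => by
      exact_mod_cast Real.mul_self_sqrt (hμ k).le
    have he : Orthonormal ℂ e := by
      rw [orthonormal_iff_ite]
      intro i j
      have h1 := hGin _ _ (hw i).isH1 j
      rw [Lp.toLp_coeFn, orthonormal_iff_ite.1 b.orthonormal i j] at h1
      change inner ℂ (_ • G i) (_ • G j) = _
      rw [inner_smul_left, inner_smul_right, show inner ℂ (G i) (G j) = _ from h1]
      split_ifs with hij
      · subst hij
        rw [Complex.conj_ofReal, mul_one, ← hss i]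
        push_cast
        field_simp [hsq i]
      · simp
    have hin : ∀ k, ‖inner ℂ (e k) (memLp_magGrad hΩ β hu).toLp‖ ^ 2
        = μ k * ‖inner ℂ hu.memLp.toLp (b k)‖ ^ 2 := by
      intro k
      rw [norm_inner_symm]
      change ‖inner ℂ _ (_ • G k)‖ ^ 2 = _
      rw [inner_smul_right, hGin u v hu k, norm_mul, norm_mul, Complex.norm_real,
        Complex.norm_real, Real.norm_of_nonneg (hμ k).le, Real.norm_of_nonneg (by positivity)]
      have := Real.sq_sqrt (hμ k).le
      have h3 := (Real.sqrt_pos.2 (hμ k)).ne'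
      rw [mul_pow, mul_pow, inv_pow, this]
      field_simp [(hμ k).ne']
    have hbes := he.tsum_inner_products_le (memLp_magGrad hΩ β hu).toLp
    have hsum := he.inner_products_summable (memLp_magGrad hΩ β hu).toLp
    rw [norm_sq_toLp] at hbes
    refine le_trans ?_ hbes
    simp only [hin] at hsum ⊢
    have hpar := b.hasSum_inner_mul_inner hu.memLp.toLp hu.memLp.toLp
    have hpar' : HasSum (fun k => ‖inner ℂ hu.memLp.toLp (b k)‖ ^ 2)
        (∫ x in Ω, ‖u x‖ ^ 2) := by
      rw [← norm_sq_toLp hu.memLp, ← Complex.hasSum_ofReal]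
      rw [inner_self_complex] at hpar
      have hterm : ∀ k, inner ℂ hu.memLp.toLp (b k) * inner ℂ (b k) hu.memLp.toLp
          = ((‖inner ℂ hu.memLp.toLp (b k)‖ ^ 2 : ℝ) : ℂ) := fun k => by
        rw [← inner_conj_symm (b k), Complex.mul_conj, Complex.normSq_eq_norm_sq]
      simp only [hterm] at hpar
      exact hpar
    rw [← hpar'.tsum_eq, ← tsum_mul_left]
    refine (hpar'.summable.mul_left _).tsum_le_tsum (fun k => ?_) hsum
    exact mul_le_mul_of_nonneg_right (hmono (Nat.zero_le k)) (by positivity)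
  have hpos : ∀ u v, IsH1 Ω u v → ¬ u =ᵐ[volume.restrict Ω] 0 → 0 < ∫ x in Ω, ‖u x‖ ^ 2 := by
    intro u v hu h0
    rw [← norm_sq_toLp hu.memLp]
    have : hu.memLp.toLp ≠ 0 := fun hz => h0 ((Lp.eq_zero_iff_ae_eq_zero.1 hz).symm.trans
      hu.memLp.coeFn_toLp |>.symm)
    positivity
  have hR : ∀ m u v, IsNeumannEigenpair Ω β m u v →
      m = (∫ x in Ω, ‖magGrad β u v x‖ ^ 2) / ∫ x in Ω, ‖u x‖ ^ 2 := by
    intro m u v hm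
    have h1 := hm.weak_eq u v hm.isH1
    rw [← inner_toLp (memLp_magGrad hΩ β hm.isH1) (memLp_magGrad hΩ β hm.isH1),
      ← inner_toLp hm.isH1.memLp hm.isH1.memLp, inner_self_complex,
      inner_self_complex] at h1
    have h2 : ‖(memLp_magGrad hΩ β hm.isH1).toLp‖ ^ 2 = m * ‖hm.isH1.memLp.toLp‖ ^ 2 := by
      exact_mod_cast h1
    rw [norm_sq_toLp, norm_sq_toLp] at h2
    rw [h2, mul_div_cancel_right₀ _ (hpos u v hm.isH1 hm.ne_zero).ne']
  have hbd : BddBelow {r | ∃ u v, IsH1 Ω u v ∧ ¬ u =ᵐ[volume.restrict Ω] 0 ∧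
      r = (∫ x in Ω, ‖magGrad β u v x‖ ^ 2) / ∫ x in Ω, ‖u x‖ ^ 2} := by
    refine ⟨μ 0, ?_⟩
    rintro _ ⟨u, v, hu, h0, rfl⟩
    rw [le_div_iff₀ (hpos u v hu h0)]
    exact key u v hu
  have hle : ∀ m ∈ neumannEigenvalues Ω β, lambda1 Ω β ≤ m := by
    rintro m ⟨u, v, hm⟩
    exact csInf_le hbd ⟨u, v, hm.isH1, hm.ne_zero, hR m u v hm⟩
  have hmem : μ 0 ∈ neumannEigenvalues Ω β := ⟨_, _, hw 0⟩
  have heq : lambda1 Ω β = μ 0 := by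
    refine le_antisymm (hle _ hmem) (le_csInf
      ⟨_, _, _, (hw 0).isH1, (hw 0).ne_zero, rfl⟩ ?_)
    rintro _ ⟨u, v, hu, h0, rfl⟩
    rw [le_div_iff₀ (hpos u v hu h0)]
    exact key u v hu
  exact ⟨heq ▸ hmem, hle⟩

/-! ### The de Gennes constant -/

/-- `μ` is an eigenvalue of `-f'' + (ξ + t)² f = μ f` on `(0, ∞)`, `f'(0) = 0`:
there is a nonzero square integrable solution `f` (with derivative `f'`). -/
def IsDeGennesEigenvalue (ξ μ : ℝ) : Prop :=
  ∃ f f' : ℝ → ℝ,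
    (∀ t ∈ Ici (0 : ℝ), HasDerivWithinAt f (f' t) (Ici 0) t) ∧
    (∀ t ∈ Ici (0 : ℝ), HasDerivWithinAt f' (((ξ + t) ^ 2 - μ) * f t) (Ici 0) t) ∧
    f' 0 = 0 ∧ MemLp f 2 (volume.restrict (Ioi 0)) ∧ ∃ t ∈ Ioi (0 : ℝ), f t ≠ 0

/-- The first eigenvalue `μ₁(ξ)` of the half-line problem with parameter `ξ`. -/
noncomputable def deGennesMu (ξ : ℝ) : ℝ := sInf {μ | IsDeGennesEigenvalue ξ μ}

/-- The de Gennes constant `Θ₀ = min_ξ μ₁(ξ)`. -/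
noncomputable def deGennesConst : ℝ := ⨅ ξ : ℝ, deGennesMu ξ

/-! ### The classes of domains -/

/-- `Ω = {a < x₁ < b, 0 < x₂ < g(x₁)}` for some smooth `g : (a, b) → [0, ∞)`. -/
def IsSubgraph (Ω : Set Plane) : Prop :=
  ∃ (a b : ℝ) (g : ℝ → ℝ), a < b ∧ ContDiffOn ℝ ∞ g (Ioo a b) ∧ (∀ t ∈ Ioo a b, 0 ≤ g t) ∧
    Ω = {x | x 0 ∈ Ioo a b ∧ x 1 ∈ Ioo 0 (g (x 0))}

/-- `Ω` is contained in a half-strip `(a, b) × (0, ∞)` and contains `(a, b) × (0, h)`. -/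
def FillsHalfStripTo (h : ℝ) (Ω : Set Plane) : Prop :=
  ∃ a b : ℝ, a < b ∧ Ω ⊆ {x | x 0 ∈ Ioo a b ∧ x 1 ∈ Ioi 0} ∧
    {x : Plane | x 0 ∈ Ioo a b ∧ x 1 ∈ Ioo 0 h} ⊆ Ω

/-- The boundary of `Ω` is the union of `N = n + 1 ≥ 1` cyclically ordered regular `C^∞` arcs
`γ s : [0, 1] → ℝ²`, disjoint except at the endpoints, where the end of `γ s` meets the beginning
of `γ (s + 1)` (indices mod `N`) with an angle in `(0, 2π)`: that is, the two half-tangents at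
the vertex, `-γ_s'(1)` and `γ_{s+1}'(0)`, do not point in the same direction. -/
def IsCurvilinearPolygon (Ω : Set Plane) : Prop :=
  ∃ (n : ℕ) (γ : Fin (n + 1) → ℝ → Plane),
    (∀ s, ContDiffOn ℝ ∞ (γ s) (Icc 0 1)) ∧
    (∀ s, ∀ t ∈ Icc (0 : ℝ) 1, derivWithin (γ s) (Icc 0 1) t ≠ 0) ∧
    (∀ s, γ s 1 = γ (s + 1) 0) ∧
    (∀ s s', ∀ t ∈ Ico (0 : ℝ) 1, ∀ t' ∈ Ico (0 : ℝ) 1, γ s t = γ s' t' → s = s' ∧ t = t') ∧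
    (∀ s, ¬ SameRay ℝ (-derivWithin (γ s) (Icc 0 1) 1) (derivWithin (γ (s + 1)) (Icc 0 1) 0)) ∧
    frontier Ω = ⋃ s, γ s '' Icc 0 1

/-- `Ω` is the interior of the union of the closures of `m ≥ 2` sets, each of them isometric to
`m^{-1/2} Ω`. -/
def IsSelfTiling (Ω : Set Plane) : Prop :=
  ∃ (m : ℕ) (M : Fin m → Plane ≃ᵢ Plane), 2 ≤ m ∧
    Ω = interior (⋃ i, closure (M i '' ((Real.sqrt m)⁻¹ • Ω)))

/-! Part (A) is a trial function argument. Let `f > 0` be the Neumann ground state of the half-line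
problem at the minimizing parameter `ξ₀ = -√Θ₀`. With a suitable phase `θ`, the half-plane state `u
= exp (iθ) f(√β x₂)` satisfies `|∇ᴬu|² - Θ₀ β |u|² = d/dx₂ [√β (f f')(√β x₂)]` pointwise. Since
`f'(0) = 0` and `f' < 0` on `(0, ∞)`, this density has a negative integral over every vertical
segment `0 < x₂ < T`. It is nonnegative where `√β x₂ ≥ 2 √Θ₀`, so a slice that misses points of the
segment only at such heights has an even smaller integral. Fubini gives the strict inequality
(`lambda1_lt_of_slices`).

The properties of `f` come from an integral representation of the decaying solutions of Weber's
equation (`exists_deGennes_groundState`). At an energy `μ = 1 - 2p` in `(0, 1]` the square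
integrable solution is unique up to a factor and positive on `ℝ`, and on `(-∞, √μ]` its derivative
is largest at `-√μ`. If `μ` is an eigenvalue for some `ξ`, that largest value is therefore
nonnegative. The least `μ` corresponds to the largest such `p`; there the value is zero, so `Θ₀` is
attained at `ξ₀ = -√Θ₀`.

Part (B) needs no model operators at the corners. Near each point of its closure, a curvilinear
polygon is invariant under dilations in a chart composed of isometries and shears of small slope.
Shears preserve area, hence the magnetic field up to a gauge, and they change energies by a factor
close to 1. Localizing a function by a partition of unity and contracting each piece in its chart
passes from the field `β` to any `β' ≥ β`, so `λ₁(β')/β'` is at most `λ₁(β)/β` up to a factor near 1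
and an error `O(1/β)` (`exists_lambda1_div_le`). Hence the upper limit of `λ₁(β)/β` does not exceed
the lower limit. A truncated half-plane state near a smooth boundary point gives `Λ ≤ Θ₀`
(`IsCurvilinearPolygon.exists_lambda1_le`).

Finally, restricting a function on a self-tiling domain to its `m` tiles and rescaling each of them
gives `m λ₁(β) ≤ λ₁(mβ)`. So `λ₁(β)/β` is nondecreasing along `β, mβ, m²β, …` and is bounded by its
limit. -/

/-! ### Decaying solutions of the Weber equation -/

/-- The integral `∫₀^∞ y^p exp (-y²/4 - s y) dy`. -/
noncomputable def weberInt (p s : ℝ) : ℝ :=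
  ∫ y in Ioi (0 : ℝ), y ^ p * Real.exp (-y ^ 2 / 4 - s * y)

/-- A common majorant of the integrands of `weberInt p s` for `0 ≤ p ≤ P` and `-M ≤ s`. -/
noncomputable def weberBound (P M y : ℝ) : ℝ :=
  (1 + y ^ P) * (Real.exp (2 * M ^ 2) * Real.exp (-(1 / 8) * y ^ 2))

theorem integrableOn_weberBound {P : ℝ} (hP : 0 ≤ P) (M : ℝ) :
    IntegrableOn (weberBound P M) (Ioi 0) := by
  have h1 : IntegrableOn (fun y : ℝ => Real.exp (-(1 / 8) * y ^ 2)) (Ioi 0) :=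
    (integrable_exp_neg_mul_sq (by norm_num)).integrableOn
  have h2 := integrableOn_rpow_mul_exp_neg_mul_sq (b := 1 / 8) (by norm_num)
    (show (-1 : ℝ) < P by linarith)
  refine ((h1.add h2).const_mul (Real.exp (2 * M ^ 2))).congr (Eventually.of_forall fun y => ?_)
  simp only [weberBound, Pi.add_apply]
  ring

theorem weber_integrand_le {p P s M y : ℝ} (hp : 0 ≤ p) (hpP : p ≤ P) (hs : -M ≤ s)
    (hy : 0 < y) : ‖y ^ p * Real.exp (-y ^ 2 / 4 - s * y)‖ ≤ weberBound P M y := by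
  have h0 : 0 ≤ y ^ p := Real.rpow_nonneg hy.le p
  have hP : 0 ≤ y ^ P := Real.rpow_nonneg hy.le P
  rw [Real.norm_of_nonneg (by positivity)]
  unfold weberBound
  have h1 : y ^ p ≤ 1 + y ^ P := by
    rcases le_total y 1 with h | h
    · linarith [Real.rpow_le_one hy.le h hp]
    · linarith [Real.rpow_le_rpow_of_exponent_le h hpP]
  have h2 : Real.exp (-y ^ 2 / 4 - s * y)
      ≤ Real.exp (2 * M ^ 2) * Real.exp (-(1 / 8) * y ^ 2) := by
    rw [← Real.exp_add]
    refine Real.exp_le_exp.2 ?_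
    nlinarith [sq_nonneg (y - 4 * M), mul_nonneg (by linarith : 0 ≤ s + M) hy.le]
  gcongr

theorem measurable_weber_integrand (p s : ℝ) :
    AEStronglyMeasurable (fun y : ℝ => y ^ p * Real.exp (-y ^ 2 / 4 - s * y))
      (volume.restrict (Ioi 0)) := by
  have : Measurable fun y : ℝ => y ^ p * Real.exp (-y ^ 2 / 4 - s * y) := by fun_prop
  exact this.aestronglyMeasurable

theorem integrableOn_weber {p : ℝ} (hp : 0 ≤ p) (s : ℝ) :
    IntegrableOn (fun y : ℝ => y ^ p * Real.exp (-y ^ 2 / 4 - s * y)) (Ioi 0) := by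
  refine (integrableOn_weberBound hp (-s)).mono' (measurable_weber_integrand p s) ?_
  filter_upwards [ae_restrict_mem measurableSet_Ioi] with y hy
  exact weber_integrand_le hp le_rfl (by simp) hy

theorem weberInt_pos {p : ℝ} (hp : 0 ≤ p) (s : ℝ) : 0 < weberInt p s := by
  unfold weberInt
  have hpos : ∀ y ∈ Ioi (0 : ℝ), 0 < y ^ p * Real.exp (-y ^ 2 / 4 - s * y) := fun y hy =>
    mul_pos (Real.rpow_pos_of_pos hy p) (Real.exp_pos _)
  rw [setIntegral_pos_iff_support_of_nonneg_ae _ (integrableOn_weber hp s)]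
  · refine lt_of_lt_of_le ?_ (measure_mono (s := Ioi 0) fun y hy => ⟨(hpos y hy).ne', hy⟩)
    simp
  · filter_upwards [ae_restrict_mem measurableSet_Ioi] with y hy
    exact (hpos y hy).le

/-- Joint continuity is needed because the energy is varied through `p`, and later the point `s =
-√(1 - 2p)` moves with `p`. -/
theorem continuousOn_weberInt :
    ContinuousOn (fun x : ℝ × ℝ => weberInt x.1 x.2) {x | 0 ≤ x.1} := by
  intro x hx
  unfold weberInt
  have hb := integrableOn_weberBound (P := x.1 + 1) (by have : 0 ≤ x.1 := hx; linarith) (|x.2| + 1)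
  refine continuousWithinAt_of_dominated (bound := weberBound (x.1 + 1) (|x.2| + 1)) ?_ ?_ hb ?_
  · exact Eventually.of_forall fun z => measurable_weber_integrand z.1 z.2
  · have h1 : ∀ᶠ z : ℝ × ℝ in 𝓝[{x | 0 ≤ x.1}] x, z.1 < x.1 + 1 :=
      nhdsWithin_le_nhds (continuous_fst.continuousAt.eventually_lt continuousAt_const (by simp))
    have h2 : ∀ᶠ z : ℝ × ℝ in 𝓝[{x | 0 ≤ x.1}] x, -(|x.2| + 1) < z.2 :=
      nhdsWithin_le_nhds (continuousAt_const.eventually_lt continuous_snd.continuousAt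
        (by linarith [neg_abs_le x.2]))
    filter_upwards [h1, h2, self_mem_nhdsWithin] with z h1 h2 h3
    filter_upwards [ae_restrict_mem measurableSet_Ioi] with y hy
    exact weber_integrand_le h3 h1.le h2.le hy
  · filter_upwards [ae_restrict_mem measurableSet_Ioi] with y hy
    refine Continuous.continuousWithinAt ?_
    have := Real.continuous_const_rpow (a := y) (ne_of_gt hy)
    fun_prop

theorem hasDerivAt_weberInt {p : ℝ} (hp : 0 ≤ p) (s : ℝ) :
    HasDerivAt (weberInt p) (-weberInt (p + 1) s) s := by
  unfold weberInt
  rw [← integral_neg]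
  have hp1 : 0 ≤ p + 1 := by linarith
  have hs : -(|s| + 1) < s := by linarith [neg_abs_le s]
  refine (hasDerivAt_integral_of_dominated_loc_of_deriv_le (F := fun s y => y ^ p *
    Real.exp (-y ^ 2 / 4 - s * y))
    (F' := fun s y => -(y ^ (p + 1) * Real.exp (-y ^ 2 / 4 - s * y)))
    (bound := weberBound (p + 1) (|s| + 1)) (Ioi_mem_nhds hs) ?_ (integrableOn_weber hp s) ?_
    ?_ (integrableOn_weberBound hp1 _) ?_).2
  · exact Eventually.of_forall fun z => measurable_weber_integrand p z
  · exact (measurable_weber_integrand (p + 1) s).neg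
  · filter_upwards [ae_restrict_mem measurableSet_Ioi] with y hy z hz
    rw [norm_neg]
    exact weber_integrand_le hp1 le_rfl (le_of_lt hz) hy
  · filter_upwards [ae_restrict_mem measurableSet_Ioi] with y hy z hz
    have h : HasDerivAt (fun z : ℝ => -y ^ 2 / 4 - z * y) (-(1 * y)) z :=
      ((hasDerivAt_id z).mul_const y).const_sub _
    refine (h.exp.const_mul (y ^ p)).congr_deriv ?_
    rw [Real.rpow_add_one (ne_of_gt hy)]
    ring

theorem tendsto_weber_integrand (p s : ℝ) :
    Tendsto (fun y : ℝ => y ^ p * Real.exp (-y ^ 2 / 4 - s * y)) atTop (𝓝 0) := by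
  have he : Tendsto (fun x : ℝ => Real.exp (-(1 / 2) * x)) atTop (𝓝 0) :=
    Real.tendsto_exp_atBot.comp (tendsto_id.const_mul_atTop_of_neg (by norm_num))
  have h := (rpow_mul_exp_neg_mul_sq_isLittleO_exp_neg (b := 1 / 8) (by norm_num) p).trans_tendsto he
  have h' := h.const_mul (Real.exp (2 * s ^ 2))
  rw [mul_zero] at h'
  refine squeeze_zero' ?_ ?_ h'
  · filter_upwards [eventually_gt_atTop 0] with y hy
    have := Real.rpow_nonneg hy.le p
    positivity
  · filter_upwards [eventually_gt_atTop 0] with y hy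
    have h0 := Real.rpow_nonneg hy.le p
    have h2 : Real.exp (-y ^ 2 / 4 - s * y)
        ≤ Real.exp (2 * s ^ 2) * Real.exp (-(1 / 8) * y ^ 2) := by
      rw [← Real.exp_add]
      refine Real.exp_le_exp.2 ?_
      nlinarith [sq_nonneg (y + 4 * s)]
    calc _ ≤ y ^ p * (Real.exp (2 * s ^ 2) * Real.exp (-(1 / 8) * y ^ 2)) := by gcongr
      _ = _ := by ring

/-- Integration by parts of `d/dy (y^(p+1) exp (-y²/4 - s y))`. With `hasDerivAt_weberInt` it is the
equation `a'' = 2 s a' + 2 (p + 1) a` for `a = weberInt p`, which the factor `exp (-s²/2)` turns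
into Weber's equation at the energy `-1 - 2p`. -/
theorem weberInt_add_two {p : ℝ} (hp : 0 ≤ p) (s : ℝ) :
    weberInt (p + 2) s = 2 * (p + 1) * weberInt p s - 2 * s * weberInt (p + 1) s := by
  have hi := fun q (hq : 0 ≤ q) => integrableOn_weber hq s
  have h0 := hi p hp
  have h1 := hi (p + 1) (by linarith)
  have h2 := hi (p + 2) (by linarith)
  have key := integral_Ioi_of_hasDerivAt_of_tendsto (a := 0) (m := 0)
    (f := fun y : ℝ => y ^ (p + 1) * Real.exp (-y ^ 2 / 4 - s * y))
    (f' := fun y => (p + 1) * (y ^ p * Real.exp (-y ^ 2 / 4 - s * y))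
      - (1 / 2 * (y ^ (p + 2) * Real.exp (-y ^ 2 / 4 - s * y))
        + s * (y ^ (p + 1) * Real.exp (-y ^ 2 / 4 - s * y)))) ?_ ?_ ?_
    (tendsto_weber_integrand (p + 1) s)
  · rw [integral_sub (h0.const_mul _)
        (by exact (h2.const_mul _).add (h1.const_mul _)),
      integral_add (h2.const_mul _) (h1.const_mul _), integral_const_mul, integral_const_mul,
      integral_const_mul, Real.zero_rpow (by linarith)] at key
    unfold weberInt
    linarith
  · refine ContinuousAt.continuousWithinAt ?_
    have : ContinuousAt (fun y : ℝ => y ^ (p + 1)) 0 :=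
      Real.continuousAt_rpow_const _ _ (Or.inr (by linarith))
    fun_prop
  · intro y hy
    have e1 := Real.hasDerivAt_rpow_const (x := y) (p := p + 1) (Or.inl (ne_of_gt hy))
    have e2 : HasDerivAt (fun y : ℝ => -y ^ 2 / 4 - s * y) (-(2 * y) / 4 - s * 1) y :=
      (((hasDerivAt_pow 2 y).neg.div_const 4).sub ((hasDerivAt_id y).const_mul s)).congr_deriv
        (by simp)
    refine (e1.mul e2.exp).congr_deriv ?_
    have hy' : y ≠ 0 := ne_of_gt hy
    rw [show p + 2 = p + 1 + 1 by ring, Real.rpow_add_one hy' (p + 1), Real.rpow_add_one hy' p,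
      add_sub_cancel_right]
    ring
  · exact (h0.const_mul _).sub ((h2.const_mul _).add (h1.const_mul _))

/-- The same integration by parts one exponent lower; now the boundary term at `y = 0` survives and
produces the constant 2. -/
theorem weberInt_one (s : ℝ) : weberInt 1 s = 2 - 2 * s * weberInt 0 s := by
  have h0 := integrableOn_weber (le_refl 0) s
  have h1 := integrableOn_weber zero_le_one s
  have key := integral_Ioi_of_hasDerivAt_of_tendsto (a := 0) (m := 0)
    (f := fun y : ℝ => y ^ (0 : ℝ) * Real.exp (-y ^ 2 / 4 - s * y))
    (f' := fun y => - (1 / 2 * (y ^ (1 : ℝ) * Real.exp (-y ^ 2 / 4 - s * y))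
        + s * (y ^ (0 : ℝ) * Real.exp (-y ^ 2 / 4 - s * y)))) ?_ ?_ ?_
    (tendsto_weber_integrand 0 s)
  · rw [integral_neg, integral_add (h1.const_mul _) (h0.const_mul _), integral_const_mul,
      integral_const_mul] at key
    simp at key
    unfold weberInt
    simp
    linarith
  · refine Continuous.continuousWithinAt ?_
    simp only [Real.rpow_zero]
    fun_prop
  · intro y hy
    have e2 : HasDerivAt (fun y : ℝ => -y ^ 2 / 4 - s * y) (-(2 * y) / 4 - s * 1) y :=
      (((hasDerivAt_pow 2 y).neg.div_const 4).sub ((hasDerivAt_id y).const_mul s)).congr_deriv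
        (by simp)
    simp only [Real.rpow_zero, Real.rpow_one, one_mul]
    refine e2.exp.congr_deriv ?_
    ring
  · exact ((h1.const_mul _).add (h0.const_mul _)).neg

/-- The pair `(a, a')`, where `a` is obtained from `weberInt p` by applying `k` times the raising
operator `a ↦ 2 s a - a'`. -/
noncomputable def weberPair (p s : ℝ) : ℕ → ℝ × ℝ
  | 0 => (weberInt p s, -weberInt (p + 1) s)
  | k + 1 => (2 * s * (weberPair p s k).1 - (weberPair p s k).2,
      (2 * k - 2 * p) * (weberPair p s k).1)

/-- Each raising step lifts the energy by 2, so the `k`-th function has the energy `2k - 2p - 1`.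
Without raising, `p ≥ 0` reaches only energies at most `-1`. The second component is a derivative
thanks to the equation: `(2 s a - a')' = (2k - 2p) a`. -/
theorem hasDerivAt_weberPair {p : ℝ} (hp : 0 ≤ p) (k : ℕ) (s : ℝ) :
    HasDerivAt (fun s => (weberPair p s k).1) (weberPair p s k).2 s ∧
    HasDerivAt (fun s => (weberPair p s k).2)
      (2 * s * (weberPair p s k).2 + (2 * (p + 1) - 2 * k) * (weberPair p s k).1) s := by
  induction k with
  | zero =>
    refine ⟨hasDerivAt_weberInt hp s, ?_⟩
    refine (hasDerivAt_weberInt (p := p + 1) (by linarith) s).neg.congr_deriv ?_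
    simp only [weberPair]
    rw [show p + 1 + 1 = p + 2 by ring, weberInt_add_two hp]
    push_cast
    ring
  | succ k ih =>
    obtain ⟨h1, h2⟩ := ih
    have h3 : HasDerivAt (fun s : ℝ => 2 * s) 2 s := by
      simpa using (hasDerivAt_id s).const_mul 2
    constructor
    · refine ((h3.mul h1).sub h2).congr_deriv ?_
      simp only [weberPair]
      ring
    · refine (h1.const_mul (2 * k - 2 * p)).congr_deriv ?_
      simp only [weberPair]
      push_cast
      ring

theorem continuousOn_weberPair (k : ℕ) :
    ContinuousOn (fun x : ℝ × ℝ => weberPair x.1 x.2 k) {x | 0 ≤ x.1} := by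
  induction k with
  | zero =>
    refine continuousOn_weberInt.prodMk (ContinuousOn.neg ?_)
    refine continuousOn_weberInt.comp (f := fun x : ℝ × ℝ => (x.1 + 1, x.2)) (by fun_prop) ?_
    intro x (hx : 0 ≤ x.1)
    change 0 ≤ x.1 + 1
    linarith
  | succ k ih =>
    have h1 := continuous_fst.comp_continuousOn ih
    have h2 := continuous_snd.comp_continuousOn ih
    simp only [Function.comp_def] at h1 h2
    simp only [weberPair]
    fun_prop

theorem weberInt_antitone {p : ℝ} (hp : 0 ≤ p) : Antitone (weberInt p) := by
  refine antitone_of_hasDerivAt_nonpos (fun s => hasDerivAt_weberInt hp s) fun s => ?_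
  simpa using (weberInt_pos (by linarith : 0 ≤ p + 1) s).le

theorem weberPair_bound {p : ℝ} (hp : 0 ≤ p) (k : ℕ) (ξ : ℝ) :
    ∃ C, 0 ≤ C ∧ ∀ s, ξ ≤ s → |(weberPair p s k).1| ≤ C * (1 + |s|) ^ k ∧
      |(weberPair p s k).2| ≤ C * (1 + |s|) ^ k := by
  induction k with
  | zero =>
    have h0 := weberInt_pos hp
    have h1 := weberInt_pos (by linarith : 0 ≤ p + 1)
    refine ⟨weberInt p ξ + weberInt (p + 1) ξ, by linarith [h0 ξ, h1 ξ], fun s hs => ?_⟩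
    simp only [weberPair, pow_zero, mul_one, abs_neg, abs_of_pos (h0 s), abs_of_pos (h1 s)]
    have := weberInt_antitone hp hs
    have := weberInt_antitone (by linarith : 0 ≤ p + 1) hs
    constructor <;> linarith [h0 ξ, h1 ξ]
  | succ k ih =>
    obtain ⟨C, hC, h⟩ := ih
    refine ⟨3 * C + |2 * (k : ℝ) - 2 * p| * C, by positivity, fun s hs => ?_⟩
    obtain ⟨h1, h2⟩ := h s hs
    have hs0 := abs_nonneg s
    have hp0 : 0 ≤ C * (1 + |s|) ^ k := by positivity
    simp only [weberPair]
    have hm : 0 ≤ |2 * (k : ℝ) - 2 * p| := abs_nonneg _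
    rw [pow_succ]
    constructor
    · refine (abs_sub _ _).trans ?_
      rw [abs_mul, abs_mul, abs_two]
      have : 2 * |s| * |(weberPair p s k).1| ≤ 2 * |s| * (C * (1 + |s|) ^ k) := by gcongr
      nlinarith [mul_nonneg hs0 hp0, mul_nonneg hm hp0, mul_nonneg hm (mul_nonneg hs0 hp0)]
    · rw [abs_mul]
      have : |2 * (k : ℝ) - 2 * p| * |(weberPair p s k).1|
        ≤ |2 * (k : ℝ) - 2 * p| * (C * (1 + |s|) ^ k) := by gcongr
      nlinarith [mul_nonneg hs0 hp0, mul_nonneg hm hp0, mul_nonneg hm (mul_nonneg hs0 hp0)]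

/-- The bound `|a'| ≤ s a` is carried along because it yields `2 s a - a' ≥ s a > 0`, the positivity
of the next function. -/
theorem weberPair_eventually_pos {p : ℝ} (hp : 0 ≤ p) (k : ℕ) :
    ∀ᶠ s in atTop, 0 < (weberPair p s k).1 ∧ |(weberPair p s k).2| ≤ s * (weberPair p s k).1 := by
  induction k with
  | zero =>
    filter_upwards [eventually_ge_atTop (p + 2)] with s hs
    have h0 := weberInt_pos hp s
    have h1 := weberInt_pos (by linarith : 0 ≤ p + 1) s
    have h2 := weberInt_pos (by linarith : 0 ≤ p + 2) s
    rw [weberInt_add_two hp] at h2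
    simp only [weberPair, abs_neg, abs_of_pos h1]
    refine ⟨h0, ?_⟩
    -- Positivity of `weberInt (p + 2)` gives `s * weberInt (p + 1) s < (p + 1) * weberInt p s`, and
    -- `s ≥ p + 2`.
    have : s * weberInt (p + 1) s ≤ s * (s * weberInt p s) := by
      nlinarith [mul_nonneg (by linarith : 0 ≤ s - (p + 1)) h0.le,
        mul_nonneg (mul_nonneg (by linarith : 0 ≤ s) (by linarith : 0 ≤ s - 1)) h0.le]
    exact le_of_mul_le_mul_left this (by linarith)
  | succ k ih =>
    filter_upwards [ih, eventually_ge_atTop (1 + |2 * (k : ℝ) - 2 * p|)] with s h hs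
    obtain ⟨h1, h2⟩ := h
    have hm : 0 ≤ |2 * (k : ℝ) - 2 * p| := abs_nonneg _
    simp only [weberPair, abs_mul, abs_of_pos h1]
    have h3 : s * (weberPair p s k).1 ≤ 2 * s * (weberPair p s k).1 - (weberPair p s k).2 := by
      linarith [le_abs_self (weberPair p s k).2]
    have h4 : 0 < s * (weberPair p s k).1 := mul_pos (by linarith) h1
    refine ⟨by linarith, ?_⟩
    have h5 : s * (s * (weberPair p s k).1)
      ≤ s * (2 * s * (weberPair p s k).1 - (weberPair p s k).2) :=
        mul_le_mul_of_nonneg_left h3 (by linarith)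
    refine le_trans ?_ h5
    nlinarith


/-! ### Weber functions as eigenfunctions of the half-line problem. -/

/-- The Weber function `exp (-s²/2) a(s)` with `a = weberPair p · k`. -/
noncomputable def weberFun (p : ℝ) (k : ℕ) (s : ℝ) : ℝ :=
  Real.exp (-s ^ 2 / 2) * (weberPair p s k).1

/-- The derivative of `weberFun`. -/
noncomputable def weberFunDeriv (p : ℝ) (k : ℕ) (s : ℝ) : ℝ :=
  Real.exp (-s ^ 2 / 2) * ((weberPair p s k).2 - s * (weberPair p s k).1)

theorem hasDerivAt_exp_neg_sq_half (s : ℝ) :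
    HasDerivAt (fun s : ℝ => Real.exp (-s ^ 2 / 2)) (Real.exp (-s ^ 2 / 2) * (-s)) s := by
  have h : HasDerivAt (fun s : ℝ => -s ^ 2 / 2) (-s) s :=
    ((hasDerivAt_pow 2 s).neg.div_const 2).congr_deriv (by simp; ring)
  exact h.exp

theorem hasDerivAt_weberFun {p : ℝ} (hp : 0 ≤ p) (k : ℕ) (s : ℝ) :
    HasDerivAt (weberFun p k) (weberFunDeriv p k s) s := by
  refine ((hasDerivAt_exp_neg_sq_half s).mul (hasDerivAt_weberPair hp k s).1).congr_deriv ?_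
  unfold weberFunDeriv
  ring

theorem hasDerivAt_weberFunDeriv {p : ℝ} (hp : 0 ≤ p) (k : ℕ) (s : ℝ) :
    HasDerivAt (weberFunDeriv p k) ((s ^ 2 - (2 * k - 2 * p - 1)) * weberFun p k s) s := by
  obtain ⟨h1, h2⟩ := hasDerivAt_weberPair hp k s
  refine ((hasDerivAt_exp_neg_sq_half s).mul (h2.sub ((hasDerivAt_id s).mul h1))).congr_deriv ?_
  simp only [weberFun, id, Pi.sub_apply, Pi.mul_apply]
  ring

theorem one_add_abs_pow_le (n : ℕ) (s : ℝ) :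
    (1 + |s|) ^ n ≤ n.factorial * Real.exp 2 * Real.exp (s ^ 2 / 4) := by
  have h := Real.pow_div_factorial_le_exp (1 + |s|) (by positivity) n
  rw [div_le_iff₀ (by positivity)] at h
  have h2 : Real.exp (1 + |s|) ≤ Real.exp 2 * Real.exp (s ^ 2 / 4) := by
    rw [← Real.exp_add]
    refine Real.exp_le_exp.2 ?_
    nlinarith [sq_nonneg (|s| - 2), sq_abs s]
  calc _ ≤ _ := h
    _ ≤ (Real.exp 2 * Real.exp (s ^ 2 / 4)) * n.factorial := by gcongr
    _ = _ := by ring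

theorem weberFun_bound {p : ℝ} (hp : 0 ≤ p) (k : ℕ) (ξ : ℝ) :
    ∃ C, 0 ≤ C ∧ ∀ s, ξ ≤ s → |weberFun p k s| ≤ C * Real.exp (-s ^ 2 / 4) ∧
      |weberFunDeriv p k s| ≤ C * Real.exp (-s ^ 2 / 4) := by
  obtain ⟨C, hC, h⟩ := weberPair_bound hp k ξ
  refine ⟨C * ((k + 1).factorial * Real.exp 2), by positivity, fun s hs => ?_⟩
  obtain ⟨h1, h2⟩ := h s hs
  have hs0 := abs_nonneg s
  have hk : (1 + |s|) ^ k ≤ (1 + |s|) ^ (k + 1) :=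
    pow_le_pow_right₀ (by linarith) (Nat.le_succ k)
  have e : Real.exp (-s ^ 2 / 2) * Real.exp (s ^ 2 / 4) = Real.exp (-s ^ 2 / 4) := by
    rw [← Real.exp_add]; congr 1; ring
  have key : ∀ z : ℝ, |z| ≤ C * (1 + |s|) ^ (k + 1) → |Real.exp (-s ^ 2 / 2) * z|
      ≤ C * ((k + 1).factorial * Real.exp 2) * Real.exp (-s ^ 2 / 4) := by
    intro z hz
    rw [abs_mul, abs_of_pos (Real.exp_pos _)]
    calc _ ≤ Real.exp (-s ^ 2 / 2) *
          (C * ((k + 1).factorial * Real.exp 2 * Real.exp (s ^ 2 / 4))) := by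
          gcongr
          exact hz.trans (by gcongr; exact one_add_abs_pow_le (k + 1) s)
      _ = C * ((k + 1).factorial * Real.exp 2) *
          (Real.exp (-s ^ 2 / 2) * Real.exp (s ^ 2 / 4)) := by ring
      _ = _ := by rw [e]
  refine ⟨key _ (h1.trans (by gcongr)), key _ ?_⟩
  refine (abs_sub _ _).trans ?_
  rw [abs_mul, pow_succ]
  have : |s| * |(weberPair p s k).1| ≤ |s| * (C * (1 + |s|) ^ k) := by gcongr
  linarith

theorem tendsto_weberFun {p : ℝ} (hp : 0 ≤ p) (k : ℕ) :
    Tendsto (weberFun p k) atTop (𝓝 0) ∧ Tendsto (weberFunDeriv p k) atTop (𝓝 0) := by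
  obtain ⟨C, -, h⟩ := weberFun_bound hp k 0
  have he : Tendsto (fun s : ℝ => C * Real.exp (-s ^ 2 / 4)) atTop (𝓝 0) := by
    rw [← mul_zero C]
    refine (Real.tendsto_exp_atBot.comp ?_).const_mul C
    have := (tendsto_pow_atTop (two_ne_zero)).const_mul_atTop_of_neg
      (show (-(1 / 4) : ℝ) < 0 by norm_num)
    exact this.congr fun s => by ring
  constructor
  · refine squeeze_zero_norm' ?_ he
    filter_upwards [eventually_ge_atTop 0] with s hs using (h s hs).1
  · refine squeeze_zero_norm' ?_ he
    filter_upwards [eventually_ge_atTop 0] with s hs using (h s hs).2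

theorem memLp_weberFun {p : ℝ} (hp : 0 ≤ p) (k : ℕ) (ξ : ℝ) :
    MemLp (fun t => weberFun p k (ξ + t)) 2 (volume.restrict (Ioi 0)) := by
  obtain ⟨C, -, h⟩ := weberFun_bound hp k ξ
  have hc : Continuous (weberFun p k) :=
    continuous_iff_continuousAt.2 fun s => (hasDerivAt_weberFun hp k s).continuousAt
  have hg : MemLp (fun t : ℝ => C * Real.exp (-(ξ + t) ^ 2 / 4)) 2 (volume.restrict (Ioi 0)) := by
    refine MemLp.restrict _ ?_
    rw [memLp_two_iff_integrable_sq (by fun_prop : Continuous _).aestronglyMeasurable]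
    have := ((integrable_exp_neg_mul_sq (b := 1 / 2) (by norm_num)).comp_add_left ξ).const_mul
      (C ^ 2)
    refine this.congr (Eventually.of_forall fun t => ?_)
    simp only [mul_pow, ← Real.exp_nat_mul]
    congr 2
    push_cast
    ring
  refine hg.mono (hc.comp (by fun_prop)).aestronglyMeasurable ?_
  filter_upwards [ae_restrict_mem measurableSet_Ioi] with t ht
  have ht' : (0 : ℝ) < t := ht
  exact ((h (ξ + t) (by linarith)).1).trans (le_abs_self _)

/-- The hypothesis is the Neumann condition, that `weberFunDeriv` vanishes at `ξ`. The function is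
nonzero since it is positive near infinity. -/
theorem isDeGennesEigenvalue_weber {p : ℝ} (hp : 0 ≤ p) (k : ℕ) {ξ : ℝ}
    (h : ξ * (weberPair p ξ k).1 - (weberPair p ξ k).2 = 0) :
    IsDeGennesEigenvalue ξ (2 * k - 2 * p - 1) := by
  refine ⟨fun t => weberFun p k (ξ + t), fun t => weberFunDeriv p k (ξ + t), fun t _ => ?_,
    fun t _ => ?_, ?_, memLp_weberFun hp k ξ, ?_⟩
  · exact ((hasDerivAt_weberFun hp k (ξ + t)).comp_const_add ξ t).hasDerivWithinAt
  · exact ((hasDerivAt_weberFunDeriv hp k (ξ + t)).comp_const_add ξ t).hasDerivWithinAt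
  · simp only [weberFunDeriv, add_zero]
    rw [← neg_sub, h]
    simp
  · have h1 := (tendsto_atTop_add_const_left atTop ξ tendsto_id).eventually
      (weberPair_eventually_pos hp k)
    obtain ⟨t, h2, ht⟩ := (h1.and (eventually_gt_atTop 0)).exists
    exact ⟨t, ht, (mul_pos (Real.exp_pos _) h2.1).ne'⟩

theorem weberPair_zero_one (s : ℝ) : weberPair 0 s 1 = (2, 0) := by
  simp only [weberPair, zero_add, weberInt_one]
  ext <;> simp

/-- At `p = 0` these are multiples of the Hermite polynomials. If the Neumann expression stayed
positive for all `k`, induction would keep `a > 0` and `a' ≥ 0`; but it equals `(2ξ² - 2(k + 1)) a -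
ξ a'` in terms of the preceding pair, which is negative once `k > ξ²`. -/
theorem exists_weberPair_nonpos {ξ : ℝ} (hξ : 0 < ξ) :
    ∃ k : ℕ, ξ * (weberPair 0 ξ (k + 1)).1 - (weberPair 0 ξ (k + 1)).2 ≤ 0 := by
  by_contra! hQ
  have hrec : ∀ k : ℕ, (weberPair 0 ξ (k + 2)).1
      = 2 * ξ * (weberPair 0 ξ (k + 1)).1 - (weberPair 0 ξ (k + 1)).2 := fun k => rfl
  have hrec2 : ∀ k : ℕ, (weberPair 0 ξ (k + 2)).2
      = (2 * (k + 1 : ℕ) - 2 * 0) * (weberPair 0 ξ (k + 1)).1 := fun k => rfl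
  have hpos : ∀ k : ℕ, 0 < (weberPair 0 ξ (k + 1)).1 ∧ 0 ≤ (weberPair 0 ξ (k + 1)).2 := by
    intro k
    induction k with
    | zero => simp [weberPair_zero_one]
    | succ k ih =>
      refine ⟨?_, ?_⟩
      · rw [hrec]
        nlinarith [hQ k, mul_pos hξ ih.1]
      · rw [hrec2]
        exact mul_nonneg (by push_cast; linarith [(Nat.cast_nonneg k : (0:ℝ) ≤ k)]) ih.1.le
  obtain ⟨k, hk⟩ := exists_nat_gt (ξ ^ 2)
  have h1 := hQ (k + 1)
  rw [hrec2, hrec] at h1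
  obtain ⟨h2, h3⟩ := hpos k
  push_cast at h1
  nlinarith [mul_nonneg hξ.le h3, mul_pos (sub_pos.2 hk) h2]

/-- The condition on `k` says that the energy `2k - 2p - 1` is at most 0. -/
theorem weberPair_sign {p : ℝ} {s : ℝ} (hs : 0 ≤ s) (hp : 0 ≤ p) (k : ℕ) (hk : (k : ℝ) ≤ p + 1 / 2) :
    0 < (weberPair p s k).1 ∧ (weberPair p s k).2 < 0 := by
  induction k with
  | zero => exact ⟨weberInt_pos hp s, by simpa [weberPair] using weberInt_pos (by linarith) s⟩
  | succ k ih =>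
    push_cast at hk
    obtain ⟨h1, h2⟩ := ih (by linarith)
    simp only [weberPair]
    exact ⟨by nlinarith [mul_nonneg hs h1.le], mul_neg_of_neg_of_pos (by linarith) h1⟩

/-- For energies at most 1 the Weber function is positive on the whole line: its polynomial-type
factor has derivative `-2p * weberInt p ≤ 0` and is positive near infinity. -/
theorem weberPair_one_pos {p : ℝ} (hp : 0 ≤ p) (s : ℝ) : 0 < (weberPair p s 1).1 := by
  have hanti : Antitone fun s => (weberPair p s 1).1 := by
    refine antitone_of_hasDerivAt_nonpos (fun s => (hasDerivAt_weberPair hp 1 s).1) fun s => ?_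
    have := weberInt_pos hp s
    simp only [weberPair]
    push_cast
    exact mul_nonpos_of_nonpos_of_nonneg (by linarith) this.le
  obtain ⟨t, ht, hst⟩ := ((weberPair_eventually_pos hp 1).and (eventually_ge_atTop s)).exists
  exact ht.1.trans_le (hanti hst)

/-- As `p` runs from 0 to `k - 1/2` the energy runs from `2k - 1` to 0; the Neumann expression
changes sign on the way. -/
theorem exists_weber_root {k : ℕ} {ξ : ℝ} (hk : 1 ≤ k)
    (h0 : ξ * (weberPair 0 ξ k).1 - (weberPair 0 ξ k).2 ≤ 0)
    (h1 : 0 ≤ ξ * (weberPair (k - 1 / 2) ξ k).1 - (weberPair (k - 1 / 2) ξ k).2) :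
    ∃ μ, IsDeGennesEigenvalue ξ μ := by
  have hk' : (1 : ℝ) ≤ k := by exact_mod_cast hk
  have hc : ContinuousOn (fun p => ξ * (weberPair p ξ k).1 - (weberPair p ξ k).2)
      (Icc 0 (k - 1 / 2)) := by
    have h := (continuousOn_weberPair k).comp (f := fun p : ℝ => (p, ξ)) (s := Icc 0 ((k : ℝ) - 1 / 2))
      (by fun_prop) fun p hp => hp.1
    simp only [Function.comp_def] at h
    fun_prop
  obtain ⟨p, hp, h⟩ := intermediate_value_Icc (by linarith) hc ⟨h0, h1⟩
  exact ⟨_, isDeGennesEigenvalue_weber hp.1 k h⟩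

/-- Existence matters for `deGennesMu`, since `sInf ∅ = 0` would lower the infimum over `ξ`. -/
theorem exists_isDeGennesEigenvalue (ξ : ℝ) : ∃ μ, IsDeGennesEigenvalue ξ μ := by
  rcases le_or_gt ξ 0 with hξ | hξ
  · rcases hξ.eq_or_lt with rfl | hξ
    · exact ⟨_, isDeGennesEigenvalue_weber le_rfl 1 (by simp [weberPair_zero_one])⟩
    by_cases h1 : 0 ≤ ξ * (weberPair ((1 : ℕ) - 1 / 2) ξ 1).1 - (weberPair ((1 : ℕ) - 1 / 2) ξ 1).2
    · exact exists_weber_root le_rfl (by simp [weberPair_zero_one]; linarith) h1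
    · refine absurd ?_ h1
      push_cast
      rw [show (1 - 1 / 2 : ℝ) = 1 / 2 by norm_num]
      have hp : (0 : ℝ) ≤ 1 / 2 := by norm_num
      -- At `p = 1/2` the energy is 0 and the equation reads `f'' = s² f ≥ 0`; since `f'` tends to 0
      -- at infinity, `f' ≤ 0` everywhere.
      have hmono : Monotone (weberFunDeriv (1 / 2) 1) := by
        refine monotone_of_hasDerivAt_nonneg (fun s => hasDerivAt_weberFunDeriv hp 1 s) fun s => ?_
        have : 0 < weberFun (1 / 2) 1 s := mul_pos (Real.exp_pos _) (weberPair_one_pos hp s)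
        norm_num
        positivity
      have h := hmono.ge_of_tendsto (tendsto_weberFun hp 1).2 ξ
      unfold weberFunDeriv at h
      have := nonpos_of_mul_nonpos_right h (Real.exp_pos _)
      linarith
  · obtain ⟨k, hk⟩ := exists_weberPair_nonpos hξ
    refine exists_weber_root (Nat.succ_pos k) hk ?_
    have hp : (0 : ℝ) ≤ ((k + 1 : ℕ) : ℝ) - 1 / 2 := by push_cast; linarith [(Nat.cast_nonneg k : (0:ℝ) ≤ k)]
    obtain ⟨h1, h2⟩ := weberPair_sign hξ.le hp (k + 1) (by linarith)
    nlinarith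

/-- The Weber function at the energy `μ = 1 - 2 p`. -/
theorem deGennes_crit_of_root {p ξ : ℝ} (hp : 0 ≤ p) (hp2 : p ≤ 1 / 2)
    (h : weberFunDeriv p 1 ξ = 0) : 0 ≤ weberFunDeriv p 1 (-Real.sqrt (1 - 2 * p)) := by
  set m := Real.sqrt (1 - 2 * p) with hm
  have hm0 : 0 ≤ m := Real.sqrt_nonneg _
  have hm2 : m ^ 2 = 1 - 2 * p := Real.sq_sqrt (by linarith)
  have hpos : ∀ s, 0 < weberFun p 1 s := fun s => mul_pos (Real.exp_pos _) (weberPair_one_pos hp s)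
  have hd : ∀ s, HasDerivAt (weberFunDeriv p 1) ((s ^ 2 - m ^ 2) * weberFun p 1 s) s := by
    intro s
    refine (hasDerivAt_weberFunDeriv hp 1 s).congr_deriv ?_
    rw [hm2]; push_cast; ring
  have hc : Continuous (weberFunDeriv p 1) :=
    continuous_iff_continuousAt.2 fun s => (hd s).continuousAt
  -- By `f'' = (s² - m²) f`, the derivative `f'` increases up to `-m` and decreases on `[-m, m]`.
  -- Its value at `-m` therefore dominates its value 0 at any root `ξ ≤ m`.
  rcases le_total ξ (-m) with h1 | h1
  · have hmono : MonotoneOn (weberFunDeriv p 1) (Iic (-m)) := by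
      refine monotoneOn_of_deriv_nonneg (convex_Iic _) hc.continuousOn
        (fun s _ => (hd s).differentiableAt.differentiableWithinAt) fun s hs => ?_
      rw [interior_Iic] at hs
      rw [(hd s).deriv]
      have : s < -m := hs
      exact mul_nonneg (by nlinarith) (hpos s).le
    rw [← h]
    exact hmono h1 (mem_Iic.2 le_rfl) h1
  rcases le_total ξ m with h2 | h2
  · have hanti : AntitoneOn (weberFunDeriv p 1) (Icc (-m) m) := by
      refine antitoneOn_of_deriv_nonpos (convex_Icc _ _) hc.continuousOn
        (fun s _ => (hd s).differentiableAt.differentiableWithinAt) fun s hs => ?_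
      rw [interior_Icc] at hs
      rw [(hd s).deriv]
      exact mul_nonpos_of_nonpos_of_nonneg (by nlinarith [hs.1, hs.2]) (hpos s).le
    rw [← h]
    exact hanti ⟨le_rfl, by linarith⟩ ⟨h1, h2⟩ h1
  -- A root beyond `m` would make `f'` nonnegative and `f` nondecreasing from there on, against `f >
  -- 0` and `f → 0`.
  · exfalso
    have hmono : MonotoneOn (weberFunDeriv p 1) (Ici ξ) := by
      refine monotoneOn_of_deriv_nonneg (convex_Ici _) hc.continuousOn
        (fun s _ => (hd s).differentiableAt.differentiableWithinAt) fun s hs => ?_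
      rw [interior_Ici] at hs
      rw [(hd s).deriv]
      have : ξ < s := hs
      exact mul_nonneg (by nlinarith) (hpos s).le
    have hmono2 : MonotoneOn (weberFun p 1) (Ici ξ) := by
      refine monotoneOn_of_deriv_nonneg (convex_Ici _)
        (fun s _ => (hasDerivAt_weberFun hp 1 s).continuousAt.continuousWithinAt)
        (fun s _ => (hasDerivAt_weberFun hp 1 s).differentiableAt.differentiableWithinAt)
        fun s hs => ?_
      rw [interior_Ici] at hs
      rw [(hasDerivAt_weberFun hp 1 s).deriv, ← h]
      exact hmono self_mem_Ici (mem_Ici.2 (le_of_lt hs)) (le_of_lt hs)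
    have : weberFun p 1 ξ ≤ 0 := by
      refine ge_of_tendsto (tendsto_weberFun hp 1).1 ?_
      filter_upwards [eventually_ge_atTop ξ] with s hs
      exact hmono2 self_mem_Ici hs hs
    exact absurd (hpos ξ) this.not_gt

/-- An `L²` solution of `f'' = ((ξ + t)² - μ) f` satisfies `f f' ≤ 0` where the potential is
nonnegative. -/
theorem mul_deriv_nonpos_of_memLp {ξ μ T : ℝ} (hT : 0 ≤ T) {f f' : ℝ → ℝ}
    (hV : ∀ t, T ≤ t → 0 ≤ (ξ + t) ^ 2 - μ)
    (hf : ∀ t ∈ Ici (0 : ℝ), HasDerivWithinAt f (f' t) (Ici 0) t)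
    (hf' : ∀ t ∈ Ici (0 : ℝ), HasDerivWithinAt f' (((ξ + t) ^ 2 - μ) * f t) (Ici 0) t)
    (hL : MemLp f 2 (volume.restrict (Ioi 0))) :
    MonotoneOn (fun t => f t * f' t) (Ici T) ∧ ∀ t, T ≤ t → f t * f' t ≤ 0 := by
  have hsub : Ici T ⊆ Ici (0 : ℝ) := Ici_subset_Ici.2 hT
  have hcf : ContinuousOn f (Ici 0) := fun t ht => (hf t ht).continuousWithinAt
  have hcf' : ContinuousOn f' (Ici 0) := fun t ht => (hf' t ht).continuousWithinAt
  have hat : ∀ t, T < t → HasDerivAt f (f' t) t := fun t ht =>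
    (hf t (hT.trans ht.le)).hasDerivAt (Ici_mem_nhds (hT.trans_lt ht))
  have hat' : ∀ t, T < t → HasDerivAt f' (((ξ + t) ^ 2 - μ) * f t) t := fun t ht =>
    (hf' t (hT.trans ht.le)).hasDerivAt (Ici_mem_nhds (hT.trans_lt ht))
  -- The derivative of `f f'` is `f'² + V f²`, where `V` is the potential minus the energy.
  have hmono : MonotoneOn (fun t => f t * f' t) (Ici T) := by
    refine monotoneOn_of_deriv_nonneg (convex_Ici _) ((hcf.mul hcf').mono hsub) ?_ ?_
    · intro t ht
      rw [interior_Ici] at ht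
      exact ((hat t ht).mul (hat' t ht)).differentiableAt.differentiableWithinAt
    · intro t ht
      rw [interior_Ici] at ht
      rw [((hat t ht).fun_mul (hat' t ht)).deriv]
      have := hV t (le_of_lt ht)
      nlinarith [mul_nonneg this (sq_nonneg (f t)), sq_nonneg (f' t)]
  refine ⟨hmono, fun t₁ ht₁ => ?_⟩
  by_contra! hpos
  -- If `f f'` is positive at `t₁`, then `f²` is nondecreasing from `t₁` on and starts at a positive
  -- value, so it is not integrable.
  have hmono2 : MonotoneOn (fun t => f t ^ 2) (Ici t₁) := by
    refine monotoneOn_of_deriv_nonneg (convex_Ici _) ((hcf.pow 2).mono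
      (Ici_subset_Ici.2 (hT.trans ht₁))) ?_ ?_
    · intro t ht
      rw [interior_Ici] at ht
      exact ((hat t (ht₁.trans_lt ht)).pow 2).differentiableAt.differentiableWithinAt
    · intro t ht
      rw [interior_Ici] at ht
      rw [((hat t (ht₁.trans_lt ht)).fun_pow 2).deriv]
      have h1 := hmono (show t₁ ∈ Ici T from ht₁) (show t ∈ Ici T from ht₁.trans (le_of_lt ht))
        (le_of_lt ht)
      simp only at h1
      norm_num
      nlinarith
  have hne : 0 < f t₁ ^ 2 := by
    have : f t₁ ≠ 0 := by rintro h; rw [h] at hpos; simp at hpos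
    positivity
  have hint : IntegrableOn (fun t => f t ^ 2) (Ioi t₁) :=
    (hL.integrable_sq).mono_measure (Measure.restrict_mono (Ioi_subset_Ioi (hT.trans ht₁)) le_rfl)
  have hc : IntegrableOn (fun _ : ℝ => f t₁ ^ 2) (Ioi t₁) := by
    refine hint.mono' aestronglyMeasurable_const ?_
    filter_upwards [ae_restrict_mem measurableSet_Ioi] with t ht
    rw [Real.norm_of_nonneg hne.le]
    exact hmono2 self_mem_Ici (mem_Ici.2 (le_of_lt ht)) (le_of_lt ht)
  rw [integrableOn_const_iff] at hc
  simp at hc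
  exact hpos.ne' (by rw [hc]; simp)

/-- If `μ ≤ 0`, then `V ≥ 0` on the whole half-line. So `f f'` vanishes at 0, is nondecreasing and
is nonpositive, hence is zero. Then `f²` is constant and integrable on a half-line, hence zero. -/
theorem IsDeGennesEigenvalue.pos {ξ μ : ℝ} (h : IsDeGennesEigenvalue ξ μ) : 0 < μ := by
  obtain ⟨f, f', hf, hf', h0, hL, t₀, ht₀, hne⟩ := h
  by_contra! hμ
  have hV : ∀ t, 0 ≤ t → 0 ≤ (ξ + t) ^ 2 - μ := fun t _ => by nlinarith [sq_nonneg (ξ + t)]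
  obtain ⟨hm, hn⟩ := mul_deriv_nonpos_of_memLp le_rfl hV hf hf' hL
  have hz : ∀ t, 0 ≤ t → f t * f' t = 0 := by
    intro t ht
    refine le_antisymm (hn t ht) ?_
    have := hm self_mem_Ici (show t ∈ Ici (0:ℝ) from ht) ht
    simpa [h0] using this
  have hconst : ∀ t, 0 ≤ t → f t ^ 2 = f 0 ^ 2 := by
    intro t ht
    refine constant_of_has_deriv_right_zero (f := fun t => f t ^ 2) (a := 0) (b := t) ?_ ?_ t
      ⟨ht, le_rfl⟩
    · exact (ContinuousOn.pow (fun s hs => (hf s hs).continuousWithinAt) 2).mono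
        Icc_subset_Ici_self
    · intro s hs
      refine (((hf s hs.1).fun_pow 2).mono (Ici_subset_Ici.2 hs.1)).congr_deriv ?_
      have := hz s hs.1
      norm_num
      rcases mul_eq_zero.1 this with h | h <;> simp [h]
  have hc : IntegrableOn (fun _ : ℝ => f 0 ^ 2) (Ioi 0) := by
    refine Integrable.congr hL.integrable_sq ?_
    filter_upwards [ae_restrict_mem measurableSet_Ioi] with t ht
    exact hconst t (le_of_lt ht)
  rw [integrableOn_const_iff] at hc
  have h2 : f 0 = 0 := by simpa using hc
  have := hconst t₀ (le_of_lt ht₀)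
  rw [h2] at this
  exact hne (by simpa using this)

/-- Below the energy `1`, an eigenfunction of the half-line problem is a Weber function. -/
theorem IsDeGennesEigenvalue.weber_root {ξ μ : ℝ} (h : IsDeGennesEigenvalue ξ μ) (hμ : μ ≤ 1) :
    weberFunDeriv ((1 - μ) / 2) 1 ξ = 0 := by
  have hp : 0 ≤ (1 - μ) / 2 := by linarith
  set p := (1 - μ) / 2 with hp'
  have hμp : μ = 2 * (1 : ℕ) - 2 * p - 1 := by rw [hp']; push_cast; ring
  have hpos : ∀ s, 0 < weberFun p 1 s := fun s => mul_pos (Real.exp_pos _) (weberPair_one_pos hp s)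
  obtain ⟨f, f', hf, hf', h0, hL, t₀, ht₀, hne⟩ := h
  set U := fun t => weberFun p 1 (ξ + t)
  set U' := fun t => weberFunDeriv p 1 (ξ + t)
  have hU : ∀ t, HasDerivAt U (U' t) t := fun t =>
    (hasDerivAt_weberFun hp 1 (ξ + t)).comp_const_add ξ t
  have hU' : ∀ t, HasDerivAt U' (((ξ + t) ^ 2 - μ) * U t) t := fun t => by
    rw [hμp]
    exact (hasDerivAt_weberFunDeriv hp 1 (ξ + t)).comp_const_add ξ t
  obtain ⟨T, hT, hV⟩ : ∃ T, 0 ≤ T ∧ ∀ t, T ≤ t → 0 ≤ (ξ + t) ^ 2 - μ := by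
    refine ⟨|ξ| + 1, by positivity, fun t ht => ?_⟩
    nlinarith [neg_abs_le ξ]
  obtain ⟨-, hn⟩ := mul_deriv_nonpos_of_memLp hT hV hf hf' hL
  have hcf : ContinuousOn f (Ici 0) := fun t ht => (hf t ht).continuousWithinAt
  have hcf' : ContinuousOn f' (Ici 0) := fun t ht => (hf' t ht).continuousWithinAt
  have hat : ∀ t, T < t → HasDerivAt f (f' t) t := fun t ht =>
    (hf t (hT.trans ht.le)).hasDerivAt (Ici_mem_nhds (hT.trans_lt ht))
  have hat' : ∀ t, T < t → HasDerivAt f' (((ξ + t) ^ 2 - μ) * f t) t := fun t ht =>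
    (hf' t (hT.trans ht.le)).hasDerivAt (Ici_mem_nhds (hT.trans_lt ht))
  have hsub : Ici T ⊆ Ici (0 : ℝ) := Ici_subset_Ici.2 hT
  -- Beyond `T` both `f²` and `f'²` are nonincreasing, which bounds `f` and `f'` without any rate of
  -- decay.
  have a1 : AntitoneOn (fun t => f t ^ 2) (Ici T) := by
    refine antitoneOn_of_deriv_nonpos (convex_Ici _) ((hcf.pow 2).mono hsub) ?_ ?_
    · intro t ht
      rw [interior_Ici] at ht
      exact ((hat t ht).pow 2).differentiableAt.differentiableWithinAt
    · intro t ht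
      rw [interior_Ici] at ht
      rw [((hat t ht).fun_pow 2).deriv]
      have := hn t (le_of_lt ht)
      norm_num
      nlinarith
  have a2 : AntitoneOn (fun t => f' t ^ 2) (Ici T) := by
    refine antitoneOn_of_deriv_nonpos (convex_Ici _) ((hcf'.pow 2).mono hsub) ?_ ?_
    · intro t ht
      rw [interior_Ici] at ht
      exact ((hat' t ht).pow 2).differentiableAt.differentiableWithinAt
    · intro t ht
      rw [interior_Ici] at ht
      rw [((hat' t ht).fun_pow 2).deriv]
      have h1 := hn t (le_of_lt ht)
      have h2 := hV t (le_of_lt ht)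
      norm_num
      nlinarith [mul_nonneg h2 (neg_nonneg.2 h1)]
  -- The Wronskian of `f` and the Weber function is constant. It tends to 0 because `f` and `f'` are
  -- bounded while `U` and `U'` decay, so the two solutions are proportional.
  have hw : ∀ t, 0 ≤ t → f t * U' t - f' t * U t = f 0 * U' 0 - f' 0 * U 0 := by
    intro t ht
    refine constant_of_has_deriv_right_zero (f := fun t => f t * U' t - f' t * U t) (a := 0)
      (b := t) ?_ ?_ t ⟨ht, le_rfl⟩
    · intro s hs
      exact (((hf s hs.1).mul (hU' s).hasDerivWithinAt).sub
        ((hf' s hs.1).mul (hU s).hasDerivWithinAt)).continuousWithinAt.mono Icc_subset_Ici_self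
    · intro s hs
      refine ((((hf s hs.1).mul (hU' s).hasDerivWithinAt).sub
        ((hf' s hs.1).mul (hU s).hasDerivWithinAt)).mono (Ici_subset_Ici.2 hs.1)).congr_deriv ?_
      ring
  have hshift : Tendsto (fun t => ξ + t) atTop atTop :=
    tendsto_atTop_add_const_left atTop ξ tendsto_id
  have hlim : Tendsto (fun t => f t * U' t - f' t * U t) atTop (𝓝 (0 - 0)) := by
    refine Tendsto.sub ?_ ?_
    · refine bdd_le_mul_tendsto_zero' |f T| ?_ ((tendsto_weberFun hp 1).2.comp hshift)
      filter_upwards [eventually_ge_atTop T] with t ht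
      exact sq_le_sq.1 (a1 self_mem_Ici ht ht)
    · refine bdd_le_mul_tendsto_zero' |f' T| ?_ ((tendsto_weberFun hp 1).1.comp hshift)
      filter_upwards [eventually_ge_atTop T] with t ht
      exact sq_le_sq.1 (a2 self_mem_Ici ht ht)
  have hw0 : f 0 * U' 0 - f' 0 * U 0 = 0 := by
    refine tendsto_nhds_unique (tendsto_const_nhds.congr' ?_) (by simpa using hlim)
    filter_upwards [eventually_ge_atTop 0] with t ht using (hw t ht).symm
  rw [h0, zero_mul, sub_zero] at hw0
  rcases mul_eq_zero.1 hw0 with hz | hz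
  · exfalso
    -- With zero Wronskian, `f / U` is constant; `f 0 = 0` would force `f = 0`.
    have hq : f t₀ / U t₀ = f 0 / U 0 := by
      refine constant_of_has_deriv_right_zero (f := fun t => f t / U t) (a := 0)
        (b := t₀) ?_ ?_ t₀ ⟨le_of_lt ht₀, le_rfl⟩
      · intro s hs
        exact ((hf s hs.1).div (hU s).hasDerivWithinAt (hpos _).ne').continuousWithinAt.mono
          Icc_subset_Ici_self
      · intro s hs
        refine (((hf s hs.1).div (hU s).hasDerivWithinAt (hpos _).ne').mono
          (Ici_subset_Ici.2 hs.1)).congr_deriv ?_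
        have := hw s hs.1
        rw [h0, hz] at this
        rw [div_eq_zero_iff]
        left
        linarith
    rw [hz, zero_div, div_eq_zero_iff] at hq
    exact hq.elim hne (hpos _).ne'
  · simpa [U'] using hz

/-- The ground state at the de Gennes constant. -/
theorem exists_deGennes_groundState :
    ∃ f f' : ℝ → ℝ, 0 < deGennesConst ∧ (∀ t, HasDerivAt f (f' t) t) ∧
      (∀ t, HasDerivAt f' (((t - Real.sqrt deGennesConst) ^ 2 - deGennesConst) * f t) t) ∧
      f' 0 = 0 ∧ (∀ t, 0 < f t) ∧ ∀ t, 0 < t → f' t < 0 := by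
  -- By `deGennes_crit_of_root`, an energy `1 - 2p ≤ 1` that is an eigenvalue for some `ξ` has `G p
  -- ≥ 0`. Minimizing the energy means maximizing `p` under this constraint, which avoids
  -- differentiating the eigenvalue in `ξ`.
  set G : ℝ → ℝ := fun p => weberFunDeriv p 1 (-Real.sqrt (1 - 2 * p)) with hG
  have hcW : ContinuousOn (fun x : ℝ × ℝ => weberFunDeriv x.1 1 x.2) {x | 0 ≤ x.1} := by
    have h := continuousOn_weberPair 1
    have h1 := continuous_fst.comp_continuousOn h
    have h2 := continuous_snd.comp_continuousOn h
    simp only [Function.comp_def] at h1 h2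
    unfold weberFunDeriv
    fun_prop
  have hGc : ContinuousOn G (Icc 0 (1 / 2)) :=
    hcW.comp (f := fun p : ℝ => (p, -Real.sqrt (1 - 2 * p))) (by fun_prop) fun p hp => hp.1
  have hG0 : 0 < G 0 := by
    simp only [hG, weberFunDeriv, weberPair_zero_one]
    norm_num
    positivity
  have hG1 : G (1 / 2) < 0 := by
    simp only [hG, weberFunDeriv]
    norm_num
    have := weberInt_pos (p := 1 / 2) (by norm_num) 0
    simp only [weberPair]
    norm_num
    positivity
  -- the largest `p` with `0 ≤ G p`
  have hK : IsCompact (Icc (0 : ℝ) (1 / 2) ∩ G ⁻¹' Ici 0) :=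
    isCompact_Icc.of_isClosed_subset (hGc.preimage_isClosed_of_isClosed isClosed_Icc isClosed_Ici)
      inter_subset_left
  obtain ⟨p₀, ⟨hp₀, hGp₀⟩, hmax⟩ := hK.exists_isGreatest ⟨0, ⟨le_rfl, by norm_num⟩, hG0.le⟩
  -- If `G p₀ > 0`, then `G (1/2) < 0` would give a zero of `G` to the right of `p₀`.
  have hGz : G p₀ = 0 := by
    refine le_antisymm ?_ hGp₀
    by_contra! hlt
    obtain ⟨q, hq, hGq⟩ := intermediate_value_Icc' hp₀.2 (hGc.mono (Icc_subset_Icc hp₀.1 le_rfl))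
      (show (0 : ℝ) ∈ Icc (G (1 / 2)) (G p₀) from ⟨hG1.le, hlt.le⟩)
    have := hmax ⟨⟨hp₀.1.trans hq.1, hq.2⟩, hGq.ge⟩
    have hqp : q = p₀ := le_antisymm this hq.1
    rw [hqp] at hGq
    exact hlt.ne' hGq
  have hp₀2 : p₀ < 1 / 2 := by
    refine lt_of_le_of_ne hp₀.2 ?_
    rintro rfl
    exact hG1.ne hGz
  set μ₀ := 1 - 2 * p₀ with hμ₀
  have hEig : IsDeGennesEigenvalue (-Real.sqrt μ₀) μ₀ := by
    have := isDeGennesEigenvalue_weber hp₀.1 1 (ξ := -Real.sqrt μ₀) ?_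
    · convert this using 1
      rw [hμ₀]; push_cast; ring
    · have h1 : weberFunDeriv p₀ 1 (-Real.sqrt μ₀) = 0 := hGz
      unfold weberFunDeriv at h1
      have := (mul_eq_zero.1 h1).resolve_left (Real.exp_pos _).ne'
      linarith
  have hmin : ∀ ξ μ, IsDeGennesEigenvalue ξ μ → μ₀ ≤ μ := by
    intro ξ μ h
    have hμ := h.pos
    rcases le_total μ 1 with h1 | h1
    · have hp : 0 ≤ (1 - μ) / 2 := by linarith
      have h2 := deGennes_crit_of_root hp (by linarith) (h.weber_root h1)
      have := hmax ⟨⟨hp, by linarith⟩, h2⟩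
      rw [hμ₀]
      linarith
    · linarith [hp₀.1]
  have hle : ∀ ξ, μ₀ ≤ deGennesMu ξ := fun ξ =>
    le_csInf (exists_isDeGennesEigenvalue ξ) fun μ hμ => hmin ξ μ hμ
  have hΘ : deGennesConst = μ₀ := by
    refine le_antisymm ?_ (le_ciInf hle)
    refine (ciInf_le ⟨μ₀, ?_⟩ (-Real.sqrt μ₀)).trans ?_
    · rintro _ ⟨ξ, rfl⟩
      exact hle ξ
    · exact csInf_le ⟨μ₀, fun μ hμ => hmin _ μ hμ⟩ hEig
  have hpos : 0 < deGennesConst := by rw [hΘ, hμ₀]; linarith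
  set ξ := -Real.sqrt deGennesConst with hξ
  have hξ2 : ξ ^ 2 = deGennesConst := by rw [hξ, neg_sq, Real.sq_sqrt hpos.le]
  have hξ0 : ξ < 0 := by rw [hξ]; simpa using hpos
  have hf : ∀ t, HasDerivAt (fun t => weberFun p₀ 1 (ξ + t)) (weberFunDeriv p₀ 1 (ξ + t)) t :=
    fun t => (hasDerivAt_weberFun hp₀.1 1 (ξ + t)).comp_const_add ξ t
  have hf' : ∀ t, HasDerivAt (fun t => weberFunDeriv p₀ 1 (ξ + t))
      (((t - Real.sqrt deGennesConst) ^ 2 - deGennesConst) * weberFun p₀ 1 (ξ + t)) t := fun t =>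
    ((hasDerivAt_weberFunDeriv hp₀.1 1 (ξ + t)).comp_const_add ξ t).congr_deriv (by
      rw [hΘ, hμ₀, hξ, hΘ, hμ₀]; push_cast; ring)
  have hfpos : ∀ t, 0 < weberFun p₀ 1 (ξ + t) := fun t =>
    mul_pos (Real.exp_pos _) (weberPair_one_pos hp₀.1 _)
  have hz : weberFunDeriv p₀ 1 (ξ + 0) = 0 := by
    rw [add_zero, hξ, hΘ]
    exact hGz
  have hc : Continuous fun t => weberFunDeriv p₀ 1 (ξ + t) :=
    continuous_iff_continuousAt.2 fun t => (hf' t).continuousAt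
  -- Because `ξ² = Θ₀`, the potential minus the energy vanishes exactly at `t = 0` and `t = -2ξ`.
  have hV : ∀ t, (t - Real.sqrt deGennesConst) ^ 2 - deGennesConst = t * (t + 2 * ξ) := fun t => by
    rw [show Real.sqrt deGennesConst = -ξ by rw [hξ, neg_neg], ← hξ2]; ring
  refine ⟨_, _, hpos, hf, hf', hz, hfpos, ?_⟩
  -- Up to `-2ξ` the function is concave, so its derivative decreases strictly from 0.
  have hneg1 : ∀ t ∈ Ioc 0 (-(2 * ξ)), weberFunDeriv p₀ 1 (ξ + t) < 0 := by
    have hanti : StrictAntiOn (fun t => weberFunDeriv p₀ 1 (ξ + t)) (Icc 0 (-(2 * ξ))) := by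
      refine strictAntiOn_of_deriv_neg (convex_Icc _ _) hc.continuousOn fun t ht => ?_
      rw [interior_Icc] at ht
      rw [(hf' t).deriv, hV]
      exact mul_neg_of_neg_of_pos (mul_neg_of_pos_of_neg ht.1 (by linarith [ht.2])) (hfpos t)
    intro t ht
    have := hanti ⟨le_rfl, by linarith⟩ ⟨ht.1.le, ht.2⟩ ht.1
    simpa only [hz] using this
  intro t ht
  rcases le_or_gt t (-(2 * ξ)) with h1 | h1
  · exact hneg1 t ⟨ht, h1⟩
  -- Beyond `-2ξ` the function is convex: once its derivative is nonnegative it stays so, and a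
  -- positive function tending to 0 cannot be nondecreasing.
  by_contra! hge
  have hmono : MonotoneOn (fun t => weberFunDeriv p₀ 1 (ξ + t)) (Ici t) := by
    refine monotoneOn_of_deriv_nonneg (convex_Ici _) hc.continuousOn
      (fun s _ => (hf' s).differentiableAt.differentiableWithinAt) fun s hs => ?_
    rw [interior_Ici] at hs
    have hs' : t < s := hs
    rw [(hf' s).deriv, hV]
    exact mul_nonneg (mul_nonneg (by linarith) (by linarith)) (hfpos s).le
  have hmono2 : MonotoneOn (fun t => weberFun p₀ 1 (ξ + t)) (Ici t) := by
    refine monotoneOn_of_deriv_nonneg (convex_Ici _) (fun s _ => (hf s).continuousAt.continuousWithinAt)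
      (fun s _ => (hf s).differentiableAt.differentiableWithinAt) fun s hs => ?_
    rw [interior_Ici] at hs
    rw [(hf s).deriv]
    exact hge.trans (hmono self_mem_Ici (mem_Ici.2 (le_of_lt hs)) (le_of_lt hs))
  refine absurd (hfpos t) (not_lt.2 ?_)
  refine ge_of_tendsto ((tendsto_weberFun hp₀.1 1).1.comp
    (tendsto_atTop_add_const_left atTop ξ tendsto_id)) ?_
  filter_upwards [eventually_ge_atTop t] with s hs
  exact hmono2 self_mem_Ici hs hs


/-! ### Weak gradients -/

/-- A continuous, compactly supported function with a continuous partial derivative is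
approximated, together with this derivative, by smooth compactly supported functions. -/
theorem exists_contDiff_approx {Ω : Set Plane} (hΩ : IsOpen Ω) {η η' : Plane → ℝ} {e : Plane}
    (hη : Continuous η) (hη' : Continuous η') (hc : HasCompactSupport η) (hs : tsupport η ⊆ Ω)
    (hd : ∀ x, HasLineDerivAt ℝ η (η' x) x e) {ε : ℝ} (hε : 0 < ε) :
    ∃ φ : Plane → ℝ, ContDiff ℝ ∞ φ ∧ HasCompactSupport φ ∧ tsupport φ ⊆ Ω ∧
      ∀ x, |φ x - η x| ≤ ε ∧ |fderiv ℝ φ x e - η' x| ≤ ε := by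
  have hzero : ∀ x, x ∉ tsupport η → η' x = 0 := by
    intro x hx
    refine (hd x).unique ?_
    have h0 : η =ᶠ[𝓝 x] fun _ => 0 := notMem_tsupport_iff_eventuallyEq.1 hx
    have : HasFDerivAt η (0 : Plane →L[ℝ] ℝ) x := (hasFDerivAt_const 0 x).congr_of_eventuallyEq h0
    simpa using this.hasLineDerivAt e
  have hc' : HasCompactSupport η' := HasCompactSupport.intro hc hzero
  obtain ⟨δ₀, hδ₀, hδs⟩ := hc.isCompact.exists_cthickening_subset_open hΩ hs
  obtain ⟨δ₁, hδ₁, h1⟩ := Metric.uniformContinuous_iff.1 (hc.uniformContinuous_of_continuous hη) ε hε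
  obtain ⟨δ₂, hδ₂, h2⟩ := Metric.uniformContinuous_iff.1 (hc'.uniformContinuous_of_continuous hη') ε hε
  obtain ⟨C, hC⟩ := hc'.exists_bound_of_continuous hη'
  set δ := min δ₀ (min δ₁ δ₂) with hδ
  have hδpos : 0 < δ := lt_min hδ₀ (lt_min hδ₁ hδ₂)
  let b : ContDiffBump (0 : Plane) := ⟨δ / 2, δ, by linarith, by linarith⟩
  let ρ := b.normed volume
  have hρc : Continuous ρ := b.continuous_normed
  have hρs : HasCompactSupport ρ := b.hasCompactSupport_normed
  let L := ContinuousLinearMap.lsmul ℝ ℝ (E := ℝ)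
  have hφ : ContDiff ℝ ∞ (MeasureTheory.convolution ρ η L volume) :=
    hρs.contDiff_convolution_left L b.contDiff_normed hη.locallyIntegrable
  refine ⟨MeasureTheory.convolution ρ η L volume, hφ, hρs.convolution L hc, ?_, fun x => ⟨?_, ?_⟩⟩
  · refine subset_trans (closure_minimal (t := Metric.cthickening δ₀ (tsupport η)) ?_
      Metric.isClosed_cthickening) hδs
    refine (support_convolution_subset_swap L).trans ?_
    rintro _ ⟨y, hy, z, hz, rfl⟩
    have hz' : z ∈ Metric.ball (0 : Plane) δ := by
      have := b.support_normed_eq (μ := volume)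
      rw [← this]
      exact hz
    refine Metric.mem_cthickening_of_dist_le _ y _ _ (subset_tsupport _ hy) ?_
    simp only [Metric.mem_ball, dist_zero_right] at hz'
    simpa using hz'.le.trans (min_le_left _ _)
  · have := b.dist_normed_convolution_le (μ := volume) (g := η) (x₀ := x) (ε := ε)
      hη.aestronglyMeasurable fun y hy => (h1 (lt_of_lt_of_le hy
        ((min_le_right _ _).trans (min_le_left _ _)))).le
    exact this
  · have hconv : fderiv ℝ (MeasureTheory.convolution ρ η L volume) x e
        = MeasureTheory.convolution ρ η' L volume x := by
      refine ((hφ.differentiable (by simp)) x).lineDeriv_eq_fderiv.symm.trans ?_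
      refine HasLineDerivAt.lineDeriv ?_
      unfold HasLineDerivAt MeasureTheory.convolution
      have := (hasDerivAt_integral_of_dominated_loc_of_deriv_le (μ := volume) (x₀ := (0 : ℝ))
        (F := fun (t : ℝ) (z : Plane) => L (ρ z) (η (x + t • e - z)))
        (F' := fun (t : ℝ) (z : Plane) => L (ρ z) (η' (x + t • e - z)))
        (bound := fun z => ρ z * C) Filter.univ_mem ?_ ?_ ?_ ?_ ?_ ?_).2
      · simpa using this
      · refine Eventually.of_forall fun t => Continuous.aestronglyMeasurable ?_
        simp only [L, ContinuousLinearMap.lsmul_apply]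
        fun_prop
      · refine Continuous.integrable_of_hasCompactSupport ?_ ?_
        · simp only [L, ContinuousLinearMap.lsmul_apply]
          fun_prop
        · exact hρs.smul_right
      · refine Continuous.aestronglyMeasurable ?_
        simp only [L, ContinuousLinearMap.lsmul_apply]
        fun_prop
      · refine Eventually.of_forall fun z t _ => ?_
        simp only [L, ContinuousLinearMap.lsmul_apply, smul_eq_mul, norm_mul]
        rw [Real.norm_of_nonneg (b.nonneg_normed z)]
        exact mul_le_mul_of_nonneg_left (hC _) (b.nonneg_normed z)
      · exact (hρc.integrable_of_hasCompactSupport hρs).mul_const C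
      · refine Eventually.of_forall fun z t _ => ?_
        have h := hd (x + t • e - z)
        unfold HasLineDerivAt at h
        have h' : HasDerivAt (fun r : ℝ => η (x + r • e - z)) (η' (x + t • e - z)) t := by
          have h3 : HasDerivAt (fun r : ℝ => r - t) 1 t := (hasDerivAt_id t).sub_const t
          rw [show (0 : ℝ) = t - t by ring] at h
          have h4 := HasDerivAt.scomp (h := fun r : ℝ => r - t) t h h3
          simp only [one_smul, Function.comp_def] at h4
          refine h4.congr_of_eventuallyEq (Eventually.of_forall fun r => ?_)
          simp only
          congr 1
          rw [sub_smul]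
          abel
        exact h'.const_smul (ρ z)
    rw [hconv]
    have := b.dist_normed_convolution_le (μ := volume) (g := η') (x₀ := x) (ε := ε)
      hη'.aestronglyMeasurable fun y hy => (h2 (lt_of_lt_of_le hy
        ((min_le_right _ _).trans (min_le_right _ _)))).le
    exact this

theorem integrable_bdd_mul {Ω : Set Plane} {η u : Plane → ℂ} (hη : Continuous η)
    (hc : HasCompactSupport η) (hu : IntegrableOn u Ω) : IntegrableOn (fun x => η x * u x) Ω := by
  obtain ⟨C, hC⟩ := hc.exists_bound_of_continuous hη
  exact hu.bdd_mul hη.aestronglyMeasurable (Eventually.of_forall hC)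

/-- The `j`-th weak derivative only sees the `j`-th derivative of the test function, so uniform
approximation of `η` and `η'` suffices. This admits the `C¹` test functions of the product rule and
the less regular ones of `IsH1.comp`. -/
theorem IsWeakGradient.integral_lineDeriv {Ω : Set Plane} (hΩ : IsOpen Ω) {u : Plane → ℂ}
    {v : Plane → CVec} (h : IsWeakGradient Ω u v) (hu : IntegrableOn u Ω) (j : Fin 2)
    (hv : IntegrableOn (fun x => v x j) Ω) {η η' : Plane → ℝ}
    (hη : Continuous η) (hη' : Continuous η') (hc : HasCompactSupport η) (hs : tsupport η ⊆ Ω)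
    (hc' : HasCompactSupport η')
    (hd : ∀ x, HasLineDerivAt ℝ η (η' x) x (EuclideanSpace.single j 1)) :
    ∫ x in Ω, ((η' x : ℝ) : ℂ) * u x = -∫ x in Ω, (η x : ℂ) * v x j := by
  have hcast : ∀ {η : Plane → ℝ}, HasCompactSupport η → HasCompactSupport fun x => ((η x : ℝ) : ℂ) :=
    fun h => h.comp_left (g := fun r : ℝ => (r : ℂ)) Complex.ofReal_zero
  have hi1 := integrable_bdd_mul (Complex.continuous_ofReal.comp hη') (hcast hc') hu
  have hi2 := integrable_bdd_mul (Complex.continuous_ofReal.comp hη) (hcast hc) hv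
  rw [← sub_eq_zero, sub_neg_eq_add, ← norm_le_zero_iff]
  refine le_of_forall_pos_le_add fun ε hε => ?_
  set N := (∫ x in Ω, ‖u x‖) + ∫ x in Ω, ‖v x j‖ with hN
  have hN0 : 0 ≤ N := add_nonneg (integral_nonneg fun _ => norm_nonneg _)
    (integral_nonneg fun _ => norm_nonneg _)
  obtain ⟨φ, h1, h2, h3, h4⟩ := exists_contDiff_approx hΩ hη hη' hc hs hd
    (ε := ε / (N + 1)) (by positivity)
  have hφ' : Continuous fun x => fderiv ℝ φ x (EuclideanSpace.single j 1) :=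
    (h1.continuous_fderiv (by simp)).clm_apply continuous_const
  have hφc' : HasCompactSupport fun x => fderiv ℝ φ x (EuclideanSpace.single j 1) :=
    h2.fderiv_apply ℝ _
  have hj1 := integrable_bdd_mul (Complex.continuous_ofReal.comp hφ') (hcast hφc') hu
  have hj2 := integrable_bdd_mul (Complex.continuous_ofReal.comp h1.continuous) (hcast h2) hv
  have hw := h φ h1 h2 h3 j
  simp only [Function.comp_apply] at hi1 hi2 hj1 hj2
  have e1 : (∫ x in Ω, ((η' x : ℝ) : ℂ) * u x) + ∫ x in Ω, (η x : ℂ) * v x j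
      = (∫ x in Ω, (((η' x : ℝ) : ℂ) * u x
          - ((fderiv ℝ φ x (EuclideanSpace.single j 1) : ℝ) : ℂ) * u x))
        + ∫ x in Ω, ((η x : ℂ) * v x j - (φ x : ℂ) * v x j) := by
    rw [integral_sub hi1 hj1, integral_sub hi2 hj2, hw]
    ring
  have hbd : ∀ (f g : ℝ) (z : ℂ), |f - g| ≤ ε / (N + 1) →
      ‖(g : ℂ) * z - (f : ℂ) * z‖ ≤ ε / (N + 1) * ‖z‖ := by
    intro f g z hfg
    rw [← sub_mul, norm_mul, ← Complex.ofReal_sub, Complex.norm_real, Real.norm_eq_abs, abs_sub_comm]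
    gcongr
  rw [e1]
  refine (norm_add_le _ _).trans ?_
  have b1 := norm_integral_le_of_norm_le (hu.norm.const_mul (ε / (N + 1)))
    (Eventually.of_forall fun x => hbd _ _ (u x) (h4 x).2)
  have b2 := norm_integral_le_of_norm_le (hv.norm.const_mul (ε / (N + 1)))
    (Eventually.of_forall fun x => hbd _ _ (v x j) (h4 x).1)
  rw [integral_const_mul] at b1 b2
  refine (add_le_add b1 b2).trans ?_
  rw [← mul_add, ← hN, zero_add, div_mul_eq_mul_div, div_le_iff₀ (by positivity)]
  nlinarith

theorem IsWeakGradient.integral_lineDeriv_complex {Ω : Set Plane} (hΩ : IsOpen Ω) {u : Plane → ℂ}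
    {v : Plane → CVec} (h : IsWeakGradient Ω u v) (hu : IntegrableOn u Ω) (j : Fin 2)
    (hv : IntegrableOn (fun x => v x j) Ω) {η η' : Plane → ℂ}
    (hη : Continuous η) (hη' : Continuous η') (hc : HasCompactSupport η) (hs : tsupport η ⊆ Ω)
    (hc' : HasCompactSupport η')
    (hd : ∀ x, HasLineDerivAt ℝ η (η' x) x (EuclideanSpace.single j 1)) :
    ∫ x in Ω, η' x * u x = -∫ x in Ω, η x * v x j := by
  have hsub : ∀ (g : ℂ → ℝ), g 0 = 0 → tsupport (fun x => g (η x)) ⊆ Ω := fun g hg =>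
    (closure_mono fun x hx => by
      contrapose! hx
      simp only [Function.mem_support, not_not] at hx ⊢
      rw [hx, hg]).trans hs
  have hre := h.integral_lineDeriv hΩ hu j hv (Complex.continuous_re.comp hη)
    (Complex.continuous_re.comp hη') (hc.comp_left Complex.zero_re) (hsub _ Complex.zero_re)
    (hc'.comp_left Complex.zero_re)
    fun x => (Complex.reCLM.hasFDerivAt.comp_hasDerivAt (0 : ℝ) (hd x))
  have him := h.integral_lineDeriv hΩ hu j hv (Complex.continuous_im.comp hη)
    (Complex.continuous_im.comp hη') (hc.comp_left Complex.zero_im) (hsub _ Complex.zero_im)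
    (hc'.comp_left Complex.zero_im)
    fun x => (Complex.imCLM.hasFDerivAt.comp_hasDerivAt (0 : ℝ) (hd x))
  simp only [Function.comp_apply] at hre him
  have hcast : ∀ {η : Plane → ℝ}, HasCompactSupport η → HasCompactSupport fun x => ((η x : ℝ) : ℂ) :=
    fun h => h.comp_left (g := fun r : ℝ => (r : ℂ)) Complex.ofReal_zero
  have key : ∀ {w : Plane → ℂ} {η : Plane → ℂ}, IntegrableOn w Ω → Continuous η →
      HasCompactSupport η → ∫ x in Ω, η x * w x
        = (∫ x in Ω, (((η x).re : ℝ) : ℂ) * w x)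
          + Complex.I * ∫ x in Ω, (((η x).im : ℝ) : ℂ) * w x := by
    intro w η hw hη hc
    rw [← integral_const_mul, ← integral_add]
    · refine integral_congr_ae (Eventually.of_forall fun x => ?_)
      simp only
      conv_lhs => rw [← Complex.re_add_im (η x)]
      ring
    · exact integrable_bdd_mul (Complex.continuous_ofReal.comp (Complex.continuous_re.comp hη))
        (hcast (hc.comp_left Complex.zero_re)) hw
    · exact (integrable_bdd_mul (Complex.continuous_ofReal.comp (Complex.continuous_im.comp hη))
        (hcast (hc.comp_left Complex.zero_im)) hw).const_mul _
  rw [key hu hη' hc', key hv hη hc, hre, him]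
  ring


/-- The gradient of a complex function. -/
noncomputable def cgrad (a : Plane → ℂ) (x : Plane) : CVec :=
  WithLp.toLp 2 fun j => fderiv ℝ a x (EuclideanSpace.single j 1)

theorem continuous_cgrad {a : Plane → ℂ} (ha : ContDiff ℝ 1 a) : Continuous (cgrad a) :=
  (PiLp.continuous_toLp 2 _).comp
    (continuous_pi fun _ => (ha.continuous_fderiv (by simp)).clm_apply continuous_const)

theorem memLp_of_continuous {F : Type*} [NormedAddCommGroup F] [SecondCountableTopology F]
    {Ω : Set Plane} (hb : Bornology.IsBounded Ω) (hm : MeasurableSet Ω)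
    {a : Plane → F} (ha : Continuous a) : MemLp a 2 (volume.restrict Ω) := by
  have : IsFiniteMeasure (volume.restrict Ω) := ⟨by
    rw [Measure.restrict_apply_univ]; exact hb.measure_lt_top⟩
  obtain ⟨C, hC⟩ := (hb.isCompact_closure.image ha).isBounded.exists_norm_le
  refine MemLp.of_bound ha.aestronglyMeasurable C ?_
  filter_upwards [ae_restrict_mem hm] with x hx
  exact hC _ ⟨x, subset_closure hx, rfl⟩

theorem MemLp.integrableOn_of_isBounded {F : Type*} [NormedAddCommGroup F]
    {Ω : Set Plane} (hb : Bornology.IsBounded Ω) {u : Plane → F}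
    (hu : MemLp u 2 (volume.restrict Ω)) : IntegrableOn u Ω := by
  have : IsFiniteMeasure (volume.restrict Ω) := ⟨by
    rw [Measure.restrict_apply_univ]; exact hb.measure_lt_top⟩
  exact hu.integrable (by norm_num)

theorem MemLp.coord {Ω : Set Plane} {v : Plane → CVec} (hv : MemLp v 2 (volume.restrict Ω))
    (j : Fin 2) : MemLp (fun x => v x j) 2 (volume.restrict Ω) := by
  refine hv.mono ((EuclideanSpace.proj (𝕜 := ℂ) j).continuous.comp_aestronglyMeasurable hv.1) ?_
  exact Eventually.of_forall fun x => PiLp.norm_apply_le (v x) j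

theorem MemLp.bdd_smul {F : Type*} [NormedAddCommGroup F] [NormedSpace ℂ F]
    [SecondCountableTopology F] {Ω : Set Plane} (hb : Bornology.IsBounded Ω)
    (hm : MeasurableSet Ω) {a : Plane → ℂ} (ha : Continuous a) {u : Plane → F}
    (hu : MemLp u 2 (volume.restrict Ω)) :
    MemLp (fun x => a x • u x) 2 (volume.restrict Ω) := by
  obtain ⟨C, hC⟩ := (hb.isCompact_closure.image ha).isBounded.exists_norm_le
  refine hu.of_le_mul (c := C) (ha.aestronglyMeasurable.smul hu.1) ?_
  filter_upwards [ae_restrict_mem hm] with x hx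
  rw [norm_smul]
  exact mul_le_mul_of_nonneg_right (hC _ ⟨x, subset_closure hx, rfl⟩) (norm_nonneg _)

theorem MemLp.smul_bdd {F : Type*} [NormedAddCommGroup F] [NormedSpace ℂ F]
    [SecondCountableTopology F] {Ω : Set Plane} (hb : Bornology.IsBounded Ω)
    (hm : MeasurableSet Ω) {a : Plane → F} (ha : Continuous a) {u : Plane → ℂ}
    (hu : MemLp u 2 (volume.restrict Ω)) :
    MemLp (fun x => u x • a x) 2 (volume.restrict Ω) := by
  obtain ⟨C, hC⟩ := (hb.isCompact_closure.image ha).isBounded.exists_norm_le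
  refine hu.of_le_mul (c := C) (hu.1.smul ha.aestronglyMeasurable) ?_
  filter_upwards [ae_restrict_mem hm] with x hx
  rw [norm_smul, mul_comm]
  exact mul_le_mul_of_nonneg_right (hC _ ⟨x, subset_closure hx, rfl⟩) (norm_nonneg _)

/-- The product of an `H¹` function with a `C¹` function. -/
theorem IsH1.mul {Ω : Set Plane} (hΩ : IsOpen Ω) (hb : Bornology.IsBounded Ω) {u : Plane → ℂ}
    {v : Plane → CVec} (h : IsH1 Ω u v) {a : Plane → ℂ} (ha : ContDiff ℝ 1 a) :
    IsH1 Ω (fun x => a x * u x) (fun x => a x • v x + u x • cgrad a x) := by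
  have hm := hΩ.measurableSet
  refine ⟨MemLp.bdd_smul hb hm ha.continuous h.memLp,
    (MemLp.bdd_smul hb hm ha.continuous h.memLp_grad).add
      (MemLp.smul_bdd hb hm (continuous_cgrad ha) h.memLp), ?_⟩
  intro φ hφ hc hs j
  have hu := MemLp.integrableOn_of_isBounded hb h.memLp
  have hv := MemLp.integrableOn_of_isBounded hb (MemLp.coord h.memLp_grad j)
  have hφC : Continuous fun x => ((φ x : ℝ) : ℂ) := Complex.continuous_ofReal.comp hφ.continuous
  have hφ'C : Continuous fun x => ((fderiv ℝ φ x (EuclideanSpace.single j 1) : ℝ) : ℂ) :=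
    Complex.continuous_ofReal.comp
      ((hφ.continuous_fderiv (by simp)).clm_apply continuous_const)
  have ha'C : Continuous fun x => fderiv ℝ a x (EuclideanSpace.single j 1) :=
    (ha.continuous_fderiv (by simp)).clm_apply continuous_const
  have hcC : HasCompactSupport fun x => ((φ x : ℝ) : ℂ) :=
    hc.comp_left (g := fun r : ℝ => (r : ℂ)) Complex.ofReal_zero
  have hc'C : HasCompactSupport fun x => ((fderiv ℝ φ x (EuclideanSpace.single j 1) : ℝ) : ℂ) :=
    (hc.fderiv_apply ℝ _).comp_left (g := fun r : ℝ => (r : ℂ)) Complex.ofReal_zero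
  have c1 : HasCompactSupport fun x =>
      ((fderiv ℝ φ x (EuclideanSpace.single j 1) : ℝ) : ℂ) * a x := hc'C.mul_right
  have c2 : HasCompactSupport fun x =>
      (φ x : ℂ) * fderiv ℝ a x (EuclideanSpace.single j 1) := hcC.mul_right
  have c3 : HasCompactSupport fun x => (φ x : ℂ) * a x := hcC.mul_right
  have key := h.isWeakGradient.integral_lineDeriv_complex hΩ hu j hv
    (η := fun x => (φ x : ℂ) * a x)
    (η' := fun x => ((fderiv ℝ φ x (EuclideanSpace.single j 1) : ℝ) : ℂ) * a x
      + (φ x : ℂ) * fderiv ℝ a x (EuclideanSpace.single j 1))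
    (hφC.mul ha.continuous) ((hφ'C.mul ha.continuous).add (hφC.mul ha'C)) c3 ?_ (c1.add c2) ?_
  · have i1 : IntegrableOn (fun x => ((fderiv ℝ φ x (EuclideanSpace.single j 1) : ℝ) : ℂ)
        * a x * u x) Ω := integrable_bdd_mul (hφ'C.mul ha.continuous) c1 hu
    have i2 : IntegrableOn (fun x => (φ x : ℂ) * fderiv ℝ a x (EuclideanSpace.single j 1) * u x)
        Ω := integrable_bdd_mul (hφC.mul ha'C) c2 hu
    have i3 : IntegrableOn (fun x => (φ x : ℂ) * a x * v x j) Ω :=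
      integrable_bdd_mul (hφC.mul ha.continuous) c3 hv
    have e1 : ∫ x in Ω, ((fderiv ℝ φ x (EuclideanSpace.single j 1) : ℝ) : ℂ) * (a x * u x)
        = (∫ x in Ω, (((fderiv ℝ φ x (EuclideanSpace.single j 1) : ℝ) : ℂ) * a x
      + (φ x : ℂ) * fderiv ℝ a x (EuclideanSpace.single j 1)) * u x)
          - ∫ x in Ω, (φ x : ℂ) * fderiv ℝ a x (EuclideanSpace.single j 1) * u x := by
      rw [← integral_sub _ i2]
      · refine integral_congr_ae (Eventually.of_forall fun x => ?_)
        simp only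
        ring
      · refine (i1.add i2).congr (Eventually.of_forall fun x => ?_)
        simp only [Pi.add_apply]
        ring
    rw [e1, key, ← neg_add', ← integral_add i3 i2]
    congr 1
    refine integral_congr_ae (Eventually.of_forall fun x => ?_)
    simp only [PiLp.add_apply, PiLp.smul_apply, smul_eq_mul, cgrad]
    ring
  · refine (closure_mono fun x hx => ?_).trans hs
    simp only [Function.mem_support] at hx ⊢
    intro h0
    simp [h0] at hx
  · intro x
    have d1 : HasLineDerivAt ℝ (fun x => ((φ x : ℝ) : ℂ))
        ((fderiv ℝ φ x (EuclideanSpace.single j 1) : ℝ) : ℂ) x (EuclideanSpace.single j 1) :=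
      HasDerivAt.ofReal_comp
        (((hφ.differentiable (by simp)) x).hasFDerivAt.hasLineDerivAt _)
    have d2 := ((ha.differentiable (by simp)) x).hasFDerivAt.hasLineDerivAt
      (EuclideanSpace.single j (1 : ℝ))
    have := HasDerivAt.fun_mul d1 d2
    simpa [HasLineDerivAt] using this

theorem isH1_one {Ω : Set Plane} (hΩ : IsOpen Ω) (hb : Bornology.IsBounded Ω) :
    IsH1 Ω (fun _ => 1) (fun _ => 0) := by
  refine ⟨memLp_of_continuous hb hΩ.measurableSet continuous_const,
    memLp_of_continuous hb hΩ.measurableSet continuous_const, ?_⟩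
  intro φ hφ hc hs j
  simp only [mul_one, PiLp.zero_apply, mul_zero, integral_zero, neg_zero]
  rw [integral_complex_ofReal]
  norm_cast
  have hsupp : ∀ x, x ∉ Ω → fderiv ℝ φ x (EuclideanSpace.single j 1) = 0 := by
    intro x hx
    have := fun h => hx (hs (tsupport_fderiv_subset ℝ h))
    rw [image_eq_zero_of_notMem_tsupport this]
    rfl
  rw [setIntegral_eq_integral_of_forall_compl_eq_zero hsupp]
  have := integral_mul_fderiv_eq_neg_fderiv_mul_of_integrable (μ := volume)
    (f := fun _ : Plane => (1 : ℝ)) (g := φ) (v := EuclideanSpace.single j 1) ?_ ?_ ?_ ?_ ?_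
  · simpa using this
  · simp
  · simp only [one_mul]
    exact ((hφ.continuous_fderiv (by simp)).clm_apply continuous_const).integrable_of_hasCompactSupport
      (hc.fderiv_apply ℝ _)
  · simpa using hφ.continuous.integrable_of_hasCompactSupport hc
  · intro x
    fun_prop
  · exact fun x _ => (hφ.differentiable (by simp)) x

/-- `C¹` functions belong to `H¹` of bounded open sets. -/
theorem isH1_of_contDiff {Ω : Set Plane} (hΩ : IsOpen Ω) (hb : Bornology.IsBounded Ω)
    {a : Plane → ℂ} (ha : ContDiff ℝ 1 a) : IsH1 Ω a (cgrad a) := by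
  -- Writing `a = a · 1` reduces the claim to the product rule.
  have h := (isH1_one hΩ hb).mul hΩ hb ha
  simpa using h

theorem IsH1.mono {Ω U : Set Plane} (hU : U ⊆ Ω) {u : Plane → ℂ} {v : Plane → CVec}
    (h : IsH1 Ω u v) : IsH1 U u v := by
  have hle : volume.restrict U ≤ volume.restrict Ω := Measure.restrict_mono hU le_rfl
  refine ⟨h.memLp.mono_measure hle, h.memLp_grad.mono_measure hle, ?_⟩
  intro φ hφ hc hs j
  have key : ∀ (η : Plane → ℝ) (w : Plane → ℂ), tsupport η ⊆ U →
      ∫ x in U, (η x : ℂ) * w x = ∫ x in Ω, (η x : ℂ) * w x := by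
    intro η w hη
    have hz : ∀ {S : Set Plane}, U ⊆ S → ∀ x, x ∉ S → (η x : ℂ) * w x = 0 := fun hS x hx => by
      rw [image_eq_zero_of_notMem_tsupport fun h => hx (hS (hη h))]; simp
    rw [setIntegral_eq_integral_of_forall_compl_eq_zero (hz subset_rfl),
      setIntegral_eq_integral_of_forall_compl_eq_zero (hz hU)]
  rw [key _ _ hs, ← h.isWeakGradient φ hφ hc (hs.trans hU) j]
  exact key (fun x => fderiv ℝ φ x (EuclideanSpace.single j 1)) _
    ((tsupport_fderiv_apply_subset ℝ _).trans hs)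

/-- Extension by zero of an `H¹` function of an open subset, after cutting it off. -/
theorem IsH1.extend {Ω U : Set Plane} (hUo : IsOpen U) (hU : U ⊆ Ω) {u : Plane → ℂ}
    {v : Plane → CVec} (h : IsH1 U u v) {η : Plane → ℝ} (hη : ContDiff ℝ ∞ η)
    (hη1 : ∀ x, |η x| ≤ 1)
    (hfr : ∀ x ∈ Ω, x ∈ tsupport η → x ∈ closure U → x ∈ U)
    (hone : ∀ x ∈ U, u x ≠ 0 → η =ᶠ[𝓝 x] 1) :
    IsH1 Ω (U.indicator u) (U.indicator fun x => (η x : ℂ) • v x) := by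
  have hm := hUo.measurableSet
  have hle : volume.restrict U = (volume.restrict Ω).restrict U := by
    rw [Measure.restrict_restrict hm, inter_eq_left.2 hU]
  have hηv : MemLp (fun x => (η x : ℂ) • v x) 2 (volume.restrict U) := by
    refine h.memLp_grad.of_le
      ((Complex.continuous_ofReal.comp hη.continuous).aestronglyMeasurable.smul h.memLp_grad.1)
      (Eventually.of_forall fun x => ?_)
    rw [norm_smul, Complex.norm_real]
    exact mul_le_of_le_one_left (norm_nonneg _) (hη1 x)
  refine ⟨?_, ?_, ?_⟩
  · rw [memLp_indicator_iff_restrict hm, ← hle]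
    exact h.memLp
  · rw [memLp_indicator_iff_restrict hm, ← hle]
    exact hηv
  intro φ hφ hc hs j
  -- The identity for `u` on `U` is tested against `η φ` in place of `φ`. This does not change the
  -- left-hand side, as `η = 1` near each point of `U` where `u ≠ 0`, and by `hfr` the extension of
  -- `η φ` by zero is smooth.
  set ψ : Plane → ℝ := U.indicator fun x => η x * φ x with hψ
  -- the cut-off test function is smooth
  have hcl : ∀ x, x ∉ U → ψ =ᶠ[𝓝 x] 0 := by
    intro x hx
    by_cases h1 : x ∈ tsupport φ
    · by_cases h2 : x ∈ tsupport η
      · by_cases h3 : x ∈ closure U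
        · exact absurd (hfr x (hs h1) h2 h3) hx
        · filter_upwards [isClosed_closure.isOpen_compl.mem_nhds h3] with y hy
          exact indicator_of_notMem (fun h => hy (subset_closure h)) _
      · filter_upwards [(isClosed_tsupport η).isOpen_compl.mem_nhds h2] with y hy
        have h0 := image_eq_zero_of_notMem_tsupport hy
        by_cases hyU : y ∈ U <;> simp [hψ, hyU, h0]
    · filter_upwards [(isClosed_tsupport φ).isOpen_compl.mem_nhds h1] with y hy
      have h0 := image_eq_zero_of_notMem_tsupport hy
      by_cases hyU : y ∈ U <;> simp [hψ, hyU, h0]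
  have hψs : tsupport ψ ⊆ U := by
    intro x hx
    by_contra hxU
    exact (notMem_tsupport_iff_eventuallyEq.2 (hcl x hxU)) hx
  have hloc : ∀ x ∈ U, ψ =ᶠ[𝓝 x] fun x => η x * φ x := fun x hx => by
    filter_upwards [hUo.mem_nhds hx] with y hy
    exact indicator_of_mem hy _
  have hψd : ContDiff ℝ ∞ ψ := by
    refine contDiff_iff_contDiffAt.2 fun x => ?_
    by_cases hx : x ∈ U
    · exact (hη.mul hφ).contDiffAt.congr_of_eventuallyEq (hloc x hx)
    · exact contDiffAt_const.congr_of_eventuallyEq (hcl x hx)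
  have hψc : HasCompactSupport ψ := by
    refine HasCompactSupport.intro hc fun x hx => ?_
    have h0 := image_eq_zero_of_notMem_tsupport hx
    by_cases hxU : x ∈ U <;> simp [hψ, hxU, h0]
  have hind : ∀ (f : Plane → ℂ) (w : Plane → ℂ), ∫ x in Ω, f x * U.indicator w x
      = ∫ x in U, f x * w x := by
    intro f w
    rw [hle, ← integral_indicator hm]
    refine integral_congr_ae (Eventually.of_forall fun x => ?_)
    by_cases hx : x ∈ U <;> simp [hx]
  have hcoord : ∀ x, (U.indicator (fun x => (η x : ℂ) • v x) x) j
      = U.indicator (fun x => (η x : ℂ) * v x j) x := by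
    intro x
    by_cases hx : x ∈ U <;> simp [hx]
  simp only [hcoord]
  rw [hind, hind]
  have key := h.isWeakGradient ψ hψd hψc hψs j
  have e1 : ∫ x in U, ((fderiv ℝ φ x (EuclideanSpace.single j 1) : ℝ) : ℂ) * u x
      = ∫ x in U, ((fderiv ℝ ψ x (EuclideanSpace.single j 1) : ℝ) : ℂ) * u x := by
    refine setIntegral_congr_fun hm fun x hx => ?_
    by_cases h0 : u x = 0
    · simp [h0]
    · have : ψ =ᶠ[𝓝 x] φ := by
        filter_upwards [hloc x hx, hone x hx h0] with y h1 h2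
        rw [h1, h2]
        simp
      rw [this.fderiv_eq]
  rw [e1, key]
  congr 1
  refine setIntegral_congr_fun hm fun x hx => ?_
  simp only [hψ, indicator_of_mem hx]
  push_cast
  ring


/-! ### Transport of `H¹` functions -/

/-- The pullback of a complex covector at `Φ x` by the derivative of `Φ` at `x`. -/
noncomputable def pullVec (Φ : Plane → Plane) (x : Plane) (w : CVec) : CVec :=
  WithLp.toLp 2 fun j =>
    ∑ k, ((fderiv ℝ Φ x (EuclideanSpace.single j 1) k : ℝ) : ℂ) * w k

theorem fderiv_apply_eq_sum (f : Plane →L[ℝ] ℝ) (x : Plane) :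
    f x = ∑ k, x k * f (EuclideanSpace.single k 1) := by
  conv_lhs => rw [← (EuclideanSpace.basisFun (Fin 2) ℝ).sum_repr x]
  simp

/-- The data of a change of variables whose derivative `∂ⱼΦₖ ∘ Φ⁻¹` is invariant in the direction
`e_k`, so that the chain rule for weak gradients needs no second derivatives. -/
structure IsGoodChange (Φ : Plane ≃ₜ Plane) (c : ENNReal) (K : ℝ) : Prop where
  contDiff : ContDiff ℝ 1 Φ
  contDiff_symm : ContDiff ℝ 1 Φ.symm
  ne_top : c ≠ ⊤
  map_volume : Measure.map Φ volume = c • volume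
  invariant : ∀ j k y (s : ℝ),
    fderiv ℝ Φ (Φ.symm (y + s • EuclideanSpace.single k 1)) (EuclideanSpace.single j 1) k
      = fderiv ℝ Φ (Φ.symm y) (EuclideanSpace.single j 1) k
  norm_pullVec : ∀ x w, ‖pullVec Φ x w‖ ^ 2 ≤ K * ‖w‖ ^ 2

theorem setIntegral_preimage {F : Type*} [NormedAddCommGroup F] [NormedSpace ℝ F]
    {Φ : Plane ≃ₜ Plane} {c : ENNReal} (h : Measure.map Φ volume = c • volume)
    (V : Set Plane) (f : Plane → F) :
    ∫ x in Φ ⁻¹' V, f (Φ x) = c.toReal • ∫ y in V, f y := by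
  rw [← Φ.measurableEmbedding.setIntegral_map, h, Measure.restrict_smul, integral_smul_measure]

theorem MemLp.comp_change {F : Type*} [NormedAddCommGroup F] {Φ : Plane ≃ₜ Plane} {c : ENNReal}
    (hc : c ≠ ⊤) (h : Measure.map Φ volume = c • volume) {V : Set Plane} {f : Plane → F}
    (hf : MemLp f 2 (volume.restrict V)) :
    MemLp (fun x => f (Φ x)) 2 (volume.restrict (Φ ⁻¹' V)) := by
  have h1 := hf.smul_measure hc
  rw [← Measure.restrict_smul, ← h, Φ.measurableEmbedding.restrict_map] at h1
  exact (Φ.measurableEmbedding.memLp_map_measure_iff).1 h1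

theorem continuous_pullVec {Φ : Plane → Plane} (hΦ : ContDiff ℝ 1 Φ) :
    Continuous fun p : Plane × CVec => pullVec Φ p.1 p.2 := by
  refine (PiLp.continuous_toLp 2 _).comp (continuous_pi fun j => continuous_finsetSum _ fun k _ => ?_)
  have h1 : Continuous fun p : Plane × CVec => fderiv ℝ Φ p.1 (EuclideanSpace.single j 1) :=
    ((hΦ.continuous_fderiv (by simp)).comp continuous_fst).clm_apply continuous_const
  fun_prop

theorem aestronglyMeasurable_pullVec {Φ : Plane → Plane} (hΦ : ContDiff ℝ 1 Φ) {μ : Measure Plane}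
    {w : Plane → CVec} (hw : AEStronglyMeasurable w μ) :
    AEStronglyMeasurable (fun x => pullVec Φ x (w x)) μ := by
  have h0 : AEStronglyMeasurable (fun x : Plane => x) μ := continuous_id.aestronglyMeasurable
  have h1 : AEStronglyMeasurable (fun x : Plane => (x, w x)) μ := h0.prodMk hw
  exact Continuous.comp_aestronglyMeasurable (g := fun p : Plane × CVec => pullVec Φ p.1 p.2)
    (f := fun x : Plane => (x, w x)) (continuous_pullVec hΦ) h1

/-- The chain rule multiplies the derivatives of `φ ∘ Φ⁻¹` by coefficients `∂ⱼΦₖ ∘ Φ⁻¹` that are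
only continuous. By `invariant` the `k`-th one is constant along `e_k`, so its product with `φ ∘
Φ⁻¹` still has a continuous `k`-th partial derivative, and `IsWeakGradient.integral_lineDeriv`
applies. Hence `C¹` charts are enough. -/
theorem IsH1.comp {Φ : Plane ≃ₜ Plane} {c : ENNReal} {K : ℝ} (hΦ : IsGoodChange Φ c K)
    {V : Set Plane} (hV : IsOpen V) (hb : Bornology.IsBounded V) {u : Plane → ℂ}
    {v : Plane → CVec} (h : IsH1 V u v) :
    IsH1 (Φ ⁻¹' V) (fun x => u (Φ x)) (fun x => pullVec Φ x (v (Φ x))) := by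
  have hv := MemLp.comp_change hΦ.ne_top hΦ.map_volume h.memLp_grad
  refine ⟨MemLp.comp_change hΦ.ne_top hΦ.map_volume h.memLp, ?_, ?_⟩
  · refine hv.of_le_mul (c := Real.sqrt K) ?_ (Eventually.of_forall fun x => ?_)
    · exact aestronglyMeasurable_pullVec hΦ.contDiff hv.1
    · have hK : 0 ≤ K := by
        have := hΦ.norm_pullVec 0 (EuclideanSpace.single 0 1)
        simp only [PiLp.norm_single, norm_one, one_pow, mul_one] at this
        exact (sq_nonneg _).trans this
      rw [← Real.sqrt_sq (norm_nonneg (pullVec Φ x (v (Φ x)))), ← Real.sqrt_sq (norm_nonneg (v (Φ x))),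
        ← Real.sqrt_mul hK]
      exact Real.sqrt_le_sqrt (hΦ.norm_pullVec x _)
  intro φ hφ hc hs j
  have hφ1 : ContDiff ℝ 1 φ := hφ.of_le (by simp)
  set ψ : Plane → ℝ := fun y => φ (Φ.symm y) with hψ
  have hψd : ContDiff ℝ 1 ψ := hφ1.comp hΦ.contDiff_symm
  have hψc : HasCompactSupport ψ := hc.comp_homeomorph Φ.symm
  have hψs : tsupport ψ ⊆ V := by
    intro y hy
    have : Φ.symm y ∈ tsupport φ := by
      have := tsupport_comp_subset_preimage φ Φ.symm.continuous hy
      exact this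
    simpa using hs this
  have hchain : ∀ y, fderiv ℝ φ (Φ.symm y) (EuclideanSpace.single j 1)
      = ∑ k, fderiv ℝ ψ y (EuclideanSpace.single k 1)
        * fderiv ℝ Φ (Φ.symm y) (EuclideanSpace.single j 1) k := by
    intro y
    have e : φ = fun x => ψ (Φ x) := by funext x; simp [hψ]
    have h1 : HasFDerivAt ψ (fderiv ℝ ψ y) (Φ (Φ.symm y)) := by
      rw [Φ.apply_symm_apply]
      exact (hψd.differentiable (by simp) y).hasFDerivAt
    have h2 := h1.comp (Φ.symm y) (hΦ.contDiff.differentiable (by simp) (Φ.symm y)).hasFDerivAt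
    have h3 : fderiv ℝ φ (Φ.symm y) = (fderiv ℝ ψ y).comp (fderiv ℝ Φ (Φ.symm y)) := by
      conv_lhs => rw [e]
      exact h2.fderiv
    rw [h3, ContinuousLinearMap.comp_apply, fderiv_apply_eq_sum]
    exact Finset.sum_congr rfl fun k _ => mul_comm _ _
  have hD : ∀ k, Continuous fun y => fderiv ℝ Φ (Φ.symm y) (EuclideanSpace.single j 1) k := by
    intro k
    have := ((hΦ.contDiff.continuous_fderiv (by simp)).comp Φ.symm.continuous).clm_apply
      (continuous_const (y := (EuclideanSpace.single j (1 : ℝ) : Plane)))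
    simp only [Function.comp_apply] at this
    fun_prop
  have hψ' : ∀ k, Continuous fun y => fderiv ℝ ψ y (EuclideanSpace.single k 1) := fun k =>
    (hψd.continuous_fderiv (by simp)).clm_apply continuous_const
  have hu := MemLp.integrableOn_of_isBounded hb h.memLp
  have hvk := fun k => MemLp.integrableOn_of_isBounded hb (MemLp.coord h.memLp_grad k)
  have key : ∀ k, ∫ y in V, ((fderiv ℝ ψ y (EuclideanSpace.single k 1)
        * fderiv ℝ Φ (Φ.symm y) (EuclideanSpace.single j 1) k : ℝ) : ℂ) * u y
      = -∫ y in V, ((ψ y * fderiv ℝ Φ (Φ.symm y) (EuclideanSpace.single j 1) k : ℝ) : ℂ) * v y k := by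
    intro k
    refine h.isWeakGradient.integral_lineDeriv hV hu k (hvk k)
      (η := fun y => ψ y * fderiv ℝ Φ (Φ.symm y) (EuclideanSpace.single j 1) k)
      (η' := fun y => fderiv ℝ ψ y (EuclideanSpace.single k 1)
        * fderiv ℝ Φ (Φ.symm y) (EuclideanSpace.single j 1) k)
      (hψd.continuous.mul (hD k)) ((hψ' k).mul (hD k)) hψc.mul_right
      ((tsupport_mul_subset_left).trans hψs) ((hψc.fderiv_apply ℝ _).mul_right) fun y => ?_
    have d := (hψd.differentiable (by simp) y).hasFDerivAt.hasLineDerivAt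
      (EuclideanSpace.single k (1 : ℝ))
    unfold HasLineDerivAt at d ⊢
    simp only [hΦ.invariant]
    exact d.mul_const _
  have hcast : ∀ {η : Plane → ℝ}, HasCompactSupport η → HasCompactSupport fun x => ((η x : ℝ) : ℂ) :=
    fun h => h.comp_left (g := fun r : ℝ => (r : ℂ)) Complex.ofReal_zero
  have e1 := setIntegral_preimage hΦ.map_volume V
    fun y => ((fderiv ℝ φ (Φ.symm y) (EuclideanSpace.single j 1) : ℝ) : ℂ) * u y
  have e2 := setIntegral_preimage hΦ.map_volume V
    fun y => ((φ (Φ.symm y) : ℝ) : ℂ) * pullVec Φ (Φ.symm y) (v y) j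
  simp only [Φ.symm_apply_apply] at e1 e2
  rw [e1, e2, ← smul_neg]
  congr 1
  have i1 : ∀ k ∈ Finset.univ, Integrable (fun y => ((fderiv ℝ ψ y (EuclideanSpace.single k 1)
        * fderiv ℝ Φ (Φ.symm y) (EuclideanSpace.single j 1) k : ℝ) : ℂ) * u y)
      (volume.restrict V) := fun k _ =>
    integrable_bdd_mul (Complex.continuous_ofReal.comp ((hψ' k).mul (hD k)))
      (hcast (hψc.fderiv_apply ℝ _).mul_right) hu
  have i2 : ∀ k ∈ Finset.univ, Integrable (fun y => ((ψ y
        * fderiv ℝ Φ (Φ.symm y) (EuclideanSpace.single j 1) k : ℝ) : ℂ) * v y k)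
      (volume.restrict V) := fun k _ =>
    integrable_bdd_mul (Complex.continuous_ofReal.comp (hψd.continuous.mul (hD k)))
      (hcast hψc.mul_right) (hvk k)
  calc _ = ∫ y in V, ∑ k, ((fderiv ℝ ψ y (EuclideanSpace.single k 1)
        * fderiv ℝ Φ (Φ.symm y) (EuclideanSpace.single j 1) k : ℝ) : ℂ) * u y := by
        refine integral_congr_ae (Eventually.of_forall fun y => ?_)
        simp only
        rw [hchain, ← Finset.sum_mul]
        push_cast
        rfl
    _ = -∫ y in V, ∑ k, ((ψ y * fderiv ℝ Φ (Φ.symm y) (EuclideanSpace.single j 1) k : ℝ) : ℂ)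
        * v y k := by
        rw [integral_finsetSum _ i1, integral_finsetSum _ i2, ← Finset.sum_neg_distrib]
        exact Finset.sum_congr rfl fun k _ => key k
    _ = _ := by
        congr 1
        refine integral_congr_ae (Eventually.of_forall fun y => ?_)
        simp only [pullVec, hψ, Finset.mul_sum]
        refine Finset.sum_congr rfl fun k _ => ?_
        push_cast
        ring

/-- `Φ` transports `H¹` functions with the magnetic field `β'` to `H¹` functions with the magnetic
field `β`, the `L²` norms being multiplied by `J` and the energies at most by `J K`. -/
def Transports (Φ : Plane ≃ₜ Plane) (β β' J K : ℝ) : Prop :=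
  ∀ V : Set Plane, IsOpen V → Bornology.IsBounded V → ∀ u v, IsH1 V u v →
    ∃ u' v', IsH1 (Φ ⁻¹' V) u' v' ∧ (∀ x, ‖u' x‖ = ‖u (Φ x)‖) ∧
      ∫ x in Φ ⁻¹' V, ‖u' x‖ ^ 2 = J * ∫ x in V, ‖u x‖ ^ 2 ∧
      ∫ x in Φ ⁻¹' V, ‖magGrad β u' v' x‖ ^ 2 ≤ J * K * ∫ x in V, ‖magGrad β' u v x‖ ^ 2

theorem Homeomorph.isBounded_preimage (Φ : Plane ≃ₜ Plane) {V : Set Plane}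
    (hb : Bornology.IsBounded V) : Bornology.IsBounded (Φ ⁻¹' V) := by
  have : IsCompact (Φ.symm '' closure V) := hb.isCompact_closure.image Φ.symm.continuous
  refine this.isBounded.subset ?_
  rw [Φ.image_symm]
  exact preimage_mono subset_closure

theorem Transports.trans {Φ Ψ : Plane ≃ₜ Plane} {β β' β'' J K J' K' : ℝ}
    (hΦ : Transports Φ β β' J K) (hΨ : Transports Ψ β' β'' J' K') (hJ : 0 ≤ J * K) :
    Transports (Φ.trans Ψ) β β'' (J * J') (K * K') := by
  intro V hV hb u v h
  obtain ⟨u₁, v₁, h₁, hn₁, hi₁, he₁⟩ := hΨ V hV hb u v h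
  obtain ⟨u₂, v₂, h₂, hn₂, hi₂, he₂⟩ := hΦ _ (hV.preimage Ψ.continuous)
    (Homeomorph.isBounded_preimage Ψ hb) u₁ v₁ h₁
  refine ⟨u₂, v₂, h₂, fun x => (hn₂ x).trans (hn₁ _), ?_, ?_⟩
  · exact hi₂.trans (by rw [hi₁]; ring)
  · refine he₂.trans ((mul_le_mul_of_nonneg_left he₁ hJ).trans_eq (by ring))

/-- The condition on `θ` says that the pullback of the potential at field `β'` differs from the
potential at field `β` by `∇θ`. Multiplication by `exp (-iθ)` absorbs this difference, and the
magnetic gradient becomes a pullback times a unimodular factor. -/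
theorem IsGoodChange.transports {Φ : Plane ≃ₜ Plane} {c : ENNReal} {K : ℝ}
    (hΦ : IsGoodChange Φ c K) {β β' : ℝ} {θ : Plane → ℝ} (hθ : ContDiff ℝ 1 θ)
    (hg : ∀ x j, ((fderiv ℝ θ x (EuclideanSpace.single j 1) : ℝ) : ℂ)
      = pullVec Φ x (stdPotential β' (Φ x)) j - stdPotential β x j) :
    Transports Φ β β' c.toReal K := by
  intro V hV hb u v h
  have h1 := h.comp hΦ hV hb
  set a : Plane → ℂ := fun x => Complex.exp (-(Complex.I * (θ x : ℂ))) with ha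
  have haθ : ∀ x, HasFDerivAt a (a x • (-(Complex.I • (Complex.ofRealCLM.comp (fderiv ℝ θ x))))) x := by
    intro x
    have d1 : HasFDerivAt (fun x => (θ x : ℂ)) (Complex.ofRealCLM.comp (fderiv ℝ θ x)) x :=
      Complex.ofRealCLM.hasFDerivAt.comp x (hθ.differentiable (by simp) x).hasFDerivAt
    exact ((d1.const_mul Complex.I).neg).cexp
  have haC : ContDiff ℝ 1 a :=
    (((Complex.ofRealCLM.contDiff.comp hθ).const_smul Complex.I).neg).cexp
  have hnorm : ∀ x, ‖a x‖ = 1 := by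
    intro x
    have : -(Complex.I * (θ x : ℂ)) = ((-θ x : ℝ) : ℂ) * Complex.I := by push_cast; ring
    rw [ha]
    simp only
    rw [this, Complex.norm_exp_ofReal_mul_I]
  have hcg : ∀ x, cgrad a x = -(Complex.I * a x) •
      (WithLp.toLp 2 fun j => ((fderiv ℝ θ x (EuclideanSpace.single j 1) : ℝ) : ℂ) : CVec) := by
    intro x
    ext j
    simp only [cgrad, (haθ x).fderiv, PiLp.smul_apply, smul_eq_mul]
    simp
    ring
  refine ⟨_, _, h1.mul (hV.preimage Φ.continuous) (Homeomorph.isBounded_preimage Φ hb) haC,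
    fun x => ?_, ?_, ?_⟩
  · rw [norm_mul, hnorm, one_mul]
  · simp only [norm_mul, hnorm, one_mul]
    exact setIntegral_preimage hΦ.map_volume V fun y => ‖u y‖ ^ 2
  · have hpt : ∀ x, ‖magGrad β (fun x => a x * u (Φ x))
        (fun x => a x • pullVec Φ x (v (Φ x)) + u (Φ x) • cgrad a x) x‖ ^ 2
        ≤ K * ‖magGrad β' u v (Φ x)‖ ^ 2 := by
      intro x
      have e : magGrad β (fun x => a x * u (Φ x))
          (fun x => a x • pullVec Φ x (v (Φ x)) + u (Φ x) • cgrad a x) x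
          = a x • pullVec Φ x (magGrad β' u v (Φ x)) := by
        ext j
        have hg' := hg x j
        simp only [magGrad, hcg, PiLp.sub_apply, PiLp.add_apply, PiLp.smul_apply, smul_eq_mul, hg']
        simp only [pullVec, PiLp.sub_apply, PiLp.smul_apply, smul_eq_mul, Fin.sum_univ_two]
        ring
      rw [e, norm_smul, hnorm, one_mul]
      exact hΦ.norm_pullVec x _
    have hmL := IsH1.mul (hV.preimage Φ.continuous) (Homeomorph.isBounded_preimage Φ hb) h1 haC
    have hmag : ∀ {V : Set Plane} {β : ℝ} {u v}, IsOpen V → Bornology.IsBounded V → IsH1 V u v →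
        MemLp (magGrad β u v) 2 (volume.restrict V) := by
      intro V β u v hV hb h
      have hcont : Continuous (stdPotential β) := by
        unfold stdPotential
        refine (PiLp.continuous_toLp 2 _).comp (continuous_pi fun j => ?_)
        fin_cases j <;> simp <;> fun_prop
      exact h.memLp_grad.sub (MemLp.smul_bdd hb hV.measurableSet hcont (h.memLp.const_mul Complex.I))
    have i2 : Integrable (fun x => K * ‖magGrad β' u v (Φ x)‖ ^ 2) (volume.restrict (Φ ⁻¹' V)) :=
      (MemLp.comp_change hΦ.ne_top hΦ.map_volume (hmag hV hb h)).integrable_norm_pow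
        (by norm_num) |>.const_mul K
    refine (integral_mono_of_nonneg (Eventually.of_forall fun x => by positivity) i2
      (Eventually.of_forall hpt)).trans_eq ?_
    rw [integral_const_mul]
    have := setIntegral_preimage hΦ.map_volume V fun y => ‖magGrad β' u v y‖ ^ 2
    rw [this, smul_eq_mul]
    ring


/-- The measurable identification of the plane with `ℝ × ℝ`. -/
noncomputable def planeProd : Plane ≃ᵐ ℝ × ℝ :=
  (MeasurableEquiv.toLp 2 (Fin 2 → ℝ)).symm.trans MeasurableEquiv.finTwoArrow

theorem planeProd_apply (x : Plane) : planeProd x = (x 0, x 1) := rfl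

theorem planeProd_symm_apply (x : ℝ × ℝ) : planeProd.symm x = !₂[x.1, x.2] := rfl

theorem volume_preserving_planeProd : MeasurePreserving planeProd volume volume :=
  (EuclideanSpace.volume_preserving_symm_measurableEquiv_toLp (Fin 2)).trans
    (volume_preserving_finTwoArrow ℝ)

theorem stdPotential_zero (β : ℝ) (x : Plane) : stdPotential β x 0 = ((-(β / 2 * x 1) : ℝ) : ℂ) := rfl

theorem stdPotential_one (β : ℝ) (x : Plane) : stdPotential β x 1 = ((β / 2 * x 0 : ℝ) : ℂ) := rfl

theorem CVec.norm_sq (w : CVec) :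
    ‖w‖ ^ 2 = (w 0).re ^ 2 + (w 0).im ^ 2 + ((w 1).re ^ 2 + (w 1).im ^ 2) := by
  rw [EuclideanSpace.norm_sq_eq, Fin.sum_univ_two, Complex.sq_norm, Complex.sq_norm,
    Complex.normSq_apply, Complex.normSq_apply]
  ring

/-! #### Dilations -/

/-- The dilation by `s`. -/
noncomputable def dilation (s : ℝ) (hs : s ≠ 0) : Plane ≃ₜ Plane := Homeomorph.smulOfNeZero s hs

theorem dilation_apply (s : ℝ) (hs : s ≠ 0) (x : Plane) : dilation s hs x = s • x := rfl

/-- The potential is linear in `x`, so its pullback by the dilation is exactly `s²` times itself and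
the phase is trivial. -/
theorem transports_dilation {s : ℝ} (hs : 0 < s) (β : ℝ) :
    Transports (dilation s hs.ne') (s ^ 2 * β) β (s ^ 2)⁻¹ (s ^ 2) := by
  have hd : ∀ x, HasFDerivAt (dilation s hs.ne') (s • ContinuousLinearMap.id ℝ Plane) x := fun x =>
    (hasFDerivAt_id x).const_smul s
  have hpull : ∀ x w, pullVec (dilation s hs.ne') x w = (s : ℂ) • w := by
    intro x w
    ext j
    simp only [pullVec, (hd x).fderiv, Fin.sum_univ_two]
    fin_cases j <;> simp
  have hgood : IsGoodChange (dilation s hs.ne') (ENNReal.ofReal (s ^ 2)⁻¹) (s ^ 2) := by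
    refine ⟨contDiff_id.const_smul s, contDiff_id.const_smul s⁻¹, ENNReal.ofReal_ne_top, ?_, ?_, ?_⟩
    · have := Measure.map_addHaar_smul (volume : Measure Plane) hs.ne'
      rw [finrank_euclideanSpace_fin, abs_of_pos (by positivity)] at this
      exact this
    · intro j k y t
      rw [(hd _).fderiv, (hd _).fderiv]
    · intro x w
      rw [hpull, norm_smul, mul_pow, Complex.norm_real, Real.norm_of_nonneg hs.le]
  have h := hgood.transports (β := s ^ 2 * β) (β' := β) (θ := fun _ => 0) contDiff_const ?_
  · rwa [ENNReal.toReal_ofReal (by positivity)] at h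
  · intro x j
    simp only [hpull]
    fin_cases j
    · simp [stdPotential_zero, dilation_apply]
      ring
    · simp [stdPotential_one, dilation_apply]
      ring

/-! #### Isometries -/

theorem IsH1.conj {Ω : Set Plane} {u : Plane → ℂ} {v : Plane → CVec} (h : IsH1 Ω u v) :
    IsH1 Ω (fun x => (starRingEnd ℂ) (u x))
      (fun x => WithLp.toLp 2 fun j => (starRingEnd ℂ) (v x j)) := by
  refine ⟨?_, ?_, ?_⟩
  · exact h.memLp.of_le (Complex.continuous_conj.comp_aestronglyMeasurable h.memLp.1)
      (Eventually.of_forall fun x => by simp)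
  · have hc : Continuous fun w : CVec => (WithLp.toLp 2 fun j => (starRingEnd ℂ) (w j) : CVec) :=
      (PiLp.continuous_toLp 2 _).comp (continuous_pi fun j => Complex.continuous_conj.comp
        (EuclideanSpace.proj (𝕜 := ℂ) j).continuous)
    refine h.memLp_grad.of_le (hc.comp_aestronglyMeasurable h.memLp_grad.1)
      (Eventually.of_forall fun x => ?_)
    rw [EuclideanSpace.norm_eq, EuclideanSpace.norm_eq]
    simp
  · intro φ hφ hc hs j
    have := congrArg (starRingEnd ℂ) (h.isWeakGradient φ hφ hc hs j)
    rw [map_neg, ← integral_conj, ← integral_conj] at this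
    simpa using this

/-- Complex conjugation reverses the sign of the field and preserves the norms of `u` and of its
magnetic gradient. -/
theorem Transports.conj {Φ : Plane ≃ₜ Plane} {β β' J K : ℝ} (h : Transports Φ (-β) β' J K) :
    Transports Φ β β' J K := by
  intro V hV hb u v hu
  obtain ⟨u', v', h1, h2, h3, h4⟩ := h V hV hb u v hu
  refine ⟨_, _, h1.conj, fun x => by simpa using h2 x, by simpa using h3, le_trans (le_of_eq ?_) h4⟩
  refine integral_congr_ae (Eventually.of_forall fun x => ?_)
  simp only [CVec.norm_sq, magGrad, PiLp.sub_apply, PiLp.smul_apply, smul_eq_mul,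
    stdPotential_zero, stdPotential_one]
  simp
  ring

/-- The linear part multiplies the field by its determinant `δ = ±1`, and the translation adds a
constant to the potential, which is the gradient of a linear phase. When `δ = -1` a complex
conjugation restores the sign. -/
theorem transports_isometry (M : Plane ≃ᵢ Plane) (β : ℝ) :
    Transports M.toHomeomorph β β 1 1 := by
  set L := M.toRealLinearIsometryEquiv with hL
  have hM : ∀ x, M x = L x + M 0 := fun x => by
    rw [hL, IsometryEquiv.toRealLinearIsometryEquiv_apply]; abel
  have hMs : ∀ y, M.symm y = L.symm (y - M 0) := fun y => by
    rw [LinearIsometryEquiv.eq_symm_apply, eq_sub_iff_add_eq, ← hM]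
    simp
  have hd : ∀ x, HasFDerivAt M.toHomeomorph (L.toContinuousLinearEquiv : Plane →L[ℝ] Plane) x := by
    intro x
    have h1 : (M.toHomeomorph : Plane → Plane) = fun x => L x + M 0 := funext hM
    rw [h1]
    exact (L.toContinuousLinearEquiv.hasFDerivAt).add_const _
  set e0 : Plane := EuclideanSpace.single 0 1
  set e1 : Plane := EuclideanSpace.single 1 1
  set a := L e0 0 with ha
  set c := L e0 1 with hc
  set b := L e1 0 with hb
  set d := L e1 1 with hd'
  have hin : ∀ x y : Plane, L x 0 * L y 0 + L x 1 * L y 1 = x 0 * y 0 + x 1 * y 1 := by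
    intro x y
    have := L.inner_map_map x y
    simp only [PiLp.inner_apply, Fin.sum_univ_two] at this
    simpa [mul_comm] using this
  have h00 : a * a + c * c = 1 := by simpa [e0] using hin e0 e0
  have h01 : a * b + c * d = 0 := by simpa [e0, e1] using hin e0 e1
  have h11 : b * b + d * d = 1 := by simpa [e1] using hin e1 e1
  set δ := a * d - b * c with hδ
  -- The second column of an orthogonal matrix is `δ` times the first one turned by a right angle.
  have hdδ : d = δ * a := by rw [hδ]; linear_combination d * (-h00) + c * h01
  have hbδ : b = -δ * c := by rw [hδ]; linear_combination b * (-h00) + a * h01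
  have hδ2 : δ * δ = 1 := by
    have : δ * δ * (a * a + c * c) = 1 := by rw [← h11]; rw [hdδ, hbδ]; ring
    rwa [h00, mul_one] at this
  have hLx : ∀ x : Plane, L x 0 = a * x 0 + b * x 1 ∧ L x 1 = c * x 0 + d * x 1 := by
    intro x
    have hx : x = x 0 • e0 + x 1 • e1 := by
      ext j; fin_cases j <;> simp [e0, e1]
    have h1 : L x = x 0 • L e0 + x 1 • L e1 := by
      conv_lhs => rw [hx]
      rw [map_add, map_smul, map_smul]
    rw [h1]
    simp only [PiLp.add_apply, PiLp.smul_apply, smul_eq_mul]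
    constructor <;> ring
  have hpull0 : ∀ x w, pullVec M.toHomeomorph x w 0 = a * w 0 + c * w 1 := by
    intro x w
    simp only [pullVec, (hd x).fderiv, Fin.sum_univ_two]
    rfl
  have hpull1 : ∀ x w, pullVec M.toHomeomorph x w 1 = b * w 0 + d * w 1 := by
    intro x w
    simp only [pullVec, (hd x).fderiv, Fin.sum_univ_two]
    rfl
  have hgood : IsGoodChange M.toHomeomorph 1 1 := by
    refine ⟨?_, ?_, ENNReal.one_ne_top, ?_, ?_, ?_⟩
    · have h1 : (M.toHomeomorph : Plane → Plane) = fun x => L x + M 0 := funext hM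
      rw [h1]
      exact L.toContinuousLinearEquiv.contDiff.add contDiff_const
    · have h1 : (M.toHomeomorph.symm : Plane → Plane) = fun x => L.symm (x - M 0) := funext hMs
      rw [h1]
      exact L.symm.toContinuousLinearEquiv.contDiff.comp (contDiff_id.sub contDiff_const)
    · have h1 : (M.toHomeomorph : Plane → Plane) = fun x => L x + M 0 := funext hM
      rw [h1, one_smul]
      exact ((measurePreserving_add_right volume (M 0)).comp L.measurePreserving).map_eq
    · intro j k y t
      rw [(hd _).fderiv, (hd _).fderiv]
    · intro x w
      rw [CVec.norm_sq, CVec.norm_sq, hpull0, hpull1, hdδ, hbδ]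
      refine le_of_eq ?_
      simp
      linear_combination ((w 0).re ^ 2 + (w 0).im ^ 2 + ((w 1).re ^ 2 + (w 1).im ^ 2)) * h00
        + ((c * (w 0).re - a * (w 1).re) ^ 2 + (c * (w 0).im - a * (w 1).im) ^ 2) * hδ2
  have key : Transports M.toHomeomorph (δ * β) β 1 1 := by
    have h := hgood.transports (β := δ * β) (β' := β)
      (θ := fun x => β / 2 * (c * M 0 0 - a * M 0 1) * x 0
        + β / 2 * (d * M 0 0 - b * M 0 1) * x 1) (by fun_prop) ?_
    · rwa [ENNReal.toReal_one] at h
    · intro x j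
      have hθ : HasFDerivAt (fun x : Plane => β / 2 * (c * M 0 0 - a * M 0 1) * x 0
          + β / 2 * (d * M 0 0 - b * M 0 1) * x 1)
          ((β / 2 * (c * M 0 0 - a * M 0 1)) • EuclideanSpace.proj (𝕜 := ℝ) (0 : Fin 2)
            + (β / 2 * (d * M 0 0 - b * M 0 1)) • EuclideanSpace.proj (𝕜 := ℝ) (1 : Fin 2)) x :=
        ((EuclideanSpace.proj (𝕜 := ℝ) (0 : Fin 2)).hasFDerivAt.const_mul _).add
          ((EuclideanSpace.proj (𝕜 := ℝ) (1 : Fin 2)).hasFDerivAt.const_mul _)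
      rw [hθ.fderiv]
      have hy : (M.toHomeomorph x : Plane) = L x + M 0 := hM x
      fin_cases j
      · simp only [Fin.zero_eta, hpull0, stdPotential_zero, stdPotential_one, hy, PiLp.add_apply,
          (hLx x).1, (hLx x).2, hδ]
        simp
        ring
      · simp only [Fin.mk_one, hpull1, stdPotential_zero, stdPotential_one, hy, PiLp.add_apply,
          (hLx x).1, (hLx x).2, hδ]
        simp
        ring
  rcases mul_self_eq_one_iff.1 hδ2 with h | h
  · rwa [h, one_mul] at key
  · rw [h, neg_one_mul] at key
    exact key.conj

/-! #### Shears -/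

/-- The vertical shear `x ↦ (x₁, x₂ + g x₁)`. -/
noncomputable def shear (g : ℝ → ℝ) (hg : Continuous g) : Plane ≃ₜ Plane where
  toFun x := x + g (x 0) • EuclideanSpace.single 1 1
  invFun x := x - g (x 0) • EuclideanSpace.single 1 1
  left_inv x := by simp
  right_inv x := by simp
  continuous_toFun := by fun_prop
  continuous_invFun := by fun_prop

theorem shear_apply_zero (g : ℝ → ℝ) (hg : Continuous g) (x : Plane) : shear g hg x 0 = x 0 := by
  simp [shear]

theorem shear_apply_one (g : ℝ → ℝ) (hg : Continuous g) (x : Plane) :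
    shear g hg x 1 = x 1 + g (x 0) := by
  simp [shear]

theorem shear_symm (g : ℝ → ℝ) (hg : Continuous g) :
    (shear g hg).symm = shear (fun t => -g t) hg.neg := by
  ext x j
  simp [shear, sub_eq_add_neg]

theorem contDiff_shear {g : ℝ → ℝ} (hg : ContDiff ℝ 1 g) :
    ContDiff ℝ 1 (shear g hg.continuous) := by
  have h : ContDiff ℝ 1 fun x : Plane => x 0 := (EuclideanSpace.proj (𝕜 := ℝ) (0 : Fin 2)).contDiff
  exact contDiff_id.add ((hg.comp h).smul contDiff_const)

/-- A shear has Jacobian 1, so it preserves the field exactly, up to a gauge. Its only nontrivial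
coefficient `g'(x₁)` belongs to the second component and does not depend on `x₂`; this is the
invariance required of a good change of variables. -/
theorem transports_shear {g : ℝ → ℝ} (hg : ContDiff ℝ 1 g) {ε : ℝ} (hε : ∀ t, |deriv g t| ≤ ε)
    (β : ℝ) : Transports (shear g hg.continuous) β β 1 ((1 + ε) ^ 2) := by
  have hε0 : 0 ≤ ε := (abs_nonneg _).trans (hε 0)
  have hgd : ∀ t, HasDerivAt g (deriv g t) t := fun t => (hg.differentiable (by simp) t).hasDerivAt
  have hp0 : ∀ x, HasFDerivAt (fun x : Plane => x 0) (EuclideanSpace.proj (𝕜 := ℝ) (0 : Fin 2)) x :=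
    fun x => (EuclideanSpace.proj (𝕜 := ℝ) (0 : Fin 2)).hasFDerivAt
  have hd : ∀ x, HasFDerivAt (shear g hg.continuous) (ContinuousLinearMap.id ℝ Plane
      + (deriv g (x 0) • EuclideanSpace.proj (𝕜 := ℝ) (0 : Fin 2)).smulRight
        (EuclideanSpace.single 1 1)) x := fun x =>
    (hasFDerivAt_id x).add (((hgd (x 0)).comp_hasFDerivAt x (hp0 x)).smul_const _)
  have hpull0 : ∀ x w, pullVec (shear g hg.continuous) x w 0 = w 0 + deriv g (x 0) * w 1 := by
    intro x w
    simp only [pullVec, (hd x).fderiv, Fin.sum_univ_two]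
    simp
  have hpull1 : ∀ x w, pullVec (shear g hg.continuous) x w 1 = w 1 := by
    intro x w
    simp only [pullVec, (hd x).fderiv, Fin.sum_univ_two]
    simp
  have hgood : IsGoodChange (shear g hg.continuous) 1 ((1 + ε) ^ 2) := by
    refine ⟨contDiff_shear hg, ?_, ENNReal.one_ne_top, ?_, ?_, ?_⟩
    · rw [shear_symm]
      exact contDiff_shear hg.neg
    · rw [one_smul]
      have h1 : MeasurePreserving (fun p : ℝ × ℝ => (p.1, p.2 + g p.1)) volume volume :=
        (MeasurePreserving.id volume).skew_product (g := fun x y => y + g x)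
          (by have := hg.continuous; fun_prop)
          (ae_of_all _ fun x => (measurePreserving_add_right volume (g x)).map_eq)
      have h2 := (volume_preserving_planeProd.symm.comp h1).comp volume_preserving_planeProd
      have h3 : (shear g hg.continuous : Plane → Plane)
          = (planeProd.symm ∘ fun p : ℝ × ℝ => (p.1, p.2 + g p.1)) ∘ planeProd := by
        funext x
        ext j
        simp only [Function.comp_apply, planeProd_apply, planeProd_symm_apply]
        fin_cases j
        · exact shear_apply_zero _ _ _
        · exact shear_apply_one _ _ _
      rw [h3]
      exact h2.map_eq
    · intro j k y t
      rw [(hd _).fderiv, (hd _).fderiv, shear_symm]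
      fin_cases j <;> fin_cases k <;> simp [shear_apply_zero]
    · intro x w
      rw [CVec.norm_sq, CVec.norm_sq, hpull0, hpull1]
      set t := deriv g (x 0)
      have ht : |t| ≤ ε := hε _
      have ht2 : t ^ 2 ≤ ε ^ 2 := sq_le_sq' (by linarith [neg_abs_le t]) (by linarith [le_abs_self t])
      have key : ∀ p q : ℝ, (p + t * q) ^ 2 ≤ (1 + ε) * p ^ 2 + (ε + ε ^ 2) * q ^ 2 := by
        intro p q
        have h1 : 2 * (p * (t * q)) ≤ ε * p ^ 2 + ε * q ^ 2 := by
          have : p * q * t ≤ |p * q| * ε := by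
            calc p * q * t ≤ |p * q * t| := le_abs_self _
              _ = |p * q| * |t| := abs_mul _ _
              _ ≤ |p * q| * ε := by gcongr
          have h2 : 2 * |p * q| ≤ p ^ 2 + q ^ 2 := by
            rw [abs_mul]
            nlinarith [sq_nonneg (|p| - |q|), sq_abs p, sq_abs q]
          nlinarith
        nlinarith [mul_nonneg (sub_nonneg.2 ht2) (sq_nonneg q)]
      have e1 : (w 0 + t * w 1).re = (w 0).re + t * (w 1).re := by simp
      have e2 : (w 0 + t * w 1).im = (w 0).im + t * (w 1).im := by simp
      rw [e1, e2]
      have k1 := key (w 0).re (w 1).re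
      have k2 := key (w 0).im (w 1).im
      have h0 := mul_nonneg (add_nonneg hε0 (sq_nonneg ε)) (add_nonneg (sq_nonneg (w 0).re) (sq_nonneg (w 0).im))
      have h1 := mul_nonneg hε0 (add_nonneg (sq_nonneg (w 1).re) (sq_nonneg (w 1).im))
      nlinarith
  -- The pulled back potential differs from the original one by `(β/2) (x₁ g' - g)` in the first
  -- component, whose primitive is `(β/2) (x₁ g - 2P)`.
  set P : ℝ → ℝ := fun t => ∫ s in (0 : ℝ)..t, g s with hP
  have hPd : ∀ t, HasDerivAt P (g t) t := fun t =>
    intervalIntegral.integral_hasDerivAt_right (hg.continuous.intervalIntegrable _ _)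
      (hg.continuous.stronglyMeasurableAtFilter _ _) hg.continuous.continuousAt
  have hPc : ContDiff ℝ 1 P := by
    rw [contDiff_one_iff_deriv]
    refine ⟨fun t => (hPd t).differentiableAt, ?_⟩
    rw [show deriv P = g from funext fun t => (hPd t).deriv]
    exact hg.continuous
  have hx0 : ContDiff ℝ 1 fun x : Plane => x 0 := (EuclideanSpace.proj (𝕜 := ℝ) (0 : Fin 2)).contDiff
  have h := hgood.transports (β := β) (β' := β)
    (θ := fun x => β / 2 * (x 0 * g (x 0) - 2 * P (x 0))) ?_ ?_
  · rwa [ENNReal.toReal_one] at h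
  · have h1 := hg.comp hx0
    have h2 := hPc.comp hx0
    simp only [Function.comp_def] at h1 h2
    fun_prop
  · intro x j
    have hθ1 : HasDerivAt (fun t => β / 2 * (t * g t - 2 * P t))
        (β / 2 * ((1 * g (x 0) + x 0 * deriv g (x 0)) - 2 * g (x 0))) (x 0) :=
      (((hasDerivAt_id (x 0)).mul (hgd (x 0))).sub ((hPd (x 0)).const_mul 2)).const_mul (β / 2)
    have hθ := hθ1.comp_hasFDerivAt x (hp0 x)
    simp only [Function.comp_def] at hθ
    rw [hθ.fderiv]
    fin_cases j
    · simp only [Fin.zero_eta, hpull0, stdPotential_zero, stdPotential_one, shear_apply_zero,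
        shear_apply_one]
      simp
      ring
    · simp only [Fin.mk_one, hpull1, stdPotential_one, shear_apply_zero]
      simp


/-! ### The Rayleigh quotient -/

theorem memLp_magGrad_of_isOpen {V : Set Plane} (hV : IsOpen V) (hb : Bornology.IsBounded V)
    (β : ℝ) {u : Plane → ℂ} {v : Plane → CVec} (h : IsH1 V u v) :
    MemLp (magGrad β u v) 2 (volume.restrict V) := by
  have hcont : Continuous (stdPotential β) := by
    unfold stdPotential
    refine (PiLp.continuous_toLp 2 _).comp (continuous_pi fun j => ?_)
    fin_cases j <;> simp <;> fun_prop
  exact h.memLp_grad.sub (MemLp.smul_bdd hb hV.measurableSet hcont (h.memLp.const_mul Complex.I))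

theorem IsH1.integral_norm_sq_pos {Ω : Set Plane} {u : Plane → ℂ} {v : Plane → CVec}
    (h : IsH1 Ω u v) (h0 : ¬ u =ᵐ[volume.restrict Ω] 0) : 0 < ∫ x in Ω, ‖u x‖ ^ 2 := by
  rw [← norm_sq_toLp h.memLp]
  have : h.memLp.toLp ≠ 0 := fun hz => h0 ((Lp.eq_zero_iff_ae_eq_zero.1 hz).symm.trans
    h.memLp.coeFn_toLp |>.symm)
  positivity

theorem bddBelow_rayleigh (Ω : Set Plane) (β : ℝ) :
    BddBelow {r | ∃ u v, IsH1 Ω u v ∧ ¬ u =ᵐ[volume.restrict Ω] 0 ∧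
      r = (∫ x in Ω, ‖magGrad β u v x‖ ^ 2) / ∫ x in Ω, ‖u x‖ ^ 2} := by
  refine ⟨0, ?_⟩
  rintro _ ⟨u, v, -, -, rfl⟩
  exact div_nonneg (integral_nonneg fun _ => by positivity) (integral_nonneg fun _ => by positivity)

theorem lambda1_nonneg (Ω : Set Plane) (β : ℝ) : 0 ≤ lambda1 Ω β := by
  refine Real.sInf_nonneg ?_
  rintro _ ⟨u, v, -, -, rfl⟩
  exact div_nonneg (integral_nonneg fun _ => by positivity) (integral_nonneg fun _ => by positivity)

theorem IsH1.lambda1_mul_le {Ω : Set Plane} {β : ℝ} {u : Plane → ℂ} {v : Plane → CVec}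
    (h : IsH1 Ω u v) :
    lambda1 Ω β * ∫ x in Ω, ‖u x‖ ^ 2 ≤ ∫ x in Ω, ‖magGrad β u v x‖ ^ 2 := by
  by_cases h0 : u =ᵐ[volume.restrict Ω] 0
  · have : ∫ x in Ω, ‖u x‖ ^ 2 = 0 := by
      rw [integral_eq_zero_of_ae]
      filter_upwards [h0] with x hx
      simp [hx]
    rw [this, mul_zero]
    exact integral_nonneg fun _ => by positivity
  · rw [← le_div_iff₀ (h.integral_norm_sq_pos h0)]
    exact csInf_le (bddBelow_rayleigh Ω β) ⟨u, v, h, h0, rfl⟩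

theorem lambda1_lt_of_isH1 {Ω : Set Plane} {β c : ℝ} {u : Plane → ℂ} {v : Plane → CVec}
    (h : IsH1 Ω u v)
    (hlt : ∫ x in Ω, ‖magGrad β u v x‖ ^ 2 < c * ∫ x in Ω, ‖u x‖ ^ 2) : lambda1 Ω β < c := by
  have h0 : ¬ u =ᵐ[volume.restrict Ω] 0 := by
    intro h0
    have : ∫ x in Ω, ‖u x‖ ^ 2 = 0 := by
      rw [integral_eq_zero_of_ae]
      filter_upwards [h0] with x hx
      simp [hx]
    rw [this, mul_zero] at hlt
    exact absurd hlt (not_lt.2 (integral_nonneg fun _ => by positivity))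
  have h1 := h.lambda1_mul_le (β := β)
  exact lt_of_mul_lt_mul_right (h1.trans_lt hlt) (h.integral_norm_sq_pos h0).le

theorem le_lambda1 {Ω : Set Plane} (hΩ : IsOpen Ω) (hb : Bornology.IsBounded Ω)
    (hne : Ω.Nonempty) {β c : ℝ} (h : ∀ u v, IsH1 Ω u v →
      c * ∫ x in Ω, ‖u x‖ ^ 2 ≤ ∫ x in Ω, ‖magGrad β u v x‖ ^ 2) : c ≤ lambda1 Ω β := by
  refine le_csInf ?_ ?_
  -- Since `sInf ∅ = 0`, the set of quotients must be shown to be nonempty; the constant function 1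
  -- is not almost everywhere zero on a nonempty open set.
  · refine ⟨_, _, _, isH1_one hΩ hb, ?_, rfl⟩
    intro h0
    have : volume.restrict Ω = 0 := by
      rw [← ae_eq_bot]
      by_contra hbot
      have : NeBot (ae (volume.restrict Ω)) := ⟨hbot⟩
      obtain ⟨x, hx⟩ := h0.exists
      exact one_ne_zero hx
    rw [Measure.restrict_eq_zero] at this
    exact (hΩ.measure_pos volume hne).ne' this
  · rintro _ ⟨u, v, hu, h0, rfl⟩
    rw [le_div_iff₀ (hu.integral_norm_sq_pos h0)]
    exact h u v hu

/-! ### The half-plane ground state -/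

/-- A ground state of the half-plane, in the gauge of `stdPotential`. -/
theorem exists_halfPlane_state {f f' : ℝ → ℝ} (hf : ∀ t, HasDerivAt f (f' t) t)
    (hf' : Continuous f') {β : ℝ} (hβ : 0 ≤ β) (k : ℝ) :
    ∃ u : Plane → ℂ, ContDiff ℝ 1 u ∧ (∀ x, ‖u x‖ ^ 2 = f (Real.sqrt β * x 1) ^ 2) ∧
      ∀ x, ‖magGrad β u (cgrad u) x‖ ^ 2 = β * ((Real.sqrt β * x 1 - k) ^ 2
        * f (Real.sqrt β * x 1) ^ 2 + f' (Real.sqrt β * x 1) ^ 2) := by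
  set b := Real.sqrt β with hb
  have hb2 : b ^ 2 = β := Real.sq_sqrt hβ
  have hp : ∀ (j : Fin 2) x, HasFDerivAt (fun x : Plane => x j) (EuclideanSpace.proj (𝕜 := ℝ) j) x :=
    fun j x => (EuclideanSpace.proj (𝕜 := ℝ) j).hasFDerivAt
  -- The quadratic term changes the gauge so that the potential points along `x₁`, and the linear
  -- term selects the momentum: `∇θ - A = (b (b x₂ - k), 0)`.
  set θ : Plane → ℝ := fun x => β / 2 * (x 0 * x 1) - b * k * x 0 with hθ
  have hθd : ∀ x, HasFDerivAt θ ((β / 2) • (x 0 • EuclideanSpace.proj (𝕜 := ℝ) (1 : Fin 2)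
      + x 1 • EuclideanSpace.proj (𝕜 := ℝ) (0 : Fin 2))
      - (b * k) • EuclideanSpace.proj (𝕜 := ℝ) (0 : Fin 2)) x := fun x =>
    (((hp 0 x).mul (hp 1 x)).const_mul (β / 2)).sub ((hp 0 x).const_mul (b * k))
  set a : Plane → ℂ := fun x => Complex.exp ((θ x : ℂ) * Complex.I) with ha
  have had : ∀ x, HasFDerivAt a (a x • (Complex.I • Complex.ofRealCLM.comp
      ((β / 2) • (x 0 • EuclideanSpace.proj (𝕜 := ℝ) (1 : Fin 2)
      + x 1 • EuclideanSpace.proj (𝕜 := ℝ) (0 : Fin 2))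
      - (b * k) • EuclideanSpace.proj (𝕜 := ℝ) (0 : Fin 2)))) x := fun x =>
    ((Complex.ofRealCLM.hasFDerivAt.comp x (hθd x)).mul_const Complex.I).cexp
  set w : Plane → ℝ := fun x => f (b * x 1) with hw
  have hwd : ∀ x, HasFDerivAt w ((f' (b * x 1) * b) • EuclideanSpace.proj (𝕜 := ℝ) (1 : Fin 2)) x := by
    intro x
    have h1 : HasDerivAt (fun t => f (b * t)) (f' (b * x 1) * b) (x 1) := by
      have hl : HasDerivAt (fun y => b * y) b (x 1) := by
        simpa using (hasDerivAt_id (x 1)).const_mul b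
      exact (hf (b * x 1)).comp (x 1) hl
    exact HasDerivAt.comp_hasFDerivAt (h₂ := fun t => f (b * t)) x h1 (hp 1 x)
  have hud : ∀ x, HasFDerivAt (fun x => a x * (w x : ℂ))
      (a x • Complex.ofRealCLM.comp ((f' (b * x 1) * b) • EuclideanSpace.proj (𝕜 := ℝ) (1 : Fin 2))
        + (w x : ℂ) • (a x • (Complex.I • Complex.ofRealCLM.comp
      ((β / 2) • (x 0 • EuclideanSpace.proj (𝕜 := ℝ) (1 : Fin 2)
      + x 1 • EuclideanSpace.proj (𝕜 := ℝ) (0 : Fin 2))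
      - (b * k) • EuclideanSpace.proj (𝕜 := ℝ) (0 : Fin 2))))) x := fun x =>
    (had x).mul (Complex.ofRealCLM.hasFDerivAt.comp x (hwd x))
  have hnorm : ∀ x, ‖a x‖ = 1 := fun x => Complex.norm_exp_ofReal_mul_I _
  refine ⟨fun x => a x * (w x : ℂ), ?_, ?_, ?_⟩
  · have hfC : ContDiff ℝ 1 f := by
      rw [contDiff_one_iff_deriv]
      exact ⟨fun t => (hf t).differentiableAt, by
        rwa [show deriv f = f' from funext fun t => (hf t).deriv]⟩
    have hx : ∀ j : Fin 2, ContDiff ℝ 1 fun x : Plane => x j := fun j =>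
      (EuclideanSpace.proj (𝕜 := ℝ) j).contDiff
    have hθC : ContDiff ℝ 1 θ := by
      have h0 := hx 0
      have h1 := hx 1
      fun_prop
    have hwC : ContDiff ℝ 1 w := hfC.comp (contDiff_const.mul (hx 1))
    exact ((Complex.ofRealCLM.contDiff.comp hθC).mul contDiff_const).cexp.mul
      (Complex.ofRealCLM.contDiff.comp hwC)
  · intro x
    rw [norm_mul, hnorm, one_mul, Complex.norm_real, Real.norm_eq_abs, sq_abs]
  · intro x
    have e0 : magGrad β (fun x => a x * (w x : ℂ)) (cgrad fun x => a x * (w x : ℂ)) x 0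
        = a x * (((b * (b * x 1 - k) * w x : ℝ) : ℂ) * Complex.I) := by
      simp only [magGrad, cgrad, PiLp.sub_apply, PiLp.smul_apply, smul_eq_mul, stdPotential_zero,
        (hud x).fderiv]
      simp
      rw [show (β : ℂ) = (b : ℂ) ^ 2 by rw [← hb2]; push_cast; rfl]
      ring
    have e1 : magGrad β (fun x => a x * (w x : ℂ)) (cgrad fun x => a x * (w x : ℂ)) x 1
        = a x * ((b * f' (b * x 1) : ℝ) : ℂ) := by
      simp only [magGrad, cgrad, PiLp.sub_apply, PiLp.smul_apply, smul_eq_mul, stdPotential_one,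
        (hud x).fderiv]
      simp
      ring
    rw [EuclideanSpace.norm_sq_eq, Fin.sum_univ_two, e0, e1, norm_mul, norm_mul, norm_mul, hnorm,
      Complex.norm_real, Complex.norm_real, Complex.norm_I, Real.norm_eq_abs, Real.norm_eq_abs,
      one_mul, one_mul, mul_one, sq_abs, sq_abs, ← hb2]
    ring

/-- Fubini's theorem in the plane. -/
theorem integral_plane {G : Plane → ℝ} (hG : Integrable G) :
    ∫ x, G x = ∫ s, ∫ y, G !₂[s, y] ∧ Integrable (fun s : ℝ => ∫ y : ℝ, G !₂[s, y]) := by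
  have h1 : Integrable (fun p : ℝ × ℝ => G (planeProd.symm p)) (volume.prod volume) :=
    (volume_preserving_planeProd.symm.integrable_comp_emb
      planeProd.symm.measurableEmbedding).2 hG
  refine ⟨?_, h1.integral_prod_left⟩
  rw [← volume_preserving_planeProd.symm.integral_comp planeProd.symm.measurableEmbedding]
  exact integral_prod _ h1

/-- The hypothesis covers both classes of domains: each nonempty vertical slice lies in a segment
`(0, T)` and misses only points at heights where the energy density of the trial state is
nonnegative. -/
theorem lambda1_lt_of_slices {Ω : Set Plane} (hΩ : IsOpen Ω) (hb : Bornology.IsBounded Ω)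
    (hne : Ω.Nonempty) {β : ℝ} (hβ : 0 < β)
    (hslice : ∀ x ∈ Ω, ∃ T, 0 < T ∧ (∀ y, !₂[x 0, y] ∈ Ω → y ∈ Ioo 0 T) ∧
      ∀ y ∈ Ioo 0 T, !₂[x 0, y] ∉ Ω → 2 * Real.sqrt deGennesConst ≤ Real.sqrt β * y) :
    ∃ u v, IsH1 Ω u v ∧ ∫ x in Ω, ‖magGrad β u v x‖ ^ 2
      < deGennesConst * β * ∫ x in Ω, ‖u x‖ ^ 2 := by
  obtain ⟨f, f', hΘ, hf, hf', h0, hpos, hneg⟩ := exists_deGennes_groundState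
  have hfc : Continuous f := continuous_iff_continuousAt.2 fun t => (hf t).continuousAt
  have hfc' : Continuous f' := continuous_iff_continuousAt.2 fun t => (hf' t).continuousAt
  set Θ := deGennesConst
  set b := Real.sqrt β with hbdef
  have hb0 : 0 < b := Real.sqrt_pos.2 hβ
  have hb2 : b ^ 2 = β := Real.sq_sqrt hβ.le
  obtain ⟨u, hu, hun, hue⟩ := exists_halfPlane_state hf hfc' hβ.le (Real.sqrt Θ)
  refine ⟨u, cgrad u, isH1_of_contDiff hΩ hb hu, ?_⟩
  have hsΘ : Real.sqrt Θ ^ 2 = Θ := Real.sq_sqrt hΘ.le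
  -- The excess density `|∇ᴬu|² - Θ₀ β |u|²`. By the equation for `f` it is the derivative of `b
  -- f(by) f'(by)`, which vanishes at `y = 0`.
  set E : ℝ → ℝ := fun y => β * (((b * y - Real.sqrt Θ) ^ 2 - Θ) * f (b * y) ^ 2 + f' (b * y) ^ 2)
    with hE
  have hEc : Continuous E := by fun_prop
  have hH : ∀ y, HasDerivAt (fun y => b * (f (b * y) * f' (b * y))) (E y) y := by
    intro y
    have hl : HasDerivAt (fun y => b * y) b y := by simpa using (hasDerivAt_id y).const_mul b
    have h1 := (hf (b * y)).comp y hl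
    have h2 := (hf' (b * y)).comp y hl
    refine ((h1.mul h2).const_mul b).congr_deriv ?_
    simp only [hE, ← hb2, Function.comp_apply]
    ring
  have hEint : ∀ T, ∫ y in (0 : ℝ)..T, E y = b * (f (b * T) * f' (b * T)) := by
    intro T
    rw [intervalIntegral.integral_eq_sub_of_hasDerivAt (fun y _ => hH y)
      (hEc.intervalIntegrable _ _)]
    simp [h0]
  have hEnn : ∀ y, 2 * Real.sqrt Θ ≤ b * y → 0 ≤ E y := by
    intro y hy
    have : 0 ≤ (b * y - Real.sqrt Θ) ^ 2 - Θ := by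
      nlinarith [Real.sqrt_nonneg Θ]
    positivity
  have i1 : IntegrableOn (fun x => ‖magGrad β u (cgrad u) x‖ ^ 2) Ω :=
    (memLp_magGrad_of_isOpen hΩ hb β (isH1_of_contDiff hΩ hb hu)).integrable_norm_pow (by norm_num)
  have i2 : IntegrableOn (fun x => ‖u x‖ ^ 2) Ω :=
    (isH1_of_contDiff hΩ hb hu).memLp.integrable_norm_pow (by norm_num)
  rw [← sub_neg, ← integral_const_mul, ← integral_sub i1 (i2.const_mul _)]
  have e1 : ∀ x, ‖magGrad β u (cgrad u) x‖ ^ 2 - Θ * β * ‖u x‖ ^ 2 = E (x 1) := by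
    intro x
    rw [hue, hun]
    simp only [hE]
    ring
  have i3 : IntegrableOn (fun x : Plane => E (x 1)) Ω :=
    (i1.sub (i2.const_mul (Θ * β))).congr (Eventually.of_forall e1)
  simp only [e1]
  have hm := hΩ.measurableSet
  rw [← integral_indicator hm]
  obtain ⟨hF, hFi⟩ := integral_plane ((integrable_indicator_iff hm).2 i3)
  rw [hF]
  set h : ℝ → ℝ := fun s => ∫ y : ℝ, Ω.indicator (fun x : Plane => E (x 1)) !₂[s, y] with hh
  have hmk : ∀ s : ℝ, Continuous fun y : ℝ => (!₂[s, y] : Plane) := fun s => by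
    refine (PiLp.continuous_toLp 2 _).comp (continuous_pi fun j => ?_)
    fin_cases j <;> simp <;> fun_prop
  have hslice_int : ∀ s, h s = ∫ y in {y : ℝ | (!₂[s, y] : Plane) ∈ Ω}, E y := by
    intro s
    have hmS : MeasurableSet {y : ℝ | (!₂[s, y] : Plane) ∈ Ω} := hm.preimage (hmk s).measurable
    rw [← integral_indicator hmS]
    rfl
  have hempty : ∀ s, (∀ y, (!₂[s, y] : Plane) ∉ Ω) → h s = 0 := by
    intro s hs
    rw [hslice_int, show {y : ℝ | (!₂[s, y] : Plane) ∈ Ω} = ∅ from eq_empty_of_forall_notMem hs]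
    simp
  have hnonempty : ∀ s y, (!₂[s, y] : Plane) ∈ Ω → h s < 0 := by
    intro s y hy
    obtain ⟨T, hT, hsub, hge⟩ := hslice _ hy
    have hsub' : {y : ℝ | (!₂[s, y] : Plane) ∈ Ω} ⊆ Ioo 0 T := fun z hz => hsub z hz
    have hmS : MeasurableSet {y : ℝ | (!₂[s, y] : Plane) ∈ Ω} := hm.preimage (hmk s).measurable
    have hi : IntegrableOn E (Ioo 0 T) :=
      (hEc.continuousOn.integrableOn_compact isCompact_Icc).mono_set Ioo_subset_Icc_self
    rw [hslice_int]
    have h1 : ∫ y in Ioo 0 T, E y = b * (f (b * T) * f' (b * T)) := by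
      rw [← hEint, intervalIntegral.integral_of_le hT.le, integral_Ioc_eq_integral_Ioo]
    -- Filling the gaps of the slice adds only nonnegative contributions.
    have h2 : ∫ y in {y : ℝ | (!₂[s, y] : Plane) ∈ Ω}, E y ≤ ∫ y in Ioo 0 T, E y := by
      rw [← integral_indicator hmS, ← integral_indicator measurableSet_Ioo]
      refine integral_mono ((integrable_indicator_iff hmS).2 (hi.mono_set hsub'))
        ((integrable_indicator_iff measurableSet_Ioo).2 hi) fun z => ?_
      by_cases hz : (!₂[s, z] : Plane) ∈ Ω
      · rw [indicator_of_mem (show z ∈ {y : ℝ | (!₂[s, y] : Plane) ∈ Ω} from hz),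
          indicator_of_mem (hsub' hz)]
      · rw [indicator_of_notMem (show z ∉ {y : ℝ | (!₂[s, y] : Plane) ∈ Ω} from hz)]
        by_cases hz2 : z ∈ Ioo 0 T
        · rw [indicator_of_mem hz2]
          exact hEnn z (hge z hz2 hz)
        · rw [indicator_of_notMem hz2]
    refine h2.trans_lt ?_
    rw [h1]
    have hbT : 0 < b * T := mul_pos hb0 hT
    exact mul_neg_of_pos_of_neg hb0 (mul_neg_of_pos_of_neg (hpos _) (hneg _ hbT))
  have hle : ∀ s, h s ≤ 0 := by
    intro s
    by_cases hs : ∃ y, (!₂[s, y] : Plane) ∈ Ω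
    · obtain ⟨y, hy⟩ := hs
      exact (hnonempty s y hy).le
    · exact (hempty s (not_exists.1 hs)).le
  -- Strictness: the slice integral is negative for an open nonempty set of abscissas.
  have hposint : 0 < ∫ s, -h s := by
    rw [integral_pos_iff_support_of_nonneg (fun s => neg_nonneg.2 (hle s)) hFi.neg]
    obtain ⟨x, hx⟩ := hne
    have hcont : Continuous fun s : ℝ => (!₂[s, x 1] : Plane) := by
      refine (PiLp.continuous_toLp 2 _).comp (continuous_pi fun j => ?_)
      fin_cases j <;> simp <;> fun_prop
    have hxe : (!₂[x 0, x 1] : Plane) = x := by ext j; fin_cases j <;> rfl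
    refine ((hΩ.preimage hcont).measure_pos volume ⟨x 0, by simpa [hxe] using hx⟩).trans_le
      (measure_mono fun s hs => ?_)
    exact (neg_pos.2 (hnonempty s _ hs)).ne'
  rw [integral_neg] at hposint
  linarith

theorem lambda1_lt_of_isometry {Ω : Set Plane} (hΩ : IsBoundedDomain Ω) {β : ℝ} (hβ : 0 < β)
    (M : Plane ≃ᵢ Plane) (h : IsSubgraph (M '' Ω) ∨
      FillsHalfStripTo (2 * Real.sqrt (deGennesConst / β)) (M '' Ω)) :
    lambda1 Ω β < deGennesConst * β := by
  have hb : Bornology.IsBounded (M '' Ω) := by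
    have := (hΩ.isBounded.isCompact_closure.image M.continuous).isBounded
    exact this.subset (image_mono subset_closure)
  have ho : IsOpen (M '' Ω) := M.toHomeomorph.isOpenMap _ hΩ.isOpen
  have hsl : ∃ u v, IsH1 (M '' Ω) u v ∧ ∫ x in M '' Ω, ‖magGrad β u v x‖ ^ 2
      < deGennesConst * β * ∫ x in M '' Ω, ‖u x‖ ^ 2 := by
    refine lambda1_lt_of_slices ho hb (hΩ.isConnected.nonempty.image M) hβ fun x hx => ?_
    rcases h with ⟨a, b, g, -, -, -, hg⟩ | ⟨a, b, -, hsub, hsup⟩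
    · rw [hg] at hx ⊢
      refine ⟨g (x 0), hx.2.1.trans hx.2.2, fun y hy => hy.2, fun y hy hy' => ?_⟩
      exact absurd ⟨hx.1, hy⟩ hy'
    -- Any height above the whole domain serves as `T`; the points missing below it lie above the
    -- filled part of the strip.
    · obtain ⟨R, hR⟩ := hb.exists_norm_le
      have hlt : ∀ y, !₂[x 0, y] ∈ M '' Ω → y ∈ Ioo 0 (R + 1) := by
        intro y hy
        refine ⟨(hsub hy).2, ?_⟩
        have h1 := (PiLp.norm_apply_le (!₂[x 0, y] : Plane) 1).trans (hR _ hy)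
        have h2 : |y| ≤ R := h1
        linarith [le_abs_self y]
      have hx1 := hlt (x 1) (by
        rwa [show (!₂[x 0, x 1] : Plane) = x from by ext j; fin_cases j <;> rfl])
      refine ⟨R + 1, hx1.1.trans hx1.2, hlt, fun y hy hy' => ?_⟩
      have hge : 2 * Real.sqrt (deGennesConst / β) ≤ y := by
        by_contra! hlt'
        exact hy' (hsup ⟨(hsub hx).1, hy.1, hlt'⟩)
      have hsq : Real.sqrt deGennesConst = Real.sqrt β * Real.sqrt (deGennesConst / β) := by
        rw [← Real.sqrt_mul hβ.le, mul_div_cancel₀ _ hβ.ne']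
      rw [hsq]
      nlinarith [Real.sqrt_nonneg β]
  obtain ⟨u, v, hu, hlt⟩ := hsl
  obtain ⟨u', v', hu', -, hn, he⟩ := transports_isometry M β _ ho hb u v hu
  have hpre : M.toHomeomorph ⁻¹' (M '' Ω) = Ω := preimage_image_eq _ M.injective
  rw [hpre] at hu' hn he
  refine lambda1_lt_of_isH1 hu' ?_
  rw [hn]
  linarith


/-! ### Charts of a curvilinear polygon -/

/-- A function that agrees on `[0, δ]` with a given primitive of `d`, and is affine outside. -/
noncomputable def clampPrimitive (δ : ℝ) (d : ℝ → ℝ) (x : ℝ) : ℝ :=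
  ∫ t in (0 : ℝ)..x, d (max 0 (min t δ))

theorem clamp_mem {δ : ℝ} (hδ : 0 ≤ δ) (t : ℝ) : max 0 (min t δ) ∈ Icc 0 δ :=
  ⟨le_max_left _ _, max_le hδ (min_le_right _ _)⟩

theorem clamp_of_mem {δ t : ℝ} (ht : t ∈ Icc 0 δ) : max 0 (min t δ) = t := by
  rw [min_eq_left ht.2, max_eq_right ht.1]

theorem continuous_clamp_comp {δ : ℝ} (hδ : 0 ≤ δ) {d : ℝ → ℝ} (hd : ContinuousOn d (Icc 0 δ)) :
    Continuous fun t => d (max 0 (min t δ)) :=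
  hd.comp_continuous (by fun_prop) (clamp_mem hδ)

theorem hasDerivAt_clampPrimitive {δ : ℝ} (hδ : 0 ≤ δ) {d : ℝ → ℝ} (hd : ContinuousOn d (Icc 0 δ))
    (x : ℝ) : HasDerivAt (clampPrimitive δ d) (d (max 0 (min x δ))) x :=
  ((continuous_clamp_comp hδ hd).integral_hasStrictDerivAt 0 x).hasDerivAt

theorem contDiff_clampPrimitive {δ : ℝ} (hδ : 0 ≤ δ) {d : ℝ → ℝ} (hd : ContinuousOn d (Icc 0 δ)) :
    ContDiff ℝ 1 (clampPrimitive δ d) := by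
  rw [contDiff_one_iff_deriv]
  refine ⟨fun x => (hasDerivAt_clampPrimitive hδ hd x).differentiableAt, ?_⟩
  rw [show deriv (clampPrimitive δ d) = _ from
    funext fun x => (hasDerivAt_clampPrimitive hδ hd x).deriv]
  exact continuous_clamp_comp hδ hd

theorem clampPrimitive_of_nonpos {δ : ℝ} (hδ : 0 ≤ δ) (d : ℝ → ℝ) {x : ℝ} (hx : x ≤ 0) :
    clampPrimitive δ d x = d 0 * x := by
  rw [clampPrimitive, intervalIntegral.integral_congr (g := fun _ => d 0)]
  · simp [mul_comm]
  · intro t ht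
    rw [uIcc_of_ge hx] at ht
    simp only
    rw [min_eq_left (ht.2.trans hδ), max_eq_left ht.2]

theorem clampPrimitive_of_mem {δ : ℝ} {a d : ℝ → ℝ}
    (hd : ContinuousOn d (Icc 0 δ)) (ha : ∀ t ∈ Icc 0 δ, HasDerivWithinAt a (d t) (Icc 0 δ) t)
    (h0 : a 0 = 0) {x : ℝ} (hx : x ∈ Icc 0 δ) : clampPrimitive δ d x = a x := by
  have hδ : 0 ≤ δ := hx.1.trans hx.2
  rw [clampPrimitive, intervalIntegral.integral_eq_sub_of_hasDeriv_right_of_le hx.1 (f := a), h0,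
    sub_zero]
  · exact fun t ht => ((ha t ⟨ht.1, ht.2.trans hx.2⟩).continuousWithinAt).mono
      (Icc_subset_Icc_right hx.2)
  · intro t ht
    rw [clamp_of_mem ⟨ht.1.le, ht.2.le.trans hx.2⟩]
    refine ((ha t ⟨ht.1.le, ht.2.le.trans hx.2⟩).hasDerivAt
      (Icc_mem_nhds ht.1 (ht.2.trans_le hx.2))).hasDerivWithinAt
  · exact (continuous_clamp_comp hδ hd).intervalIntegrable _ _

/-- Freezing `a'` and `b'` outside a short interval extends the two coordinates to functions `p` and
`q` on `ℝ`, with `p` a `C¹` homeomorphism, and `g = q ∘ p⁻¹`. Its slope `b'/a'` is then everywhere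
close to the initial slope, and `g` is linear on `(-∞, 0]`. This linearity lets the two arcs at a
point be straightened one after the other. -/
theorem exists_graph_function {a b a' b' : ℝ → ℝ}
    (ha : ∀ t ∈ Icc (0 : ℝ) 1, HasDerivWithinAt a (a' t) (Icc 0 1) t)
    (hb : ∀ t ∈ Icc (0 : ℝ) 1, HasDerivWithinAt b (b' t) (Icc 0 1) t)
    (ha' : ContinuousOn a' (Icc 0 1)) (hb' : ContinuousOn b' (Icc 0 1))
    (ha0 : a 0 = 0) (hb0 : b 0 = 0) (hpos : 0 < a' 0) {ε : ℝ} (hε : 0 < ε) :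
    ∃ (g : ℝ → ℝ) (δ : ℝ), 0 < δ ∧ δ ≤ 1 ∧ ContDiff ℝ 1 g ∧ (∀ x ≤ 0, g x = b' 0 / a' 0 * x) ∧
      (∀ x, |deriv g x - b' 0 / a' 0| ≤ ε) ∧ StrictMonoOn a (Icc 0 δ) ∧
      ∀ t ∈ Icc 0 δ, g (a t) = b t := by
  have h01 : (0 : ℝ) ∈ Icc (0 : ℝ) 1 := ⟨le_rfl, zero_le_one⟩
  have hev : ∀ᶠ t in 𝓝[Icc 0 1] (0 : ℝ), a' 0 / 2 < a' t ∧ |b' t / a' t - b' 0 / a' 0| < ε := by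
    refine (((ha' 0 h01).eventually (lt_mem_nhds (half_lt_self hpos)))).and ?_
    have := ((hb' 0 h01).div (ha' 0 h01) hpos.ne').eventually (Metric.ball_mem_nhds _ hε)
    filter_upwards [this] with t ht
    simpa only [Real.dist_eq, Pi.div_apply] using ht
  obtain ⟨δ, hδ, hδ'⟩ := Metric.mem_nhdsWithin_iff.1 hev
  obtain ⟨r, hr0, hr⟩ : ∃ r : ℝ, 0 < r ∧ r < min δ 1 := exists_between (lt_min hδ one_pos)
  have hr1 : r ≤ 1 := (hr.trans_le (min_le_right _ _)).le
  have hsub : Icc 0 r ⊆ Icc (0 : ℝ) 1 := Icc_subset_Icc_right hr1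
  have hgood : ∀ t ∈ Icc 0 r, a' 0 / 2 < a' t ∧ |b' t / a' t - b' 0 / a' 0| < ε := by
    intro t ht
    refine hδ' ⟨?_, hsub ht⟩
    rw [Metric.mem_ball, Real.dist_eq, sub_zero, abs_of_nonneg ht.1]
    exact ht.2.trans_lt (hr.trans_le (min_le_left _ _))
  have hca := ha'.mono hsub
  have hcb := hb'.mono hsub
  set p := clampPrimitive r a' with hp
  set q := clampPrimitive r b' with hq
  have hpd := hasDerivAt_clampPrimitive hr0.le hca
  have hqd := hasDerivAt_clampPrimitive hr0.le hcb
  have hpos' : ∀ x, a' 0 / 2 < a' (max 0 (min x r)) := fun x => (hgood _ (clamp_mem hr0.le x)).1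
  have hmono : Monotone fun x => p x - a' 0 / 2 * x := by
    refine monotone_of_hasDerivAt_nonneg (fun x => (hpd x).sub ((hasDerivAt_id x).const_mul _)) ?_
    intro x
    simpa using (hpos' x).le
  have hp0 : p 0 = 0 := by simp [hp, clampPrimitive]
  have hpm : StrictMono p := strictMono_of_hasDerivAt_pos hpd
    fun x => (half_pos hpos).trans (hpos' x)
  have hpc : Continuous p := (contDiff_clampPrimitive hr0.le hca).continuous
  have hps : Function.Surjective p := by
    refine hpc.surjective ?_ ?_
    · refine tendsto_atTop_mono' _ ?_ (tendsto_id.const_mul_atTop (half_pos hpos))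
      filter_upwards [eventually_ge_atTop 0] with x hx
      have := hmono hx
      simp only [hp0, mul_zero, sub_zero] at this
      simp only [id]; linarith
    · refine tendsto_atBot_mono' _ ?_ (tendsto_id.const_mul_atBot (half_pos hpos))
      filter_upwards [eventually_le_atBot 0] with x hx
      have := hmono hx
      simp only [hp0, mul_zero, sub_zero] at this
      simp only [id]; linarith
  let e : ℝ ≃ₜ ℝ := (hpm.orderIsoOfSurjective p hps).toHomeomorph
  have he : ∀ x, e x = p x := fun x => rfl
  have hne : ∀ x, a' (max 0 (min x r)) ≠ 0 := fun x => ((half_pos hpos).trans (hpos' x)).ne'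
  have hed : ∀ y, HasDerivAt e.symm (a' (max 0 (min (e.symm y) r)))⁻¹ y := fun y =>
    HasDerivAt.of_local_left_inverse (f := e) e.symm.continuous.continuousAt (hpd _) (hne _)
      (Eventually.of_forall fun z => e.apply_symm_apply z)
  have hgd : ∀ y, HasDerivAt (fun y => q (e.symm y))
      (b' (max 0 (min (e.symm y) r)) / a' (max 0 (min (e.symm y) r))) y := fun y =>
    (hqd _).comp y (hed y)
  have heq : ∀ t ∈ Icc 0 r, p t = a t := fun t ht => clampPrimitive_of_mem hca
    (fun t ht => (ha t (hsub ht)).mono hsub) ha0 ht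
  refine ⟨fun y => q (e.symm y), r, hr0, hr1, ?_, ?_, ?_, ?_, ?_⟩
  · rw [contDiff_one_iff_deriv]
    refine ⟨fun y => (hgd y).differentiableAt, ?_⟩
    rw [show deriv (fun y => q (e.symm y)) = _ from funext fun y => (hgd y).deriv]
    exact ((continuous_clamp_comp hr0.le hcb).comp e.symm.continuous).div
      ((continuous_clamp_comp hr0.le hca).comp e.symm.continuous) fun y => hne _
  · intro x hx
    have h1 : p (x / a' 0) = x := by
      rw [hp, clampPrimitive_of_nonpos hr0.le _ (div_nonpos_of_nonpos_of_nonneg hx hpos.le)]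
      field_simp
    have h2 : e.symm x = x / a' 0 := by rw [e.symm_apply_eq, he, h1]
    simp only [h2, hq]
    rw [clampPrimitive_of_nonpos hr0.le _ (div_nonpos_of_nonpos_of_nonneg hx hpos.le)]
    ring
  · intro x
    rw [(hgd x).deriv]
    exact (hgood _ (clamp_mem hr0.le _)).2.le
  · intro s hs t ht hst
    rw [← heq s hs, ← heq t ht]
    exact hpm hst
  · intro t ht
    have : e.symm (a t) = t := by rw [e.symm_apply_eq, he, heq t ht]
    simp only [this]
    exact clampPrimitive_of_mem hcb (fun t ht => (hb t (hsub ht)).mono hsub) hb0 ht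

/-! ### Arcs as graphs near their starting point. -/

/-- `A` is a simple `C¹` arc that starts at `p` with velocity `v`. -/
def IsArc (A : Set Plane) (p v : Plane) : Prop :=
  ∃ c d : ℝ → Plane, c 0 = p ∧ d 0 = v ∧
    (∀ t ∈ Icc (0 : ℝ) 1, HasDerivWithinAt c (d t) (Icc 0 1) t) ∧ ContinuousOn d (Icc 0 1) ∧
    InjOn c (Icc 0 1) ∧ A = c '' Icc 0 1

theorem IsArc.image {A : Set Plane} {p v : Plane} (h : IsArc A p v) {Φ : Plane → Plane}
    (hΦ : ContDiff ℝ 1 Φ) (hi : Function.Injective Φ) : IsArc (Φ '' A) (Φ p) (fderiv ℝ Φ p v) := by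
  obtain ⟨c, d, rfl, rfl, hc, hd, hinj, rfl⟩ := h
  have hcc : ContinuousOn c (Icc 0 1) := fun t ht => (hc t ht).continuousWithinAt
  refine ⟨fun t => Φ (c t), fun t => fderiv ℝ Φ (c t) (d t), rfl, rfl, ?_, ?_, ?_, ?_⟩
  · exact fun t ht => ((hΦ.differentiable (by simp) _).hasFDerivAt).comp_hasDerivWithinAt t (hc t ht)
  · exact ((hΦ.continuous_fderiv (by simp)).comp_continuousOn hcc).clm_apply hd
  · exact hi.comp_injOn hinj
  · rw [image_image]

/-- Only a short initial piece is a graph; by injectivity the rest of the arc is a compact set that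
misses the origin. -/
theorem IsArc.exists_graph {A : Set Plane} {v : Plane} (h : IsArc A 0 v) (hv : 0 < v 0) {ε : ℝ}
    (hε : 0 < ε) : ∃ g : ℝ → ℝ, ContDiff ℝ 1 g ∧ (∀ x ≤ 0, g x = v 1 / v 0 * x) ∧
      (∀ x, |deriv g x - v 1 / v 0| ≤ ε) ∧
      ∀ᶠ x in 𝓝 (0 : Plane), x ∈ A ↔ 0 ≤ x 0 ∧ x 1 = g (x 0) := by
  obtain ⟨c, d, h0, rfl, hc, hd, hinj, rfl⟩ := h
  have hcc : ContinuousOn c (Icc 0 1) := fun t ht => (hc t ht).continuousWithinAt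
  have hcomp : ∀ j : Fin 2, ∀ t ∈ Icc (0 : ℝ) 1,
      HasDerivWithinAt (fun t => c t j) (d t j) (Icc 0 1) t := fun j t ht =>
    ((EuclideanSpace.proj (𝕜 := ℝ) j).hasFDerivAt).comp_hasDerivWithinAt t (hc t ht)
  have hdcomp : ∀ j : Fin 2, ContinuousOn (fun t => d t j) (Icc 0 1) := fun j =>
    (EuclideanSpace.proj (𝕜 := ℝ) j).continuous.comp_continuousOn hd
  have hz : ∀ j, c 0 j = 0 := fun j => by rw [h0]; rfl
  obtain ⟨g, δ, hδ, hδ1, hg, hg0, hgε, hmono, hgr⟩ := exists_graph_function (hcomp 0) (hcomp 1)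
    (hdcomp 0) (hdcomp 1) (hz 0) (hz 1) hv hε
  refine ⟨g, hg, hg0, hgε, ?_⟩
  have h0δ : (0 : ℝ) ∈ Icc 0 δ := ⟨le_rfl, hδ.le⟩
  have haδ : 0 < c δ 0 := by
    have := hmono h0δ ⟨hδ.le, le_rfl⟩ hδ
    simpa only [hz] using this
  have hcomp' : IsCompact (c '' Icc δ 1) :=
    isCompact_Icc.image_of_continuousOn (hcc.mono (Icc_subset_Icc_left hδ.le))
  have hnot : (0 : Plane) ∉ c '' Icc δ 1 := by
    rintro ⟨t, ht, h⟩
    have := hinj ⟨hδ.le.trans ht.1, ht.2⟩ ⟨le_rfl, zero_le_one⟩ (h.trans h0.symm)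
    linarith [ht.1]
  have hcont0 : Continuous fun x : Plane => x 0 := (EuclideanSpace.proj (𝕜 := ℝ) (0 : Fin 2)).continuous
  have hlt : ∀ᶠ x in 𝓝 (0 : Plane), x 0 < c δ 0 :=
    (hcont0.tendsto (0 : Plane)).eventually (gt_mem_nhds (by simpa using haδ))
  filter_upwards [hcomp'.isClosed.isOpen_compl.mem_nhds hnot, hlt] with x hx hx0
  constructor
  · rintro ⟨t, ht, rfl⟩
    have htδ : t < δ := by
      by_contra hcon
      exact hx ⟨t, ⟨not_lt.1 hcon, ht.2⟩, rfl⟩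
    have ht' : t ∈ Icc 0 δ := ⟨ht.1, htδ.le⟩
    refine ⟨?_, (hgr t ht').symm⟩
    rw [← hz 0]
    exact hmono.monotoneOn h0δ ht' ht.1
  · rintro ⟨hx1, hx2⟩
    have hsub : Icc 0 δ ⊆ Icc (0 : ℝ) 1 := Icc_subset_Icc_right hδ1
    have := intermediate_value_Icc hδ.le (f := fun t => c t 0)
      (hcont0.comp_continuousOn (hcc.mono hsub))
    obtain ⟨t, ht, hteq⟩ := this ⟨(hz 0).le.trans hx1, hx0.le⟩
    refine ⟨t, hsub ht, ?_⟩
    ext j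
    fin_cases j
    · exact hteq
    · have := hgr t ht
      simp only at hteq
      rw [hteq, ← hx2] at this
      exact this.symm


/-! ### Near-isometries and the straightening of two arcs. -/

/-- `Φ` preserves areas and energies, in both directions, up to the factor `K`. -/
def IsNearIsometry (Φ : Plane ≃ₜ Plane) (K : ℝ) : Prop :=
  ∀ β, Transports Φ β β 1 K ∧ Transports Φ.symm β β 1 K

theorem Transports.mono {Φ : Plane ≃ₜ Plane} {β β' J K K' : ℝ} (h : Transports Φ β β' J K)
    (hJ : 0 ≤ J) (hK : K ≤ K') : Transports Φ β β' J K' := by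
  intro V hV hb u v hu
  obtain ⟨u', v', h1, h2, h3, h4⟩ := h V hV hb u v hu
  refine ⟨u', v', h1, h2, h3, h4.trans ?_⟩
  exact mul_le_mul_of_nonneg_right (mul_le_mul_of_nonneg_left hK hJ)
    (integral_nonneg fun _ => by positivity)

theorem IsNearIsometry.mono {Φ : Plane ≃ₜ Plane} {K K' : ℝ} (h : IsNearIsometry Φ K) (hK : K ≤ K') :
    IsNearIsometry Φ K' := fun β =>
  ⟨(h β).1.mono zero_le_one hK, (h β).2.mono zero_le_one hK⟩

theorem IsNearIsometry.trans {Φ Ψ : Plane ≃ₜ Plane} {K K' : ℝ} (h : IsNearIsometry Φ K)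
    (h' : IsNearIsometry Ψ K') (hK : 0 ≤ K) (hK' : 0 ≤ K') :
    IsNearIsometry (Φ.trans Ψ) (K * K') := by
  refine fun β => ⟨?_, ?_⟩
  · simpa using (h β).1.trans (h' β).1 (by simpa using hK)
  · have := (h' β).2.trans (h β).2 (by simpa using hK')
    rwa [mul_one, mul_comm K' K] at this

theorem isNearIsometry_isometry (M : Plane ≃ᵢ Plane) : IsNearIsometry M.toHomeomorph 1 :=
  fun β => ⟨transports_isometry M β, transports_isometry M.symm β⟩

theorem isNearIsometry_shear {g : ℝ → ℝ} (hg : ContDiff ℝ 1 g) {ε : ℝ} (hε : ∀ t, |deriv g t| ≤ ε) :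
    IsNearIsometry (shear g hg.continuous) ((1 + ε) ^ 2) := by
  refine fun β => ⟨transports_shear hg hε β, ?_⟩
  rw [shear_symm]
  exact transports_shear hg.neg (fun t => by rw [deriv.fun_neg, abs_neg]; exact hε t) β

theorem fderiv_shear {g : ℝ → ℝ} (hg : ContDiff ℝ 1 g) (x v : Plane) :
    fderiv ℝ (shear g hg.continuous) x v
      = v + (deriv g (x 0) * v 0) • EuclideanSpace.single 1 1 := by
  have h0 : HasFDerivAt (fun x : Plane => x 0) (EuclideanSpace.proj (𝕜 := ℝ) (0 : Fin 2)) x :=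
    (EuclideanSpace.proj (𝕜 := ℝ) (0 : Fin 2)).hasFDerivAt
  have hd : HasFDerivAt (shear g hg.continuous) (ContinuousLinearMap.id ℝ Plane
      + (deriv g (x 0) • EuclideanSpace.proj (𝕜 := ℝ) (0 : Fin 2)).smulRight
        (EuclideanSpace.single 1 1)) x :=
    (hasFDerivAt_id x).add (((hg.differentiable (by simp) (x 0)).hasDerivAt.comp_hasFDerivAt x
      h0).smul_const _)
  rw [hd.fderiv]
  simp

/-- The reflection of the plane in the first coordinate axis. -/
noncomputable def axisFlip : Plane ≃ₗᵢ[ℝ] Plane :=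
  LinearIsometryEquiv.piLpCongrRight 2
    fun j : Fin 2 => if j = 0 then LinearIsometryEquiv.refl ℝ ℝ else LinearIsometryEquiv.neg ℝ

theorem axisFlip_zero (x : Plane) : axisFlip x 0 = x 0 := by simp [axisFlip]

theorem axisFlip_one (x : Plane) : axisFlip x 1 = -x 1 := by simp [axisFlip]

/-- The exchange of the two coordinates of the plane. -/
noncomputable def axisSwap : Plane ≃ₗᵢ[ℝ] Plane :=
  LinearIsometryEquiv.piLpCongrLeft 2 ℝ ℝ (Equiv.swap (0 : Fin 2) 1)

theorem axisSwap_zero (x : Plane) : axisSwap x 0 = x 1 := by simp [axisSwap]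

theorem axisSwap_one (x : Plane) : axisSwap x 1 = x 0 := by simp [axisSwap]

/-- The reflection in the bisecting line takes `v` to the first axis; a flip of that axis then puts
`w` in the closed upper half-plane. -/
theorem exists_linearIsometry_normalize (v w : Plane) (hv : v ≠ 0) :
    ∃ T : Plane ≃ₗᵢ[ℝ] Plane, 0 < T v 0 ∧ T v 1 = 0 ∧ 0 ≤ T w 1 := by
  obtain ⟨T, hT⟩ : ∃ T : Plane ≃ₗᵢ[ℝ] Plane, T v = ‖v‖ • EuclideanSpace.single 0 1 := by
    refine ⟨(Submodule.span ℝ {v - ‖v‖ • EuclideanSpace.single 0 1})ᗮ.reflection, ?_⟩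
    exact Submodule.reflection_sub (by simp [norm_smul])
  have h0 : 0 < T v 0 := by simpa [hT] using hv
  have h1 : T v 1 = 0 := by simp [hT]
  rcases le_total 0 (T w 1) with h | h
  · exact ⟨T, h0, h1, h⟩
  · refine ⟨T.trans axisFlip, ?_, ?_, ?_⟩
    · simpa [axisFlip_zero] using h0
    · simpa [axisFlip_one] using h1
    · simpa [axisFlip_one] using h

theorem IsArc.linearIsometry {A : Set Plane} {p v : Plane} (h : IsArc A p v) (T : Plane ≃ₗᵢ[ℝ] Plane) :
    IsArc (T '' A) (T p) (T v) := by
  have := h.image (Φ := T) T.toContinuousLinearEquiv.contDiff T.injective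
  rwa [show fderiv ℝ T p = (T.toContinuousLinearEquiv : Plane →L[ℝ] Plane) from
    T.toContinuousLinearEquiv.fderiv] at this

theorem IsArc.image_shear {A : Set Plane} {p v : Plane} (h : IsArc A p v) {g : ℝ → ℝ} (hg : ContDiff ℝ 1 g) :
    IsArc (shear g hg.continuous '' A) (shear g hg.continuous p)
      (v + (deriv g (p 0) * v 0) • EuclideanSpace.single 1 1) := by
  have := h.image (contDiff_shear hg) (shear g hg.continuous).injective
  rwa [fderiv_shear hg] at this

/-- `Φ` straightens the set `F` near `p` to the set `L`. -/
def Straightens (Φ : Plane ≃ₜ Plane) (F : Set Plane) (p : Plane) (L : Set Plane) : Prop :=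
  Φ p = 0 ∧ ∀ᶠ x in 𝓝 p, x ∈ F ↔ Φ x ∈ L

theorem Straightens.trans {Φ Ψ : Plane ≃ₜ Plane} {F L : Set Plane} {p : Plane}
    (hp : Φ p = 0) (h : Straightens Ψ (Φ '' F) 0 L) : Straightens (Φ.trans Ψ) F p L := by
  refine ⟨by simp [hp, h.1], ?_⟩
  have := (Φ.continuous.tendsto p).eventually (hp.symm ▸ h.2)
  filter_upwards [this] with x hx
  rwa [Φ.injective.mem_set_image] at hx

theorem shear_zero {g : ℝ → ℝ} (hg : Continuous g) (h0 : g 0 = 0) : shear g hg 0 = 0 := by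
  ext j
  fin_cases j
  · simp [shear]
  · simp [shear, h0]

theorem deriv_zero_of_eq_mul {g : ℝ → ℝ} (hg : ContDiff ℝ 1 g) {κ : ℝ} (h : ∀ x ≤ 0, g x = κ * x) :
    deriv g 0 = κ := by
  have h1 := ((hg.differentiable (by simp) 0).hasDerivAt).hasDerivWithinAt (s := Iic 0)
  have h2 : HasDerivWithinAt g κ (Iic 0) 0 := by
    have := ((hasDerivAt_id (0 : ℝ)).const_mul κ).hasDerivWithinAt (s := Iic 0)
    rw [mul_one] at this
    exact this.congr (fun x hx => h x hx) (h 0 le_rfl)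
  exact (uniqueDiffWithinAt_Iic 0).eq_deriv _ h1 h2

theorem isNearIsometry_linear (T : Plane ≃ₗᵢ[ℝ] Plane) : IsNearIsometry T.toHomeomorph 1 :=
  isNearIsometry_isometry T.toIsometryEquiv

/-- Two arcs from the origin in opposite directions form a straight line in a suitable chart. -/
theorem exists_straightens_line_of_normalized {A B F : Set Plane} {v w : Plane} (hA : IsArc A 0 v)
    (hB : IsArc B 0 w) (hv0 : 0 < v 0) (hv1 : v 1 = 0) (hw0 : w 0 < 0) (hw1 : w 1 = 0)
    (hF : ∀ᶠ x in 𝓝 0, x ∈ F ↔ x ∈ A ∪ B) {ε : ℝ} (hε : 0 < ε) :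
    ∃ Φ : Plane ≃ₜ Plane, IsNearIsometry Φ (((1 + ε) ^ 2) ^ 2) ∧
      Straightens Φ F 0 {x | x 1 = 0} := by
  obtain ⟨g, hg, hg0, hgε, hAg⟩ := hA.exists_graph hv0 hε
  have hB' := hB.linearIsometry (LinearIsometryEquiv.neg ℝ)
  rw [map_zero] at hB'
  obtain ⟨k, hk, hk0, hkε, hBk⟩ := hB'.exists_graph (by simpa using hw0) hε
  have hwn : (LinearIsometryEquiv.neg ℝ w : Plane) 1 = 0 := by simp [hw1]
  simp only [hv1, hwn, zero_div, zero_mul, sub_zero] at hg0 hgε hk0 hkε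
  have hneg : Tendsto (fun x : Plane => -x) (𝓝 0) (𝓝 0) := by
    simpa using (continuous_neg (G := Plane)).tendsto 0
  -- Both `g` and `k` vanish on `(-∞, 0]`. The first shear flattens `A` and fixes the left
  -- half-plane, where `B` lies near the origin; the half-turn exchanges the two sides, and the
  -- second shear flattens `B`.
  refine ⟨((shear (fun t => -g t) hg.continuous.neg).trans
    (LinearIsometryEquiv.neg ℝ : Plane ≃ₗᵢ[ℝ] Plane).toHomeomorph).trans
      (shear (fun t => -k t) hk.continuous.neg), ?_, ?_, ?_⟩
  · have h1 := isNearIsometry_shear hg.neg (ε := ε) fun t => by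
      rw [deriv.fun_neg, abs_neg]; exact hgε t
    have h2 := isNearIsometry_shear hk.neg (ε := ε) fun t => by
      rw [deriv.fun_neg, abs_neg]; exact hkε t
    refine ((h1.trans (isNearIsometry_linear (LinearIsometryEquiv.neg ℝ)) (by positivity)
      zero_le_one).trans h2 (by positivity) (by positivity)).mono (by rw [mul_one, sq ((1 + ε) ^ 2)])
  · simp [shear_zero, hg0 0 le_rfl, hk0 0 le_rfl]
  · filter_upwards [hF, hAg, hneg.eventually hBk] with x hx hxA hxB
    have hB2 : x ∈ B ↔ 0 ≤ -x 0 ∧ -x 1 = k (-x 0) := by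
      have : -x ∈ (LinearIsometryEquiv.neg ℝ : Plane ≃ₗᵢ[ℝ] Plane) '' B ↔ x ∈ B := by simp
      rw [← this]
      exact hxB
    have hΦ : ((((shear (fun t => -g t) hg.continuous.neg).trans
        (LinearIsometryEquiv.neg ℝ : Plane ≃ₗᵢ[ℝ] Plane).toHomeomorph).trans
          (shear (fun t => -k t) hk.continuous.neg)) x) 1 = -(x 1 - g (x 0)) - k (-x 0) := by
      simp [shear_apply_one, shear_apply_zero]
      ring
    rw [hx, mem_union, hxA, hB2, hΦ]
    rcases lt_trichotomy (x 0) 0 with h | h | h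
    · rw [hg0 _ h.le]
      constructor
      · rintro (h' | h')
        · linarith [h'.1]
        · linarith [h'.2]
      · exact fun h' => Or.inr ⟨by linarith, by linarith⟩
    · rw [h, neg_zero, hg0 0 le_rfl, hk0 0 le_rfl]
      simp
    · rw [hk0 _ (by linarith)]
      constructor
      · rintro (h' | h')
        · linarith [h'.2]
        · linarith [h'.1]
      · exact fun h' => Or.inl ⟨by linarith, by linarith⟩

/-- Two arcs from the origin in transversal directions form a cone in a suitable chart. -/
theorem exists_straightens_cone_of_normalized {A B F : Set Plane} {v w : Plane} (hA : IsArc A 0 v)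
    (hB : IsArc B 0 w) (hv0 : 0 < v 0) (hv1 : v 1 = 0) (hw1 : 0 < w 1)
    (hF : ∀ᶠ x in 𝓝 0, x ∈ F ↔ x ∈ A ∪ B) {ε : ℝ} (hε : 0 < ε) :
    ∃ (Φ : Plane ≃ₜ Plane) (L : Set Plane), IsNearIsometry Φ (((1 + ε) ^ 2) ^ 2) ∧
      Straightens Φ F 0 L ∧ ∀ s : ℝ, 0 < s → ∀ x ∈ L, s • x ∈ L := by
  obtain ⟨g, hg, hg0, hgε, hAg⟩ := hA.exists_graph hv0 hε
  rw [hv1, zero_div] at hg0 hgε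
  have hd0 := deriv_zero_of_eq_mul hg hg0
  simp only [zero_mul, sub_zero] at hg0 hgε
  have hB' := (hB.image_shear hg.neg).linearIsometry axisSwap
  have hS0 : shear (fun t => -g t) hg.continuous.neg 0 = 0 :=
    shear_zero _ (by simp [hg0 0 le_rfl])
  -- The tangent of `A` is already horizontal, so `g' 0 = 0` and the first shear keeps the direction
  -- of `B`.
  have hvel : w + (deriv (fun t => -g t) ((0 : Plane) 0) * w 0) • EuclideanSpace.single 1 1 = w := by
    rw [deriv.fun_neg]
    simp [hd0]
  rw [hvel] at hB'
  rw [hS0, map_zero] at hB'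
  obtain ⟨k, hk, hk0, hkε, hBk⟩ := hB'.exists_graph (by simpa [axisSwap_zero] using hw1) hε
  -- The slope `κ` of `B` may be large. The second shear only replaces `k` by its tangent, so its
  -- slope is `κ - k'`, at most `ε`, and it fixes the image of `A`, where the first coordinate is 0.
  set κ := axisSwap w 1 / axisSwap w 0 with hκ
  have hm : ContDiff ℝ 1 fun t => κ * t - k t := (contDiff_const.mul contDiff_id).sub hk
  have hmε : ∀ t, |deriv (fun t => κ * t - k t) t| ≤ ε := by
    intro t
    have : HasDerivAt (fun t => κ * t - k t) (κ * 1 - deriv k t) t :=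
      ((hasDerivAt_id t).const_mul κ).sub (hk.differentiable (by simp) t).hasDerivAt
    rw [this.deriv, mul_one, abs_sub_comm]
    exact hkε t
  set S := shear (fun t => -g t) hg.continuous.neg with hS
  set Ψ := S.trans axisSwap.toHomeomorph with hΨ
  have hΨ0 : Ψ 0 = 0 := by simp [hΨ, hS0]
  have hΨt : Tendsto Ψ (𝓝 0) (𝓝 0) := by simpa only [hΨ0] using Ψ.continuous.tendsto 0
  refine ⟨Ψ.trans (shear _ hm.continuous), {x | (0 ≤ x 1 ∧ x 0 = 0) ∨ (0 ≤ x 0 ∧ x 1 = κ * x 0)},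
    ?_, ⟨?_, ?_⟩, ?_⟩
  · have h1 := isNearIsometry_shear hg.neg (ε := ε) fun t => by
      rw [deriv.fun_neg, abs_neg]; exact hgε t
    refine ((h1.trans (isNearIsometry_linear axisSwap) (by positivity)
      zero_le_one).trans (isNearIsometry_shear hm hmε) (by positivity) (by positivity)).mono
        (by rw [mul_one, sq ((1 + ε) ^ 2)])
  · simp [hΨ0, shear_zero, hk0 0 le_rfl]
  · filter_upwards [hF, hAg, hΨt.eventually hBk] with x hx hxA hxB
    have hBm : Ψ x ∈ axisSwap '' (S '' B) ↔ x ∈ B := by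
      have : axisSwap '' (S '' B) = Ψ '' B := by
        rw [image_image]; rfl
      rw [this, Ψ.injective.mem_set_image]
    have h0 : Ψ x 0 = x 1 - g (x 0) := by
      simp [hΨ, hS, axisSwap_zero, shear_apply_one, sub_eq_add_neg]
    have h1 : Ψ x 1 = x 0 := by
      simp [hΨ, hS, axisSwap_one, shear_apply_zero]
    rw [hBm, h0, h1] at hxB
    rw [hx, mem_union, hxA, hxB]
    change _ ↔ _ ∨ _
    rw [Homeomorph.trans_apply, shear_apply_zero,
      shear_apply_one, h0, h1]
    refine or_congr ?_ ?_
    · constructor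
      · rintro ⟨h2, h3⟩
        rw [h3, sub_self, hk0 0 le_rfl]
        exact ⟨by simpa using h2, rfl⟩
      · rintro ⟨h2, h3⟩
        rw [h3, hk0 0 le_rfl] at h2
        exact ⟨by simpa using h2, by linarith⟩
    · refine and_congr_right fun _ => ⟨fun h => ?_, fun h => ?_⟩ <;> linarith
  · rintro s hs x (⟨h1, h2⟩ | ⟨h1, h2⟩)
    · refine Or.inl ⟨?_, ?_⟩
      · simpa using mul_nonneg hs.le h1
      · simp [h2]
    · refine Or.inr ⟨?_, ?_⟩
      · simpa using mul_nonneg hs.le h1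
      · simp [h2]
        ring

/-- Moving the vertex of a pair of arcs to the origin and normalizing the directions. -/
theorem IsArc.exists_normalize {A B F : Set Plane} {p v w : Plane} (hA : IsArc A p v)
    (hB : IsArc B p w) (hv : v ≠ 0) (hF : ∀ᶠ x in 𝓝 p, x ∈ F ↔ x ∈ A ∪ B) :
    ∃ (M : Plane ≃ₜ Plane) (T : Plane ≃ₗᵢ[ℝ] Plane), IsNearIsometry M 1 ∧ M p = 0 ∧ 0 < T v 0 ∧
      T v 1 = 0 ∧ 0 ≤ T w 1 ∧ IsArc (M '' A) 0 (T v) ∧ IsArc (M '' B) 0 (T w) ∧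
      ∀ᶠ x in 𝓝 0, x ∈ M '' F ↔ x ∈ M '' A ∪ M '' B := by
  obtain ⟨T, h0, h1, h2⟩ := exists_linearIsometry_normalize v w hv
  let N : Plane ≃ᵢ Plane := (IsometryEquiv.addRight (-p)).trans T.toIsometryEquiv
  have hN : ∀ x, N x = T (x + -p) := fun x => rfl
  have harc : ∀ {A v}, IsArc A p v → IsArc (N '' A) 0 (T v) := by
    intro A v h
    have := (h.image (Φ := fun x => x + -p) (contDiff_id.add contDiff_const)
      (add_left_injective _)).linearIsometry T
    rw [fderiv_add_const, image_image] at this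
    simp only [add_neg_cancel, map_zero, fderiv_fun_id, ContinuousLinearMap.id_apply] at this
    exact this
  refine ⟨N.toHomeomorph, T, isNearIsometry_isometry N, by simp [hN], h0, h1, h2, harc hA, harc hB,
    ?_⟩
  have hp : N.toHomeomorph.symm 0 = p := by
    rw [Homeomorph.symm_apply_eq]
    simp [hN]
  have := (N.toHomeomorph.symm.continuous.tendsto 0).eventually (hp.symm ▸ hF)
  filter_upwards [this] with x hx
  rw [← image_union]
  simp only [Homeomorph.image_eq_preimage_symm, mem_preimage]
  exact hx

theorem exists_straightens_line {A B F : Set Plane} {p v w : Plane} (hA : IsArc A p v)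
    (hB : IsArc B p w) (hv : v ≠ 0) {c : ℝ} (hc : 0 < c) (hw : w = -(c • v))
    (hF : ∀ᶠ x in 𝓝 p, x ∈ F ↔ x ∈ A ∪ B) {ε : ℝ} (hε : 0 < ε) :
    ∃ Φ : Plane ≃ₜ Plane, IsNearIsometry Φ (((1 + ε) ^ 2) ^ 2) ∧
      Straightens Φ F p {x | x 1 = 0} := by
  obtain ⟨M, T, hM, hMp, h0, h1, -, hA', hB', hF'⟩ := hA.exists_normalize hB hv hF
  obtain ⟨Φ, hΦ, hs⟩ := exists_straightens_line_of_normalized hA' hB' h0 h1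
    (by rw [hw]; simpa using mul_pos hc h0) (by rw [hw]; simp [h1]) hF' hε
  refine ⟨M.trans Φ, (hM.trans hΦ zero_le_one (by positivity)).mono (one_mul _).le,
    Straightens.trans hMp hs⟩

theorem exists_straightens_cone {A B F : Set Plane} {p v w : Plane} (hA : IsArc A p v)
    (hB : IsArc B p w) (hv : v ≠ 0) (hvw : ¬ SameRay ℝ v w)
    (hF : ∀ᶠ x in 𝓝 p, x ∈ F ↔ x ∈ A ∪ B) {ε : ℝ} (hε : 0 < ε) :
    ∃ (Φ : Plane ≃ₜ Plane) (L : Set Plane), IsNearIsometry Φ (((1 + ε) ^ 2) ^ 2) ∧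
      Straightens Φ F p L ∧ ∀ s : ℝ, 0 < s → ∀ x ∈ L, s • x ∈ L := by
  obtain ⟨M, T, hM, hMp, h0, h1, h2, hA', hB', hF'⟩ := hA.exists_normalize hB hv hF
  rcases h2.eq_or_lt with h2 | h2
  -- When both directions are horizontal, they must be opposite, because equal directions would form
  -- a cusp; the arcs then form a line.
  · have hTw : T w 0 < 0 := by
      by_contra! hcon
      refine hvw ?_
      have hTT : T w = (T w 0 / T v 0) • T v := by
        ext j
        fin_cases j
        · simp [h0.ne']
        · simp [h1, ← h2]
      rw [← map_smul] at hTT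
      rw [T.injective hTT]
      exact SameRay.sameRay_nonneg_smul_right v (div_nonneg hcon h0.le)
    obtain ⟨Φ, hΦ, hs⟩ := exists_straightens_line_of_normalized hA' hB' h0 h1 hTw h2.symm hF' hε
    refine ⟨M.trans Φ, _, (hM.trans hΦ zero_le_one (by positivity)).mono (one_mul _).le,
      Straightens.trans hMp hs, fun s _ x hx => ?_⟩
    simp only [mem_ofPred_eq] at hx ⊢
    simp [hx]
  · obtain ⟨Φ, L, hΦ, hs, hL⟩ := exists_straightens_cone_of_normalized hA' hB' h0 h1 h2 hF' hε
    exact ⟨M.trans Φ, L, (hM.trans hΦ zero_le_one (by positivity)).mono (one_mul _).le,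
      Straightens.trans hMp hs, hL⟩


/-! ### The boundary of a curvilinear polygon near a smooth point and near a vertex. -/

theorem isArc_of_contDiffOn {γ : ℝ → Plane} (hγ : ContDiffOn ℝ ∞ γ (Icc 0 1)) {a b : ℝ}
    (ha : a ∈ Icc (0 : ℝ) 1) (hb : b ∈ Icc (0 : ℝ) 1) (hab : a ≠ b) (hinj : InjOn γ (uIcc a b)) :
    IsArc (γ '' uIcc a b) (γ a) ((b - a) • derivWithin γ (Icc 0 1) a) := by
  have himg : (fun θ : ℝ => a + θ • (b - a)) '' Icc 0 1 = uIcc a b := by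
    rw [← segment_eq_image', segment_eq_uIcc]
  have hsub : uIcc a b ⊆ Icc (0 : ℝ) 1 := by
    rw [← segment_eq_uIcc]
    exact (convex_Icc (0 : ℝ) 1).segment_subset ha hb
  have hmaps : MapsTo (fun θ : ℝ => a + θ • (b - a)) (Icc 0 1) (uIcc a b) := by
    rw [← himg]; exact mapsTo_image _ _
  have hd : ∀ θ, HasDerivAt (fun θ : ℝ => a + θ • (b - a)) (b - a) θ := fun θ =>
    (((hasDerivAt_id θ).mul_const (b - a)).const_add a).congr_deriv (one_mul _)
  refine ⟨fun θ => γ (a + θ • (b - a)),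
    fun θ => (b - a) • derivWithin γ (Icc 0 1) (a + θ • (b - a)), by simp, by simp, ?_, ?_, ?_, ?_⟩
  · intro t ht
    have h1 := ((hγ.differentiableOn (by simp)) _ (hsub (hmaps ht))).hasDerivWithinAt
    exact h1.scomp t (hd t).hasDerivWithinAt fun x hx => hsub (hmaps hx)
  · refine ContinuousOn.const_smul ?_ (b - a)
    exact ((hγ.continuousOn_derivWithin (uniqueDiffOn_Icc one_pos) (by simp))).comp
      (fun t _ => (hd t).continuousAt.continuousWithinAt) fun x hx => hsub (hmaps hx)
  · intro x hx y hy hxy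
    have := hinj (hmaps hx) (hmaps hy) hxy
    have h2 : x * (b - a) = y * (b - a) := by simpa using this
    exact mul_right_cancel₀ (sub_ne_zero.2 hab.symm) h2
  · rw [← himg, image_image]

theorem eventually_mem_iff_of_notMem {F A R : Set Plane} {p : Plane} (hR : IsClosed R) (hp : p ∉ R)
    (hAF : A ⊆ F) (hF : F ⊆ A ∪ R) : ∀ᶠ x in 𝓝 p, x ∈ F ↔ x ∈ A := by
  filter_upwards [hR.isOpen_compl.mem_nhds hp] with x hx
  exact ⟨fun h => (hF h).resolve_right hx, fun h => hAF h⟩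

section Polygon

variable {n : ℕ} {γ : Fin (n + 1) → ℝ → Plane}

/-- The endpoint `t' = 1` is not covered by the injectivity hypothesis; it is read as the starting
point of the next arc. -/
theorem polygon_arc_injOn (hcyc : ∀ s, γ s 1 = γ (s + 1) 0)
    (hinj : ∀ s s', ∀ t ∈ Ico (0 : ℝ) 1, ∀ t' ∈ Ico (0 : ℝ) 1,
      γ s t = γ s' t' → s = s' ∧ t = t') {s s' : Fin (n + 1)} {t t' : ℝ} (ht : t ∈ Ioo (0 : ℝ) 1)
    (ht' : t' ∈ Icc (0 : ℝ) 1) (h : γ s t = γ s' t') : s = s' ∧ t = t' := by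
  rcases ht'.2.eq_or_lt with rfl | h1
  · rw [hcyc] at h
    have := hinj _ _ t ⟨ht.1.le, ht.2⟩ 0 ⟨le_rfl, one_pos⟩ h
    linarith [this.2, ht.1]
  · exact hinj _ _ t ⟨ht.1.le, ht.2⟩ t' ⟨ht'.1, h1⟩ h

theorem polygon_straightens_smooth (hγ : ∀ s, ContDiffOn ℝ ∞ (γ s) (Icc 0 1))
    (hreg : ∀ s, ∀ t ∈ Icc (0 : ℝ) 1, derivWithin (γ s) (Icc 0 1) t ≠ 0)
    (hcyc : ∀ s, γ s 1 = γ (s + 1) 0)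
    (hinj : ∀ s s', ∀ t ∈ Ico (0 : ℝ) 1, ∀ t' ∈ Ico (0 : ℝ) 1,
      γ s t = γ s' t' → s = s' ∧ t = t') (s : Fin (n + 1)) {t : ℝ} (ht : t ∈ Ioo (0 : ℝ) 1)
    {ε : ℝ} (hε : 0 < ε) :
    ∃ Φ : Plane ≃ₜ Plane, IsNearIsometry Φ (((1 + ε) ^ 2) ^ 2) ∧
      Straightens Φ (⋃ s, γ s '' Icc 0 1) (γ s t) {x | x 1 = 0} := by
  have hA := isArc_of_contDiffOn (hγ s) (a := t) (b := (t + 1) / 2) ⟨ht.1.le, ht.2.le⟩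
    ⟨by linarith [ht.1], by linarith [ht.2]⟩ (by linarith [ht.2]) (by
      rw [uIcc_of_le (by linarith [ht.2])]
      exact fun x hx y hy h => (hinj _ _ x ⟨by linarith [hx.1, ht.1], by linarith [hx.2, ht.2]⟩ y
        ⟨by linarith [hy.1, ht.1], by linarith [hy.2, ht.2]⟩ h).2)
  have hB := isArc_of_contDiffOn (hγ s) (a := t) (b := t / 2) ⟨ht.1.le, ht.2.le⟩
    ⟨by linarith [ht.1], by linarith [ht.2]⟩ (by linarith [ht.1]) (by
      rw [uIcc_of_ge (by linarith [ht.1])]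
      exact fun x hx y hy h => (hinj _ _ x ⟨by linarith [hx.1, ht.1], by linarith [hx.2, ht.2]⟩ y
        ⟨by linarith [hy.1, ht.1], by linarith [hy.2, ht.2]⟩ h).2)
  have hv := hreg s t ⟨ht.1.le, ht.2.le⟩
  refine exists_straightens_line hA hB (smul_ne_zero (by linarith [ht.2]) hv)
    (c := t / (1 - t)) (div_pos ht.1 (by linarith [ht.2])) ?_ ?_ hε
  · rw [smul_smul, ← neg_smul]
    congr 1
    have := ht.2
    field_simp [show 1 - t ≠ 0 by linarith]
    ring
  · have hcc : ∀ s', ContinuousOn (γ s') (Icc 0 1) := fun s' => (hγ s').continuousOn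
    -- `R` is the rest of the boundary: the two remote pieces of the arc and all the other arcs. It
    -- is compact and avoids the point.
    refine eventually_mem_iff_of_notMem (R := (γ s '' Icc 0 (t / 2)) ∪ (γ s '' Icc ((t + 1) / 2) 1) ∪
      ⋃ s' : {s' // s' ≠ s}, γ s' '' Icc 0 1) ?_ ?_ ?_ ?_
    · refine IsClosed.union (IsClosed.union ?_ ?_) (isClosed_iUnion_of_finite fun s' => ?_)
      · exact (isCompact_Icc.image_of_continuousOn ((hcc s).mono
          (Icc_subset_Icc_right (by linarith [ht.2])))).isClosed
      · exact (isCompact_Icc.image_of_continuousOn ((hcc s).mono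
          (Icc_subset_Icc_left (by linarith [ht.1])))).isClosed
      · exact (isCompact_Icc.image_of_continuousOn (hcc s')).isClosed
    · rintro ((⟨x, hx, h⟩ | ⟨x, hx, h⟩) | h)
      · have := polygon_arc_injOn hcyc hinj ht ⟨hx.1, by linarith [hx.2, ht.2]⟩ h.symm
        linarith [this.2, hx.2, ht.1]
      · have := polygon_arc_injOn hcyc hinj ht ⟨by linarith [hx.1, ht.1], hx.2⟩ h.symm
        linarith [this.2, hx.1, ht.2]
      · obtain ⟨⟨s', hs'⟩, x, hx, h⟩ := mem_iUnion.1 h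
        exact hs' (polygon_arc_injOn hcyc hinj ht hx h.symm).1.symm
    · rw [uIcc_of_le (by linarith [ht.2]), uIcc_of_ge (by linarith [ht.1])]
      refine union_subset ?_ ?_ <;> refine (image_mono ?_).trans (subset_iUnion (fun s => γ s '' Icc 0 1) s)
      · exact Icc_subset_Icc ht.1.le (by linarith [ht.2])
      · exact Icc_subset_Icc (by linarith [ht.1]) ht.2.le
    · refine iUnion_subset fun s' => ?_
      rintro _ ⟨x, hx, rfl⟩
      by_cases hs : s' = s
      · subst hs
        rw [uIcc_of_le (by linarith [ht.2]), uIcc_of_ge (by linarith [ht.1])]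
        rcases le_total x (t / 2) with h1 | h1
        · exact Or.inr (Or.inl (Or.inl ⟨x, ⟨hx.1, h1⟩, rfl⟩))
        rcases le_total x t with h2 | h2
        · exact Or.inl (Or.inr ⟨x, ⟨h1, h2⟩, rfl⟩)
        rcases le_total x ((t + 1) / 2) with h3 | h3
        · exact Or.inl (Or.inl ⟨x, ⟨h2, h3⟩, rfl⟩)
        · exact Or.inr (Or.inl (Or.inr ⟨x, ⟨h3, hx.2⟩, rfl⟩))
      · exact Or.inr (Or.inr (mem_iUnion.2 ⟨⟨s', hs⟩, x, hx, rfl⟩))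

theorem polygon_straightens_vertex (hγ : ∀ s, ContDiffOn ℝ ∞ (γ s) (Icc 0 1))
    (hreg : ∀ s, ∀ t ∈ Icc (0 : ℝ) 1, derivWithin (γ s) (Icc 0 1) t ≠ 0)
    (hcyc : ∀ s, γ s 1 = γ (s + 1) 0)
    (hinj : ∀ s s', ∀ t ∈ Ico (0 : ℝ) 1, ∀ t' ∈ Ico (0 : ℝ) 1,
      γ s t = γ s' t' → s = s' ∧ t = t')
    (hang : ∀ s, ¬ SameRay ℝ (-derivWithin (γ s) (Icc 0 1) 1) (derivWithin (γ (s + 1)) (Icc 0 1) 0))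
    (s : Fin (n + 1)) {ε : ℝ} (hε : 0 < ε) :
    ∃ (Φ : Plane ≃ₜ Plane) (L : Set Plane), IsNearIsometry Φ (((1 + ε) ^ 2) ^ 2) ∧
      Straightens Φ (⋃ s, γ s '' Icc 0 1) (γ s 1) L ∧ ∀ r : ℝ, 0 < r → ∀ x ∈ L, r • x ∈ L := by
  have hA := isArc_of_contDiffOn (hγ (s + 1)) (a := 0) (b := 1 / 2) ⟨le_rfl, zero_le_one⟩
    ⟨by norm_num, by norm_num⟩ (by norm_num) (by
      rw [uIcc_of_le (by norm_num)]
      exact fun x hx y hy h => (hinj _ _ x ⟨hx.1, by linarith [hx.2]⟩ y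
        ⟨hy.1, by linarith [hy.2]⟩ h).2)
  have hB := isArc_of_contDiffOn (hγ s) (a := 1) (b := 1 / 2) ⟨zero_le_one, le_rfl⟩
    ⟨by norm_num, by norm_num⟩ (by norm_num) (by
      rw [uIcc_of_ge (by norm_num)]
      intro x hx y hy h
      rcases hx.2.eq_or_lt with rfl | h1
      · rcases hy.2.eq_or_lt with rfl | h2
        · rfl
        · exact (polygon_arc_injOn hcyc hinj (t := y) ⟨by linarith [hy.1], h2⟩
            ⟨zero_le_one, le_rfl⟩ h.symm).2.symm
      · exact (polygon_arc_injOn hcyc hinj (t := x) ⟨by linarith [hx.1], h1⟩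
            ⟨by linarith [hy.1], hy.2⟩ h).2)
  rw [← hcyc s] at hA
  refine exists_straightens_cone hA hB (smul_ne_zero (by norm_num) (hreg (s + 1) 0 ⟨le_rfl, zero_le_one⟩))
    ?_ ?_ hε
  · intro h
    refine hang s ?_
    convert (h.symm.nonneg_smul_left (zero_le_two (α := ℝ))).nonneg_smul_right
      (zero_le_two (α := ℝ)) using 1
    · rw [smul_smul, ← neg_one_smul ℝ]
      norm_num
    · rw [smul_smul]
      norm_num
  · have hcc : ∀ s', ContinuousOn (γ s') (Icc 0 1) := fun s' => (hγ s').continuousOn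
    have hle : ∀ s' : Fin (n + 1), (0 : ℝ) ≤ (if s' = s + 1 then 1 / 2 else 0) := fun s' => by
      split_ifs <;> norm_num
    have hge : ∀ s' : Fin (n + 1), (if s' = s then (1 / 2 : ℝ) else 1) ≤ 1 := fun s' => by
      split_ifs <;> norm_num
    -- Each arc is deprived of the half that touches the vertex. The two conditions are independent,
    -- so that a polygon with a single arc, where `s + 1 = s`, loses both halves and keeps the
    -- midpoint only.
    refine eventually_mem_iff_of_notMem (R := ⋃ s', γ s' ''
      Icc (if s' = s + 1 then 1 / 2 else 0) (if s' = s then 1 / 2 else 1)) ?_ ?_ ?_ ?_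
    · exact isClosed_iUnion_of_finite fun s' => (isCompact_Icc.image_of_continuousOn
        ((hcc s').mono (Icc_subset_Icc (hle s') (hge s')))).isClosed
    · intro h
      obtain ⟨s', x, hx, h⟩ := mem_iUnion.1 h
      rcases (hx.2.trans (hge s')).eq_or_lt with rfl | h1
      · rw [hcyc, hcyc] at h
        have h2 := (hinj _ _ 0 ⟨le_rfl, one_pos⟩ 0 ⟨le_rfl, one_pos⟩ h).1
        have h3 : s' = s := add_right_cancel h2
        have h4 := hx.2
        rw [if_pos h3] at h4
        norm_num at h4
      · rw [hcyc] at h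
        have h2 := hinj _ _ x ⟨(hle s').trans hx.1, h1⟩ 0 ⟨le_rfl, one_pos⟩ h
        have h4 := hx.1
        rw [if_pos h2.1, h2.2] at h4
        norm_num at h4
    · rw [uIcc_of_le (by norm_num), uIcc_of_ge (by norm_num)]
      refine union_subset ?_ ?_
      · exact (image_mono (Icc_subset_Icc le_rfl (by norm_num))).trans (subset_iUnion (fun s => γ s '' Icc 0 1) (s + 1))
      · exact (image_mono (Icc_subset_Icc (by norm_num) le_rfl)).trans (subset_iUnion (fun s => γ s '' Icc 0 1) s)
    · rw [uIcc_of_le (by norm_num), uIcc_of_ge (by norm_num)]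
      refine iUnion_subset fun s' => ?_
      rintro _ ⟨x, hx, rfl⟩
      by_cases h1 : s' = s + 1 ∧ x ≤ 1 / 2
      · exact Or.inl (Or.inl ⟨x, ⟨hx.1, h1.2⟩, by rw [h1.1]⟩)
      by_cases h2 : s' = s ∧ 1 / 2 ≤ x
      · exact Or.inl (Or.inr ⟨x, ⟨h2.2, hx.2⟩, by rw [h2.1]⟩)
      refine Or.inr (mem_iUnion.2 ⟨s', x, ⟨?_, ?_⟩, rfl⟩)
      · split_ifs with h
        · exact (not_le.1 fun h' => h1 ⟨h, h'⟩).le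
        · exact hx.1
      · split_ifs with h
        · exact (not_le.1 fun h' => h2 ⟨h, h'⟩).le
        · exact hx.2

end Polygon

/-- A connected set that avoids the frontier of `Ω` lies in `Ω` or outside `Ω`. -/
theorem IsPreconnected.mem_iff_of_disjoint_frontier {Ω S : Set Plane} (hΩ : IsOpen Ω)
    (hS : IsPreconnected S) (hd : Disjoint (frontier Ω) S) {x y : Plane} (hx : x ∈ S) (hy : y ∈ S) :
    x ∈ Ω ↔ y ∈ Ω := by
  have : PreconnectedSpace S := isPreconnected_iff_preconnectedSpace.1 hS
  rcases isClopen_iff.1 (isClopen_preimage_val hΩ hd) with h | h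
  · have hx' : (⟨x, hx⟩ : S) ∉ (Subtype.val ⁻¹' Ω : Set S) := by rw [h]; simp
    have hy' : (⟨y, hy⟩ : S) ∉ (Subtype.val ⁻¹' Ω : Set S) := by rw [h]; simp
    exact iff_of_false hx' hy'
  · have hx' : (⟨x, hx⟩ : S) ∈ (Subtype.val ⁻¹' Ω : Set S) := by rw [h]; simp
    have hy' : (⟨y, hy⟩ : S) ∈ (Subtype.val ⁻¹' Ω : Set S) := by rw [h]; simp
    exact iff_of_true hx' hy'

theorem Straightens.exists_ball {Φ : Plane ≃ₜ Plane} {F L : Set Plane} {p : Plane}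
    (h : Straightens Φ F p L) : ∃ ρ > 0, ∀ y ∈ Metric.ball (0 : Plane) ρ, Φ.symm y ∈ F ↔ y ∈ L := by
  have hp : Φ.symm 0 = p := by rw [Homeomorph.symm_apply_eq, h.1]
  have := (Φ.symm.continuous.tendsto 0).eventually (hp.symm ▸ h.2)
  obtain ⟨ρ, hρ, hb⟩ := Metric.eventually_nhds_iff_ball.1 this
  exact ⟨ρ, hρ, fun y hy => by simpa using hb y hy⟩

/-- In the chart the boundary is a cone, so the points `τ Φ(x)`, `s ≤ τ ≤ 1`, are all on it or all
off it. In the first case neither end lies in the open set `Ω`. In the second case a connected path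
avoids the boundary. -/
theorem Straightens.mem_iff_smul {Φ : Plane ≃ₜ Plane} {Ω L : Set Plane} {p : Plane} (hΩ : IsOpen Ω)
    (h : Straightens Φ (frontier Ω) p L) (hL : ∀ r : ℝ, 0 < r → ∀ x ∈ L, r • x ∈ L) :
    ∃ r > 0, ∀ x ∈ Metric.ball p r, ∀ s ∈ Ioc (0 : ℝ) 1, x ∈ Ω ↔ Φ.symm (s • Φ x) ∈ Ω := by
  obtain ⟨ρ, hρ, hb⟩ := h.exists_ball
  have : ∀ᶠ x in 𝓝 p, Φ x ∈ Metric.ball (0 : Plane) ρ :=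
    (Φ.continuous.tendsto p).eventually (by rw [h.1]; exact Metric.ball_mem_nhds _ hρ)
  obtain ⟨r, hr, hrb⟩ := Metric.eventually_nhds_iff_ball.1 this
  refine ⟨r, hr, fun x hx s hs => ?_⟩
  have hx' := hrb x hx
  have hball : ∀ τ ∈ Ioc (0 : ℝ) 1, τ • Φ x ∈ Metric.ball (0 : Plane) ρ := by
    intro τ hτ
    rw [mem_ball_zero_iff, norm_smul, Real.norm_of_nonneg hτ.1.le]
    rw [mem_ball_zero_iff] at hx'
    exact (mul_le_of_le_one_left (norm_nonneg _) hτ.2).trans_lt hx'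
  by_cases hxL : Φ x ∈ L
  · have h1 : x ∈ frontier Ω := by
      have := (hb _ hx').2 hxL
      rwa [Homeomorph.symm_apply_apply] at this
    have h2 : Φ.symm (s • Φ x) ∈ frontier Ω := (hb _ (hball s hs)).2 (hL s hs.1 _ hxL)
    rw [hΩ.frontier_eq] at h1 h2
    exact iff_of_false h1.2 h2.2
  · have hconn : IsPreconnected ((fun τ : ℝ => Φ.symm (τ • Φ x)) '' Icc s 1) :=
      isPreconnected_Icc.image _ (Φ.symm.continuous.comp (by fun_prop)).continuousOn
    refine hconn.mem_iff_of_disjoint_frontier hΩ ?_ ⟨1, ⟨hs.2, le_rfl⟩, by simp⟩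
      ⟨s, ⟨le_rfl, hs.2⟩, rfl⟩
    rw [Set.disjoint_right]
    rintro _ ⟨τ, hτ, rfl⟩ hmem
    have hτ0 : 0 < τ := hs.1.trans_le hτ.1
    have := hL τ⁻¹ (inv_pos.2 hτ0) _ ((hb _ (hball τ ⟨hτ0, hτ.2⟩)).1 hmem)
    rw [inv_smul_smul₀ hτ0.ne'] at this
    exact hxL this

/-- Near each point of its closure, a curvilinear polygon is invariant under the dilations of a
chart that is nearly an isometry. -/
theorem IsCurvilinearPolygon.exists_dilation_chart {Ω : Set Plane} (hΩ : IsOpen Ω)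
    (h : IsCurvilinearPolygon Ω) {p : Plane} (hp : p ∈ closure Ω) {ε : ℝ} (hε : 0 < ε) :
    ∃ (Φ : Plane ≃ₜ Plane), IsNearIsometry Φ (((1 + ε) ^ 2) ^ 2) ∧ Φ p = 0 ∧
      ∃ r > 0, ∀ x ∈ Metric.ball p r, ∀ s ∈ Ioc (0 : ℝ) 1, x ∈ Ω ↔ Φ.symm (s • Φ x) ∈ Ω := by
  obtain ⟨n, γ, hγ, hreg, hcyc, hinj, hang, hF⟩ := h
  rw [closure_eq_self_union_frontier] at hp
  rcases hp with hp | hp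
  · obtain ⟨r, hr, hb⟩ := Metric.isOpen_iff.1 hΩ p hp
    refine ⟨(IsometryEquiv.addRight (-p)).toHomeomorph, (isNearIsometry_isometry _).mono ?_,
      by simp, r, hr, fun x hx s hs => iff_of_true (hb hx) (hb ?_)⟩
    · exact one_le_pow₀ (one_le_pow₀ (by linarith))
    · have : (IsometryEquiv.addRight (-p)).toHomeomorph.symm
          (s • (IsometryEquiv.addRight (-p)).toHomeomorph x) = s • (x + -p) + p := by simp
      rw [this, mem_ball_iff_norm, add_sub_cancel_right, norm_smul, Real.norm_of_nonneg hs.1.le,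
        ← sub_eq_add_neg]
      rw [mem_ball_iff_norm] at hx
      exact (mul_le_of_le_one_left (norm_nonneg _) hs.2).trans_lt hx
  · have hvertex : ∀ s, p = γ s 1 → ∃ (Φ : Plane ≃ₜ Plane), IsNearIsometry Φ (((1 + ε) ^ 2) ^ 2) ∧
        Φ p = 0 ∧ ∃ r > 0, ∀ x ∈ Metric.ball p r, ∀ s ∈ Ioc (0 : ℝ) 1,
          x ∈ Ω ↔ Φ.symm (s • Φ x) ∈ Ω := by
      rintro s rfl
      obtain ⟨Φ, L, hΦ, hs, hL⟩ := polygon_straightens_vertex hγ hreg hcyc hinj hang s hε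
      rw [← hF] at hs
      exact ⟨Φ, hΦ, hs.1, hs.mem_iff_smul hΩ hL⟩
    have hp' := hp
    rw [hF] at hp'
    obtain ⟨s, t, ht, rfl⟩ := mem_iUnion.1 hp'
    rcases ht.1.eq_or_lt with rfl | h0
    · exact hvertex (s - 1) (by rw [hcyc, sub_add_cancel])
    rcases ht.2.eq_or_lt with rfl | h1
    · exact hvertex s rfl
    obtain ⟨Φ, hΦ, hs⟩ := polygon_straightens_smooth hγ hreg hcyc hinj s ⟨h0, h1⟩ hε
    rw [← hF] at hs
    refine ⟨Φ, hΦ, hs.1, hs.mem_iff_smul hΩ fun r _ x hx => ?_⟩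
    simp only [mem_ofPred_eq] at hx ⊢
    simp [hx]


/-! ### Transplantation of localized functions -/

theorem exists_contDiff_cutoff {S W : Set Plane} (hS : IsClosed S) (hW : IsOpen W) (hSW : S ⊆ W) :
    ∃ η : Plane → ℝ, ContDiff ℝ ∞ η ∧ (∀ x, |η x| ≤ 1) ∧ tsupport η ⊆ W ∧
      ∀ x ∈ S, η =ᶠ[𝓝 x] 1 := by
  obtain ⟨f, h0, h1, hf⟩ := exists_contMDiffMap_zero_one_nhds_of_isClosed (n := ⊤)
    (modelWithCornersSelf ℝ Plane) hW.isClosed_compl hS (disjoint_compl_left_iff_subset.2 hSW)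
  refine ⟨f, f.contMDiff.contDiff, fun x => abs_le.2 ⟨by linarith [(hf x).1], (hf x).2⟩, ?_, ?_⟩
  · intro x hx
    by_contra hxW
    rw [eventually_nhdsSet_iff_forall] at h0
    exact (notMem_tsupport_iff_eventuallyEq.2 (h0 x hxW)) hx
  · rw [eventually_nhdsSet_iff_forall] at h1
    exact fun x hx => h1 x hx

/-- The energy bound for the transplantation by `Ψ` of a function supported in `S`. -/
theorem Transports.lambda1_mul_le {Ψ : Plane ≃ₜ Plane} {β β' J K : ℝ} (hT : Transports Ψ β' β J K)
    (hJ : 0 < J) {Ω V S W : Set Plane} (hΩ : IsOpen Ω) (hV : IsOpen V) (hVb : Bornology.IsBounded V)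
    (hS : IsClosed S) (hW : IsOpen W) (hSW : S ⊆ W)
    (hU : Ψ ⁻¹' V ⊆ Ω) (hfr : ∀ x ∈ Ω, Ψ x ∈ W → x ∈ closure (Ψ ⁻¹' V) → Ψ x ∈ V)
    {w : Plane → ℂ} {z : Plane → CVec} (h : IsH1 V w z) (hw : ∀ x, x ∉ S → w x = 0) :
    lambda1 Ω β' * ∫ x in V, ‖w x‖ ^ 2 ≤ K * ∫ x in V, ‖magGrad β w z x‖ ^ 2 := by
  obtain ⟨u, v, h1, hn, hi, he⟩ := hT V hV hVb w z h
  obtain ⟨η, hη, hη1, hηW, hηS⟩ := exists_contDiff_cutoff (hS.preimage Ψ.continuous)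
    (hW.preimage Ψ.continuous) (preimage_mono hSW)
  set U := Ψ ⁻¹' V with hUdef
  have hUo : IsOpen U := hV.preimage Ψ.continuous
  have hsupp : ∀ x ∈ U, u x ≠ 0 → η =ᶠ[𝓝 x] 1 := by
    intro x _ hx
    refine hηS x ?_
    by_contra hxS
    refine hx ?_
    rw [← norm_eq_zero, hn, hw _ hxS, norm_zero]
  -- By `hfr`, boundary points of `Ψ⁻¹ V` inside `Ω` lie outside `Ψ⁻¹ W`, where the cut-off
  -- vanishes, so extension by zero is allowed.
  have hext := h1.extend hUo hU hη hη1 (fun x hx hxη hxU => hfr x hx (hηW hxη) hxU) hsupp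
  have hle := hext.lambda1_mul_le (β := β')
  have e1 : ∫ x in Ω, ‖U.indicator u x‖ ^ 2 = J * ∫ x in V, ‖w x‖ ^ 2 := by
    rw [← hi, setIntegral_eq_of_subset_of_forall_sdiff_eq_zero hΩ.measurableSet hU
      (fun x hx => by simp [indicator_of_notMem hx.2])]
    exact setIntegral_congr_fun hUo.measurableSet fun x hx => by simp [indicator_of_mem hx]
  -- Cutting off the gradient changes it at most where `u = 0`, and only lowers its norm there.
  have e2 : ∫ x in Ω, ‖magGrad β' (U.indicator u) (U.indicator fun x => (η x : ℂ) • v x) x‖ ^ 2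
      ≤ ∫ x in U, ‖magGrad β' u v x‖ ^ 2 := by
    rw [setIntegral_eq_of_subset_of_forall_sdiff_eq_zero hΩ.measurableSet hU
      (fun x hx => by simp [magGrad, indicator_of_notMem hx.2])]
    have hb := Homeomorph.isBounded_preimage Ψ hVb
    refine setIntegral_mono_on ((memLp_two_iff_integrable_sq_norm ?_).1 ?_)
      ((memLp_two_iff_integrable_sq_norm ?_).1 ?_) hUo.measurableSet ?_
    · exact (memLp_magGrad_of_isOpen hUo hb β' (hext.mono hU)).1
    · exact memLp_magGrad_of_isOpen hUo hb β' (hext.mono hU)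
    · exact (memLp_magGrad_of_isOpen hUo hb β' h1).1
    · exact memLp_magGrad_of_isOpen hUo hb β' h1
    · intro x hx
      refine pow_le_pow_left₀ (norm_nonneg _) ?_ 2
      simp only [magGrad, indicator_of_mem hx]
      by_cases h0 : u x = 0
      · simp only [h0, mul_zero, zero_smul, sub_zero, norm_smul, Complex.norm_real]
        exact mul_le_of_le_one_left (norm_nonneg _) (hη1 x)
      · rw [(hsupp x hx h0).eq_of_nhds]
        simp
  rw [e1] at hle
  refine le_of_mul_le_mul_left ?_ hJ
  calc J * (lambda1 Ω β' * ∫ x in V, ‖w x‖ ^ 2) = lambda1 Ω β' * (J * ∫ x in V, ‖w x‖ ^ 2) := by ring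
    _ ≤ _ := hle.trans (e2.trans he)
    _ = _ := by ring

theorem exists_sq_partition {A : Set Plane} (hA : IsCompact A) (r : Plane → ℝ) (hr : ∀ p ∈ A, 0 < r p) :
    ∃ (t : Finset Plane) (χ : Plane → Plane → ℝ), (∀ p ∈ t, p ∈ A) ∧ (∀ p, ContDiff ℝ ∞ (χ p)) ∧
      (∀ p ∈ t, ∀ x, x ∉ Metric.closedBall p (r p / 2) → χ p x = 0) ∧
      ∀ x ∈ A, ∑ p ∈ t, χ p x ^ 2 = 1 := by
  classical
  obtain ⟨t, ht, hcov⟩ := hA.elim_nhds_subcover (fun p => Metric.ball p (r p / 2))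
    fun p hp => Metric.ball_mem_nhds _ (half_pos (hr p hp))
  let b : ∀ p : Plane, ContDiffBump p := fun p =>
    if h : 0 < r p then ⟨r p / 4, r p / 2, by positivity, by linarith⟩ else ⟨1, 2, one_pos, one_lt_two⟩
  have hb : ∀ p ∈ t, (b p).rOut = r p / 2 := fun p hp => by
    simp only [b, dif_pos (hr p (ht p hp))]
  -- `ζ` is positive exactly off `A`. It keeps the denominator positive on the whole plane without
  -- affecting the sum of squares on `A`.
  obtain ⟨ζ, hζs, hζ, hζr⟩ := hA.isClosed.isOpen_compl.exists_contDiff_support_eq (n := ⊤)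
  have hζ0 : ∀ x, 0 ≤ ζ x := fun x => (hζr ⟨x, rfl⟩).1
  set D : Plane → ℝ := fun x => ∑ p ∈ t, b p x ^ 2 + ζ x with hD
  have hDpos : ∀ x, 0 < D x := by
    intro x
    by_cases hx : x ∈ A
    · obtain ⟨p, hp, hxp⟩ := mem_iUnion₂.1 (hcov hx)
      have h1 : 0 < b p x := (b p).pos_of_mem_ball (by rw [hb p hp]; exact hxp)
      have h2 : b p x ^ 2 ≤ ∑ p ∈ t, b p x ^ 2 :=
        Finset.single_le_sum (f := fun p => b p x ^ 2) (fun _ _ => sq_nonneg _) hp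
      have := hζ0 x
      simp only [hD]
      have h3 : 0 < b p x ^ 2 := pow_pos h1 2
      linarith
    · have h1 : ζ x ≠ 0 := by
        have : x ∈ Function.support ζ := by rw [hζs]; exact hx
        exact this
      have h2 : 0 < ζ x := (hζ0 x).lt_of_ne' h1
      simp only [hD]; positivity
  have hDc : ContDiff ℝ ∞ D := (ContDiff.sum fun p _ => (b p).contDiff.pow 2).add hζ
  refine ⟨t, fun p x => b p x / √(D x), ht, fun p => ?_, ?_, ?_⟩
  · exact (b p).contDiff.div (hDc.sqrt fun x => (hDpos x).ne') fun x => (Real.sqrt_pos.2 (hDpos x)).ne'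
  · intro p hp x hx
    rw [Metric.mem_closedBall, not_le, ← hb p hp] at hx
    simp [(b p).zero_of_le_dist hx.le]
  · intro x hx
    have h0 : ζ x = 0 := by
      by_contra h
      have : x ∈ Function.support ζ := h
      rw [hζs] at this
      exact this hx
    have h1 : ∑ p ∈ t, b p x ^ 2 = D x := by simp [hD, h0]
    simp only [div_pow, Real.sq_sqrt (hDpos x).le]
    rw [← Finset.sum_div, h1, div_self (hDpos x).ne']

theorem magGrad_mul (β : ℝ) (a u : Plane → ℂ) (v : Plane → CVec) (x : Plane) :
    magGrad β (fun x => a x * u x) (fun x => a x • v x + u x • cgrad a x) x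
      = a x • magGrad β u v x + u x • cgrad a x := by
  simp only [magGrad, smul_sub, smul_smul]
  rw [show Complex.I * (a x * u x) = a x * (Complex.I * u x) by ring]
  abel

theorem norm_add_sq_le_of_pos {E : Type*} [SeminormedAddCommGroup E] (a b : E) {δ : ℝ} (hδ : 0 < δ) :
    ‖a + b‖ ^ 2 ≤ (1 + δ) * ‖a‖ ^ 2 + (1 + δ⁻¹) * ‖b‖ ^ 2 := by
  have h1 : ‖a + b‖ ^ 2 ≤ (‖a‖ + ‖b‖) ^ 2 := pow_le_pow_left₀ (norm_nonneg _) (norm_add_le a b) 2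
  have h2 : 0 ≤ δ * (‖a‖ - δ⁻¹ * ‖b‖) ^ 2 := by positivity
  have h3 : δ * (‖a‖ - δ⁻¹ * ‖b‖) ^ 2 = δ * ‖a‖ ^ 2 - 2 * (‖a‖ * ‖b‖) + δ⁻¹ * ‖b‖ ^ 2 := by
    field_simp
    ring
  linarith [add_sq ‖a‖ ‖b‖]

/-- Localization of the energy by a quadratic partition of unity. -/
theorem exists_sum_energy_le {Ω : Set Plane} (hΩ : IsOpen Ω) (hb : Bornology.IsBounded Ω)
    {t : Finset Plane} {χ : Plane → Plane → ℝ} (hχ : ∀ p, ContDiff ℝ ∞ (χ p))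
    (hsum : ∀ x ∈ Ω, ∑ p ∈ t, χ p x ^ 2 = 1) {δ : ℝ} (hδ : 0 < δ) :
    ∃ C : ℝ, 0 ≤ C ∧ ∀ β u v, IsH1 Ω u v → ∃ w : Plane → Plane → ℂ, ∃ z : Plane → Plane → CVec,
      (∀ p, IsH1 Ω (w p) (z p)) ∧ (∀ p x, χ p x = 0 → w p x = 0) ∧
      ∑ p ∈ t, ∫ x in Ω, ‖w p x‖ ^ 2 = ∫ x in Ω, ‖u x‖ ^ 2 ∧
      ∑ p ∈ t, ∫ x in Ω, ‖magGrad β (w p) (z p) x‖ ^ 2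
        ≤ (1 + δ) * (∫ x in Ω, ‖magGrad β u v x‖ ^ 2) + C * ∫ x in Ω, ‖u x‖ ^ 2 := by
  have hχC : ∀ p, ContDiff ℝ 1 fun x => (χ p x : ℂ) := fun p =>
    (Complex.ofRealCLM.contDiff.comp (hχ p)).of_le (by exact_mod_cast le_top)
  have hbd : ∀ p, ∃ c, ∀ x ∈ Ω, ‖cgrad (fun x => (χ p x : ℂ)) x‖ ≤ c := by
    intro p
    obtain ⟨C, hC⟩ := (hb.isCompact_closure.image
      (continuous_cgrad (hχC p))).isBounded.exists_norm_le
    exact ⟨C, fun x hx => hC _ ⟨x, subset_closure hx, rfl⟩⟩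
  choose c hc using hbd
  -- The constant of Young's inequality times the bounds for the gradients of the cut-offs; it does
  -- not depend on `β`.
  refine ⟨(1 + δ⁻¹) * ∑ p ∈ t, c p ^ 2, by positivity, fun β u v h => ?_⟩
  have hw : ∀ p, IsH1 Ω (fun x => (χ p x : ℂ) * u x)
      (fun x => (χ p x : ℂ) • v x + u x • cgrad (fun x => (χ p x : ℂ)) x) := fun p =>
    h.mul hΩ hb (hχC p)
  have iu : IntegrableOn (fun x => ‖u x‖ ^ 2) Ω := (memLp_two_iff_integrable_sq_norm h.memLp.1).1 h.memLp
  have iw : ∀ p, IntegrableOn (fun x => ‖(χ p x : ℂ) * u x‖ ^ 2) Ω := fun p =>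
    (memLp_two_iff_integrable_sq_norm (hw p).memLp.1).1 (hw p).memLp
  have hmu := memLp_magGrad_of_isOpen hΩ hb β h
  have iG : IntegrableOn (fun x => ‖magGrad β u v x‖ ^ 2) Ω :=
    (memLp_two_iff_integrable_sq_norm hmu.1).1 hmu
  have iGw : ∀ p, IntegrableOn (fun x => ‖magGrad β (fun x => (χ p x : ℂ) * u x)
      (fun x => (χ p x : ℂ) • v x + u x • cgrad (fun x => (χ p x : ℂ)) x) x‖ ^ 2) Ω := fun p => by
    have := memLp_magGrad_of_isOpen hΩ hb β (hw p)
    exact (memLp_two_iff_integrable_sq_norm this.1).1 this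
  refine ⟨_, _, hw, fun p x hx => by simp [hx], ?_, ?_⟩
  · rw [← integral_finsetSum _ fun p _ => iw p]
    refine setIntegral_congr_fun hΩ.measurableSet fun x hx => ?_
    simp only [norm_mul, Complex.norm_real, mul_pow, Real.norm_eq_abs, sq_abs]
    rw [← Finset.sum_mul, hsum x hx, one_mul]
  · rw [← integral_finsetSum _ fun p _ => iGw p, ← integral_const_mul, ← integral_const_mul,
      ← integral_add (iG.const_mul _) (iu.const_mul _)]
    refine setIntegral_mono_on (integrable_finsetSum _ fun p _ => iGw p)
      ((iG.const_mul _).add (iu.const_mul _)) hΩ.measurableSet fun x hx => ?_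
    simp only [magGrad_mul]
    calc ∑ p ∈ t, ‖(χ p x : ℂ) • magGrad β u v x + u x • cgrad (fun x => (χ p x : ℂ)) x‖ ^ 2
        ≤ ∑ p ∈ t, ((1 + δ) * (χ p x ^ 2 * ‖magGrad β u v x‖ ^ 2)
            + (1 + δ⁻¹) * (c p ^ 2 * ‖u x‖ ^ 2)) := by
          refine Finset.sum_le_sum fun p _ => (norm_add_sq_le_of_pos _ _ hδ).trans ?_
          rw [norm_smul, norm_smul, mul_pow, mul_pow, Complex.norm_real, Real.norm_eq_abs, sq_abs,
            mul_comm (‖u x‖ ^ 2)]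
          have := pow_le_pow_left₀ (norm_nonneg _) (hc p x hx) 2
          gcongr
      _ = _ := by
          rw [Finset.sum_add_distrib, ← Finset.mul_sum, ← Finset.mul_sum, ← Finset.sum_mul,
            ← Finset.sum_mul, hsum x hx]
          ring

/-! ### Almost monotonicity of `λ₁(Ω, β) / β`. -/

/-- Comparison of the first eigenvalues of a locally dilation invariant domain. -/
theorem exists_lambda1_div_le {Ω : Set Plane} (hΩ : IsBoundedDomain Ω) {K : ℝ} (hK : 0 < K)
    (hchart : ∀ p ∈ closure Ω, ∃ Φ : Plane ≃ₜ Plane, IsNearIsometry Φ K ∧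
      ∃ r > 0, ∀ x ∈ Metric.ball p r, ∀ s ∈ Ioc (0 : ℝ) 1, x ∈ Ω ↔ Φ.symm (s • Φ x) ∈ Ω)
    {δ : ℝ} (hδ : 0 < δ) : ∃ C : ℝ, 0 ≤ C ∧ ∀ β β' : ℝ, 0 < β → β ≤ β' →
      lambda1 Ω β' / β' ≤ K ^ 2 * ((1 + δ) * (lambda1 Ω β / β) + C / β) := by
  have hc : ∀ p, ∃ (Φ : Plane ≃ₜ Plane) (r : ℝ), p ∈ closure Ω → IsNearIsometry Φ K ∧ 0 < r ∧
      ∀ x ∈ Metric.ball p r, ∀ s ∈ Ioc (0 : ℝ) 1, x ∈ Ω ↔ Φ.symm (s • Φ x) ∈ Ω := by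
    intro p
    by_cases hp : p ∈ closure Ω
    · obtain ⟨Φ, h1, r, h2, h3⟩ := hchart p hp
      exact ⟨Φ, r, fun _ => ⟨h1, h2, h3⟩⟩
    · exact ⟨Homeomorph.refl _, 1, fun h => absurd h hp⟩
  choose Φ r hΦr using hc
  obtain ⟨t, χ, ht, hχ, hsupp, hsum⟩ := exists_sq_partition hΩ.isBounded.isCompact_closure r
    fun p hp => (hΦr p hp).2.1
  obtain ⟨C, hC0, hC⟩ := exists_sum_energy_le hΩ.isOpen hΩ.isBounded hχ
    (fun x hx => hsum x (subset_closure hx)) hδ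
  refine ⟨C, hC0, fun β β' hβ hββ => ?_⟩
  have hβ' : 0 < β' := hβ.trans_le hββ
  -- Pulling back by the dilation `σ ≥ 1` contracts supports and turns the field `β` into `σ² β =
  -- β'`.
  set σ := √(β' / β) with hσ
  have hσ2 : σ ^ 2 = β' / β := Real.sq_sqrt (by positivity)
  have hσ0 : 0 < σ := Real.sqrt_pos.2 (by positivity)
  have hσ1 : 1 ≤ σ := Real.one_le_sqrt.2 ((one_le_div hβ).2 hββ)
  have hloc : ∀ p ∈ t, ∀ w z, IsH1 Ω w z → (∀ x, χ p x = 0 → w x = 0) →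
      lambda1 Ω β' * ∫ x in Ω, ‖w x‖ ^ 2
        ≤ K ^ 2 * (β' / β) * ∫ x in Ω, ‖magGrad β w z x‖ ^ 2 := by
    intro p hp w z h hw
    obtain ⟨hΦ, hr, hinv⟩ := hΦr p (ht p hp)
    have hT : Transports (((Φ p).trans (dilation σ hσ0.ne')).trans (Φ p).symm) β' β
        (1 * (σ ^ 2)⁻¹ * 1) (K * σ ^ 2 * K) := by
      refine Transports.trans (Transports.trans (hΦ β').1 ?_ (by simpa using hK.le)) (hΦ β).2
        (by positivity)
      have := transports_dilation hσ0 β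
      rwa [hσ2, div_mul_cancel₀ _ hβ.ne', ← hσ2] at this
    set Ψ := ((Φ p).trans (dilation σ hσ0.ne')).trans (Φ p).symm with hΨ
    -- Local dilation invariance: the contracted piece stays in `Ω`, and inside `Ω` it acquires no
    -- new boundary near the support of `w`.
    have hkey : ∀ y, Ψ y ∈ Metric.ball p (r p) → (Ψ y ∈ Ω ↔ y ∈ Ω) := by
      intro y hy
      have h1 : (Φ p).symm (σ⁻¹ • Φ p (Ψ y)) = y := by
        simp [hΨ, dilation_apply, hσ0.ne']
      have := hinv (Ψ y) hy σ⁻¹ ⟨inv_pos.2 hσ0, inv_le_one_of_one_le₀ hσ1⟩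
      rwa [h1] at this
    set V := Ω ∩ Metric.ball p (r p) with hV
    have hzero : ∀ x, x ∉ Metric.closedBall p (r p / 2) → w x = 0 := fun x hx =>
      hw x (hsupp p hp x hx)
    have hsub : Metric.closedBall p (r p / 2) ⊆ Metric.ball p (r p) :=
      Metric.closedBall_subset_ball (half_lt_self hr)
    have := hT.lambda1_mul_le (Ω := Ω) (V := V) (by positivity) hΩ.isOpen
      (hΩ.isOpen.inter Metric.isOpen_ball) (hΩ.isBounded.subset inter_subset_left)
      Metric.isClosed_closedBall Metric.isOpen_ball hsub
      (fun y hy => (hkey y hy.2).1 hy.1) (fun y hy hyb _ => ⟨(hkey y hyb).2 hy, hyb⟩)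
      (h.mono inter_subset_left) hzero
    have e1 : ∫ x in V, ‖w x‖ ^ 2 = ∫ x in Ω, ‖w x‖ ^ 2 := by
      refine (setIntegral_eq_of_subset_of_forall_sdiff_eq_zero hΩ.isOpen.measurableSet
        inter_subset_left fun x hx => ?_).symm
      rw [hzero x fun hxb => hx.2 ⟨hx.1, hsub hxb⟩]
      simp
    have e2 : ∫ x in V, ‖magGrad β w z x‖ ^ 2 ≤ ∫ x in Ω, ‖magGrad β w z x‖ ^ 2 := by
      have hm := memLp_magGrad_of_isOpen hΩ.isOpen hΩ.isBounded β h
      exact setIntegral_mono_set ((memLp_two_iff_integrable_sq_norm hm.1).1 hm)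
        (Eventually.of_forall fun x => by positivity) inter_subset_left.eventuallyLE
    rw [e1] at this
    calc _ ≤ _ := this
      _ = K ^ 2 * (β' / β) * ∫ x in V, ‖magGrad β w z x‖ ^ 2 := by rw [hσ2]; ring
      _ ≤ _ := mul_le_mul_of_nonneg_left e2 (by positivity)
  have hmain : ∀ u v, IsH1 Ω u v → lambda1 Ω β' * ∫ x in Ω, ‖u x‖ ^ 2
      ≤ K ^ 2 * (β' / β) * ((1 + δ) * (∫ x in Ω, ‖magGrad β u v x‖ ^ 2) + C * ∫ x in Ω, ‖u x‖ ^ 2) := by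
    intro u v h
    obtain ⟨w, z, h1, h2, h3, h4⟩ := hC β u v h
    rw [← h3, Finset.mul_sum, h3]
    calc _ ≤ ∑ p ∈ t, K ^ 2 * (β' / β) * ∫ x in Ω, ‖magGrad β (w p) (z p) x‖ ^ 2 :=
          Finset.sum_le_sum fun p hp => hloc p hp _ _ (h1 p) (h2 p)
      _ ≤ _ := by
          rw [← Finset.mul_sum]
          exact mul_le_mul_of_nonneg_left h4 (by positivity)
  have hle : (lambda1 Ω β' / (K ^ 2 * (β' / β)) - C) / (1 + δ) ≤ lambda1 Ω β := by
    refine le_lambda1 hΩ.isOpen hΩ.isBounded hΩ.isConnected.nonempty fun u v h => ?_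
    have h1 := hmain u v h
    have h2 : 0 < K ^ 2 * (β' / β) := by positivity
    rw [div_mul_eq_mul_div, div_le_iff₀ (by positivity), sub_mul, div_mul_eq_mul_div,
      sub_le_iff_le_add, div_le_iff₀ h2]
    linarith
  rw [div_le_iff₀ (by positivity), sub_le_iff_le_add, div_le_iff₀ (by positivity)] at hle
  rw [div_le_iff₀ hβ']
  refine hle.trans_eq ?_
  field_simp


/-! ### The upper bound by the half-plane energy -/

/-- A `C¹` bump on `[-a, a]`, decreasing on `[0, a]`. -/
noncomputable def hat (a t : ℝ) : ℝ := (max 0 (a ^ 2 - t ^ 2)) ^ 2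

/-- The derivative of `hat`. -/
noncomputable def hatDeriv (a t : ℝ) : ℝ := -(4 * t * max 0 (a ^ 2 - t ^ 2))

theorem hasDerivAt_max_zero_sq (s : ℝ) : HasDerivAt (fun s : ℝ => (max 0 s) ^ 2) (2 * max 0 s) s := by
  rcases lt_trichotomy s 0 with h | rfl | h
  · rw [max_eq_left h.le, mul_zero]
    refine (hasDerivAt_const s (0 : ℝ)).congr_of_eventuallyEq ?_
    filter_upwards [gt_mem_nhds h] with x hx
    simp [max_eq_left hx.le]
  · rw [max_self, mul_zero, hasDerivAt_iff_isLittleO_nhds_zero]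
    simp only [zero_add, max_self, ne_eq, OfNat.ofNat_ne_zero, not_false_eq_true, zero_pow, sub_zero,
      smul_zero]
    refine Asymptotics.IsBigO.trans_isLittleO (g := fun h : ℝ => h ^ 2) ?_
      (Asymptotics.isLittleO_pow_id one_lt_two)
    refine Asymptotics.IsBigO.of_bound 1 (Eventually.of_forall fun h => ?_)
    rw [one_mul, norm_pow, norm_pow]
    refine pow_le_pow_left₀ (norm_nonneg _) ?_ 2
    rw [Real.norm_of_nonneg (le_max_left _ _), Real.norm_eq_abs]
    exact max_le (abs_nonneg h) (le_abs_self h)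
  · rw [max_eq_right h.le]
    have := hasDerivAt_pow 2 s
    refine (this.congr_deriv (by simp)).congr_of_eventuallyEq ?_
    filter_upwards [lt_mem_nhds h] with x hx
    simp [max_eq_right hx.le]

theorem hasDerivAt_hat (a t : ℝ) : HasDerivAt (hat a) (hatDeriv a t) t := by
  have h1 : HasDerivAt (fun t : ℝ => a ^ 2 - t ^ 2) (-(2 * t)) t :=
    ((hasDerivAt_pow 2 t).const_sub (a ^ 2)).congr_deriv (by simp)
  exact ((hasDerivAt_max_zero_sq (a ^ 2 - t ^ 2)).comp t h1).congr_deriv (by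
    change 2 * max 0 (a ^ 2 - t ^ 2) * -(2 * t) = -(4 * t * max 0 (a ^ 2 - t ^ 2))
    ring)

theorem continuous_hatDeriv (a : ℝ) : Continuous (hatDeriv a) := by
  unfold hatDeriv; fun_prop

theorem contDiff_hat (a : ℝ) : ContDiff ℝ 1 (hat a) := by
  rw [contDiff_one_iff_deriv]
  refine ⟨fun t => (hasDerivAt_hat a t).differentiableAt, ?_⟩
  rw [show deriv (hat a) = hatDeriv a from funext fun t => (hasDerivAt_hat a t).deriv]
  exact continuous_hatDeriv a

theorem hat_of_le {a t : ℝ} (ha : 0 ≤ a) (h : a ≤ |t|) : hat a t = 0 ∧ hatDeriv a t = 0 := by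
  have : a ^ 2 ≤ t ^ 2 := by rw [← sq_abs t]; exact pow_le_pow_left₀ ha h 2
  simp [hat, hatDeriv, max_eq_left (sub_nonpos.2 this)]

/-- The constant depends on `a` alone, hence not on `β` when `F` is the squared, rescaled ground
state. As `F` decreases, half of `[0, a]` carries at least half of its mass. There `hat a ≥
(3a²/4)²`, while `hatDeriv a ² ≤ 16 a⁶` on `[0, a]`. -/
theorem integral_hat_mul_le {a : ℝ} (ha : 0 < a) {F : ℝ → ℝ} (hF : Continuous F) (h0 : ∀ t, 0 ≤ F t)
    (hanti : AntitoneOn F (Ici 0)) :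
    ∫ t in (0 : ℝ)..a, hatDeriv a t ^ 2 * F t
      ≤ (32 * a ^ 6 / (3 * a ^ 2 / 4) ^ 4) * ∫ t in (0 : ℝ)..a, hat a t ^ 2 * F t := by
  have hc1 := continuous_hatDeriv a
  have hc2 := (contDiff_hat a).continuous
  have ii : ∀ {g : ℝ → ℝ} {c d : ℝ}, Continuous g → IntervalIntegrable g volume c d :=
    fun h => h.intervalIntegrable _ _
  have h1 : ∫ t in (0 : ℝ)..a, hatDeriv a t ^ 2 * F t ≤ ∫ t in (0 : ℝ)..a, 16 * a ^ 6 * F t := by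
    refine intervalIntegral.integral_mono_on ha.le (ii (by fun_prop)) (ii (by fun_prop)) fun t ht => ?_
    refine mul_le_mul_of_nonneg_right ?_ (h0 t)
    have e : max 0 (a ^ 2 - t ^ 2) ≤ a ^ 2 := max_le (sq_nonneg a) (by linarith [sq_nonneg t])
    have e2 : t ^ 2 ≤ a ^ 2 := pow_le_pow_left₀ ht.1 ht.2 2
    have e3 : (max 0 (a ^ 2 - t ^ 2)) ^ 2 ≤ (a ^ 2) ^ 2 := pow_le_pow_left₀ (le_max_left _ _) e 2
    calc hatDeriv a t ^ 2 = 16 * (t ^ 2 * (max 0 (a ^ 2 - t ^ 2)) ^ 2) := by rw [hatDeriv]; ring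
      _ ≤ 16 * (a ^ 2 * (a ^ 2) ^ 2) := by gcongr
      _ = 16 * a ^ 6 := by ring
  have h2 : ∫ t in (0 : ℝ)..a, F t ≤ 2 * ∫ t in (0 : ℝ)..(a / 2), F t := by
    have e : ∫ t in (0 : ℝ)..a, F t = 2 * ∫ t in (0 : ℝ)..(a / 2), F (2 * t) := by
      rw [← smul_eq_mul, intervalIntegral.smul_integral_comp_mul_left]
      congr 1 <;> ring
    rw [e]
    refine mul_le_mul_of_nonneg_left ?_ zero_le_two
    refine intervalIntegral.integral_mono_on (by linarith)
      (ii (by fun_prop)) (ii hF) fun t ht => ?_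
    exact hanti ht.1 (mul_nonneg zero_le_two ht.1 : 0 ≤ 2 * t) (by linarith [ht.1])
  have h3 : (3 * a ^ 2 / 4) ^ 4 * ∫ t in (0 : ℝ)..(a / 2), F t
      ≤ ∫ t in (0 : ℝ)..a, hat a t ^ 2 * F t := by
    rw [← intervalIntegral.integral_const_mul]
    calc ∫ t in (0 : ℝ)..(a / 2), (3 * a ^ 2 / 4) ^ 4 * F t
        ≤ ∫ t in (0 : ℝ)..(a / 2), hat a t ^ 2 * F t := by
          refine intervalIntegral.integral_mono_on (by linarith)
            (ii (by fun_prop)) (ii (by fun_prop))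
            fun t ht => ?_
          refine mul_le_mul_of_nonneg_right ?_ (h0 t)
          have e2 : t ^ 2 ≤ (a / 2) ^ 2 := pow_le_pow_left₀ ht.1 ht.2 2
          have e : 3 * a ^ 2 / 4 ≤ max 0 (a ^ 2 - t ^ 2) := le_max_of_le_right (by nlinarith)
          calc (3 * a ^ 2 / 4) ^ 4 ≤ (max 0 (a ^ 2 - t ^ 2)) ^ 4 :=
                pow_le_pow_left₀ (by positivity) e 4
            _ = hat a t ^ 2 := by rw [hat]; ring
      _ ≤ _ := by
          refine intervalIntegral.integral_mono_interval le_rfl (by linarith) (by linarith)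
            (Eventually.of_forall fun t => mul_nonneg (sq_nonneg _) (h0 t))
            (ii (by fun_prop))
  have hm : 0 < (3 * a ^ 2 / 4) ^ 4 := by positivity
  rw [intervalIntegral.integral_const_mul] at h1
  calc _ ≤ 16 * a ^ 6 * ∫ t in (0 : ℝ)..a, F t := h1
    _ ≤ 16 * a ^ 6 * (2 * ∫ t in (0 : ℝ)..(a / 2), F t) := by gcongr
    _ = 32 * a ^ 6 / (3 * a ^ 2 / 4) ^ 4
        * ((3 * a ^ 2 / 4) ^ 4 * ∫ t in (0 : ℝ)..(a / 2), F t) := by field_simp; ring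
    _ ≤ _ := by gcongr

/-- A decreasing cut-off does not raise the energy of the half-line ground state above `Θ`. -/
theorem integral_hat_energy_le {a b k Θ : ℝ} (ha : 0 < a) (hb : 0 < b) {f f' : ℝ → ℝ}
    (hf : ∀ t, HasDerivAt f (f' t) t)
    (hf' : ∀ t, HasDerivAt f' (((t - k) ^ 2 - Θ) * f t) t) (h0 : f' 0 = 0)
    (hpos : ∀ t, 0 < f t) (hneg : ∀ t, 0 < t → f' t < 0) :
    ∫ t in (0 : ℝ)..a, hat a t ^ 2 * (b ^ 2 * ((b * t - k) ^ 2 * f (b * t) ^ 2 + f' (b * t) ^ 2))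
      ≤ Θ * b ^ 2 * ∫ t in (0 : ℝ)..a, hat a t ^ 2 * f (b * t) ^ 2 := by
  have hc1 := continuous_hatDeriv a
  have hc2 := (contDiff_hat a).continuous
  have hcf : Continuous f := continuous_iff_continuousAt.2 fun t => (hf t).continuousAt
  have hcf' : Continuous f' := continuous_iff_continuousAt.2 fun t => (hf' t).continuousAt
  have hl : ∀ t, HasDerivAt (fun t => b * t) b t := fun t => by
    simpa using (hasDerivAt_id t).const_mul b
  have hfb : ∀ t, HasDerivAt (fun t => f (b * t)) (f' (b * t) * b) t := fun t =>
    (hf (b * t)).comp t (hl t)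
  have hfb' : ∀ t, HasDerivAt (fun t => f' (b * t)) (((b * t - k) ^ 2 - Θ) * f (b * t) * b) t :=
    fun t => HasDerivAt.comp (h₂ := f') t (hf' (b * t)) (hl t)
  -- The weighted excess energy is a total derivative minus a cross term. The boundary terms vanish
  -- by `f' 0 = 0` and `hat a a = 0`.
  have hH : ∀ t, HasDerivAt (fun t => hat a t ^ 2 * (b * (f (b * t) * f' (b * t))))
      (2 * b * (hat a t * hatDeriv a t * (f (b * t) * f' (b * t)))
        + (hat a t ^ 2 * (b ^ 2 * ((b * t - k) ^ 2 * f (b * t) ^ 2 + f' (b * t) ^ 2))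
          - Θ * b ^ 2 * (hat a t ^ 2 * f (b * t) ^ 2))) t := by
    intro t
    refine (((hasDerivAt_hat a t).pow 2).mul (((hfb t).mul (hfb' t)).const_mul b)).congr_deriv ?_
    simp
    ring
  have hint := intervalIntegral.integral_eq_sub_of_hasDerivAt (a := 0) (b := a) (fun t _ => hH t)
    (Continuous.intervalIntegrable (by fun_prop) _ _)
  have hz : hat a a = 0 := (hat_of_le ha.le (le_abs_self a)).1
  have hsum : (∫ t in (0 : ℝ)..a, 2 * b * (hat a t * hatDeriv a t * (f (b * t) * f' (b * t))))
      + ((∫ t in (0 : ℝ)..a,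
          hat a t ^ 2 * (b ^ 2 * ((b * t - k) ^ 2 * f (b * t) ^ 2 + f' (b * t) ^ 2)))
        - Θ * b ^ 2 * ∫ t in (0 : ℝ)..a, hat a t ^ 2 * f (b * t) ^ 2) = 0 := by
    rw [← intervalIntegral.integral_const_mul (Θ * b ^ 2), ← intervalIntegral.integral_sub,
      ← intervalIntegral.integral_add, hint]
    · simp [hz, h0]
    all_goals exact Continuous.intervalIntegrable (by fun_prop) _ _
  -- The cross term has a sign, since the cut-off and the ground state both decrease; no decay
  -- estimate for `f` is needed.
  have hnn : 0 ≤ ∫ t in (0 : ℝ)..a, 2 * b * (hat a t * hatDeriv a t * (f (b * t) * f' (b * t))) := by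
    refine intervalIntegral.integral_nonneg ha.le fun t ht => ?_
    have e1 : 0 ≤ hat a t := sq_nonneg _
    have e2 : hatDeriv a t ≤ 0 := by
      have := mul_nonneg (mul_nonneg zero_le_four ht.1) (le_max_left 0 (a ^ 2 - t ^ 2))
      rw [hatDeriv]; linarith
    have e3 : f' (b * t) ≤ 0 := by
      rcases ht.1.eq_or_lt with rfl | h
      · rw [mul_zero, h0]
      · exact (hneg _ (mul_pos hb h)).le
    have e4 := (hpos (b * t)).le
    have := mul_nonneg_of_nonpos_of_nonpos (mul_nonpos_of_nonneg_of_nonpos e1 e2)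
      (mul_nonpos_of_nonneg_of_nonpos e4 e3)
    positivity
  linarith


/-! ### Trial states on half-discs near a smooth boundary point. -/

/-- The upper half of a disc. -/
def halfDisc (ρ : ℝ) : Set Plane := {y | y ∈ Metric.ball (0 : Plane) ρ ∧ 0 < y 1}

theorem continuous_plane_apply (j : Fin 2) : Continuous fun y : Plane => y j :=
  (EuclideanSpace.proj (𝕜 := ℝ) j).continuous

theorem isOpen_halfDisc (ρ : ℝ) : IsOpen (halfDisc ρ) :=
  Metric.isOpen_ball.inter (isOpen_lt continuous_const (continuous_plane_apply 1))

theorem isBounded_halfDisc (ρ : ℝ) : Bornology.IsBounded (halfDisc ρ) :=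
  Metric.isBounded_ball.subset fun _ h => h.1

theorem norm_lt_of_abs_lt {a : ℝ} {y : Plane} (h0 : |y 0| < a) (h1 : |y 1| < a) : ‖y‖ < 2 * a := by
  have ha : 0 < a := (abs_nonneg _).trans_lt h0
  refine lt_of_pow_lt_pow_left₀ 2 (by positivity) ?_
  rw [EuclideanSpace.norm_sq_eq, Fin.sum_univ_two, Real.norm_eq_abs, Real.norm_eq_abs]
  have e0 : |y 0| ^ 2 < a ^ 2 := pow_lt_pow_left₀ h0 (abs_nonneg _) two_ne_zero
  have e1 : |y 1| ^ 2 < a ^ 2 := pow_lt_pow_left₀ h1 (abs_nonneg _) two_ne_zero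
  nlinarith

/-- The square where the integrand may be nonzero lies in the disc because `2a ≤ ρ`, so the
half-disc can be replaced by the half-plane and the integral factorizes. -/
theorem integral_halfDisc_mul {a ρ : ℝ} (ha : 0 < a) (hρ : 2 * a ≤ ρ) {p q : ℝ → ℝ}
    (hp : ∀ t, a ≤ |t| → p t = 0) (hq : ∀ t, a ≤ |t| → q t = 0) :
    ∫ y in halfDisc ρ, p (y 0) * q (y 1) = (∫ t, p t) * ∫ t in (0 : ℝ)..a, q t := by
  have h1 : ∫ y in halfDisc ρ, p (y 0) * q (y 1)
      = ∫ y in {y : Plane | 0 < y 1}, p (y 0) * q (y 1) := by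
    refine (setIntegral_eq_of_subset_of_forall_sdiff_eq_zero
      (isOpen_lt continuous_const (continuous_plane_apply 1)).measurableSet (fun y hy => hy.2)
      fun y hy => ?_).symm
    by_cases h0 : a ≤ |y 0|
    · rw [hp _ h0, zero_mul]
    by_cases h1 : a ≤ |y 1|
    · rw [hq _ h1, mul_zero]
    refine absurd ⟨?_, hy.1⟩ hy.2
    rw [mem_ball_zero_iff]
    exact (norm_lt_of_abs_lt (not_le.1 h0) (not_le.1 h1)).trans_le hρ
  have h2 : ∫ y in {y : Plane | 0 < y 1}, p (y 0) * q (y 1)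
      = ∫ y : Plane, p (y 0) * (Ioi (0 : ℝ)).indicator q (y 1) := by
    rw [← integral_indicator (isOpen_lt continuous_const (continuous_plane_apply 1)).measurableSet]
    refine integral_congr_ae (Eventually.of_forall fun y => ?_)
    by_cases hy : 0 < y 1
    · simp [indicator, hy]
    · simp [indicator, hy]
  have h3 : ∫ y : Plane, p (y 0) * (Ioi (0 : ℝ)).indicator q (y 1)
      = ∫ z : ℝ × ℝ, p z.1 * (Ioi (0 : ℝ)).indicator q z.2 :=
    volume_preserving_planeProd.integral_comp planeProd.measurableEmbedding
      fun z : ℝ × ℝ => p z.1 * (Ioi (0 : ℝ)).indicator q z.2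
  rw [h1, h2, h3, Measure.volume_eq_prod, integral_prod_mul, integral_indicator measurableSet_Ioi,
    intervalIntegral.integral_of_le ha.le]
  congr 1
  refine setIntegral_eq_of_subset_of_forall_sdiff_eq_zero measurableSet_Ioi Ioc_subset_Ioi_self
    fun t ht => hq t ?_
  have h0 : 0 < t := ht.1
  rw [abs_of_pos h0]
  by_contra hcon
  exact ht.2 ⟨h0, (not_le.1 hcon).le⟩

/-- The product of two bumps, as a complex function on the plane. -/
noncomputable def hatProd (a : ℝ) (y : Plane) : ℂ := ((hat a (y 0) * hat a (y 1) : ℝ) : ℂ)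

theorem contDiff_hatProd (a : ℝ) : ContDiff ℝ 1 (hatProd a) := by
  have h : ∀ j : Fin 2, ContDiff ℝ 1 fun y : Plane => y j := fun j =>
    (EuclideanSpace.proj (𝕜 := ℝ) j).contDiff
  exact Complex.ofRealCLM.contDiff.comp
    (((contDiff_hat a).comp (h 0)).mul ((contDiff_hat a).comp (h 1)))

theorem norm_cgrad_hatProd_sq (a : ℝ) (y : Plane) : ‖cgrad (hatProd a) y‖ ^ 2
    = (hatDeriv a (y 0) * hat a (y 1)) ^ 2 + (hat a (y 0) * hatDeriv a (y 1)) ^ 2 := by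
  have hj : ∀ j : Fin 2, HasFDerivAt (fun y : Plane => hat a (y j))
      (hatDeriv a (y j) • EuclideanSpace.proj (𝕜 := ℝ) j) y := fun j =>
    HasDerivAt.comp_hasFDerivAt (h₂ := hat a) y (hasDerivAt_hat a (y j))
      (EuclideanSpace.proj (𝕜 := ℝ) j).hasFDerivAt
  have hd : HasFDerivAt (hatProd a) (Complex.ofRealCLM.comp
      (hat a (y 0) • (hatDeriv a (y 1) • EuclideanSpace.proj (𝕜 := ℝ) (1 : Fin 2))
        + hat a (y 1) • (hatDeriv a (y 0) • EuclideanSpace.proj (𝕜 := ℝ) (0 : Fin 2)))) y :=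
    Complex.ofRealCLM.hasFDerivAt.comp y ((hj 0).mul (hj 1))
  have e0 : cgrad (hatProd a) y 0 = ((hatDeriv a (y 0) * hat a (y 1) : ℝ) : ℂ) := by
    simp only [cgrad, hd.fderiv]
    simp
    ring
  have e1 : cgrad (hatProd a) y 1 = ((hat a (y 0) * hatDeriv a (y 1) : ℝ) : ℂ) := by
    simp only [cgrad, hd.fderiv]
    simp
  rw [EuclideanSpace.norm_sq_eq, Fin.sum_univ_two, e0, e1, Complex.norm_real, Complex.norm_real,
    Real.norm_eq_abs, Real.norm_eq_abs, sq_abs, sq_abs]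

/-- The half-plane state times a fixed product of bumps. The normal cut-off costs at most `c` by
`integral_hat_mul_le` and the tangential one costs `N' / N`, uniformly in `β`, so the error is a
constant against the main term of order `β`. -/
theorem exists_halfDisc_state {ρ δ : ℝ} (hρ : 0 < ρ) (hδ : 0 < δ) :
    ∃ C : ℝ, ∀ β : ℝ, 0 < β → ∃ w z, IsH1 (halfDisc ρ) w z ∧
      (∀ x, x ∉ Metric.closedBall (0 : Plane) (ρ / 2) → w x = 0) ∧
      0 < ∫ x in halfDisc ρ, ‖w x‖ ^ 2 ∧
      ∫ x in halfDisc ρ, ‖magGrad β w z x‖ ^ 2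
        ≤ ((1 + δ) * deGennesConst * β + C) * ∫ x in halfDisc ρ, ‖w x‖ ^ 2 := by
  obtain ⟨f, f', -, hf, hf', h0, hpos, hneg⟩ := exists_deGennes_groundState
  have hcf : Continuous f := continuous_iff_continuousAt.2 fun t => (hf t).continuousAt
  have hcf' : Continuous f' := continuous_iff_continuousAt.2 fun t => (hf' t).continuousAt
  set a := ρ / 4 with ha4
  have ha : 0 < a := by positivity
  have hc1 := continuous_hatDeriv a
  have hc2 := (contDiff_hat a).continuous
  have hz : ∀ t, a ≤ |t| → hat a t = 0 := fun t ht => (hat_of_le ha.le ht).1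
  have hz' : ∀ t, a ≤ |t| → hatDeriv a t = 0 := fun t ht => (hat_of_le ha.le ht).2
  have hpos0 : ∀ t ∈ Ioo (-a) a, 0 < hat a t := by
    intro t ht
    have : 0 < a ^ 2 - t ^ 2 := by nlinarith [ht.1, ht.2]
    rw [hat, max_eq_right this.le]
    positivity
  set c := 32 * a ^ 6 / (3 * a ^ 2 / 4) ^ 4 with hc
  set N := ∫ t, hat a t ^ 2 with hN
  set N' := ∫ t, hatDeriv a t ^ 2 with hN'
  have hcs : HasCompactSupport fun t => hat a t ^ 2 :=
    HasCompactSupport.of_support_subset_isCompact (isCompact_Icc (a := -a) (b := a)) fun t ht => by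
      by_contra h
      refine ht ?_
      have : a ≤ |t| := by
        by_contra h'
        exact h ⟨(abs_lt.1 (not_le.1 h')).1.le, (abs_lt.1 (not_le.1 h')).2.le⟩
      simp [hz t this]
  have hNpos : 0 < N := by
    have := (hc2.pow 2).integral_pos_of_hasCompactSupport_nonneg_nonzero (μ := volume) hcs
      (fun t => sq_nonneg _) (x := 0) (pow_ne_zero 2 (hpos0 0 ⟨by linarith, ha⟩).ne')
    exact this
  refine ⟨(1 + δ⁻¹) * (N' / N + c), fun β hβ => ?_⟩
  have hb : 0 < √β := Real.sqrt_pos.2 hβ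
  have hb2 : √β ^ 2 = β := Real.sq_sqrt hβ.le
  set k := √deGennesConst with hk
  obtain ⟨u, hu, hun, huG⟩ := exists_halfPlane_state hf hcf' hβ.le k
  have hV := isOpen_halfDisc ρ
  have hVb := isBounded_halfDisc ρ
  have hu1 := isH1_of_contDiff hV hVb hu
  have hw := hu1.mul hV hVb (contDiff_hatProd a)
  have hint : ∀ {g : Plane → ℝ}, Continuous g → IntegrableOn g (halfDisc ρ) := fun hg =>
    (hg.continuousOn.integrableOn_compact hVb.isCompact_closure).mono_set subset_closure
  have hy0 := continuous_plane_apply 0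
  have hy1 := continuous_plane_apply 1
  have h2a : 2 * a ≤ ρ := by rw [ha4]; linarith
  have hnA : ∀ y, ‖hatProd a y‖ ^ 2 = hat a (y 0) ^ 2 * hat a (y 1) ^ 2 := fun y => by
    rw [hatProd, Complex.norm_real, Real.norm_eq_abs, sq_abs, mul_pow]
  set I := ∫ t in (0 : ℝ)..a, hat a t ^ 2 * f (√β * t) ^ 2 with hI
  set I' := ∫ t in (0 : ℝ)..a, hatDeriv a t ^ 2 * f (√β * t) ^ 2 with hI'
  set E := ∫ t in (0 : ℝ)..a, hat a t ^ 2 * (√β ^ 2 * ((√β * t - k) ^ 2 * f (√β * t) ^ 2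
    + f' (√β * t) ^ 2)) with hE
  have hE1 : E ≤ deGennesConst * √β ^ 2 * I := integral_hat_energy_le ha hb hf hf' h0 hpos hneg
  have hI1 : I' ≤ c * I := by
    refine integral_hat_mul_le ha (F := fun t => f (√β * t) ^ 2) (by fun_prop)
      (fun t => sq_nonneg _) ?_
    have hanti : AntitoneOn f (Ici 0) := by
      refine antitoneOn_of_deriv_nonpos (convex_Ici 0) hcf.continuousOn
        (fun t _ => (hf t).differentiableAt.differentiableWithinAt) fun t ht => ?_
      rw [interior_Ici] at ht
      rw [(hf t).deriv]
      exact (hneg t ht).le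
    intro s hs t ht hst
    exact pow_le_pow_left₀ (hpos _).le (hanti (mul_nonneg hb.le hs) (mul_nonneg hb.le ht)
      (mul_le_mul_of_nonneg_left hst hb.le)) 2
  have hIpos : 0 < I := by
    refine intervalIntegral.intervalIntegral_pos_of_pos_on
      (Continuous.intervalIntegrable (by fun_prop) _ _) (fun t ht => ?_) ha
    exact mul_pos (pow_pos (hpos0 t ⟨by linarith [ht.1], ht.2⟩) 2) (pow_pos (hpos _) 2)
  have e1 : ∫ x in halfDisc ρ, ‖hatProd a x * u x‖ ^ 2 = N * I := by
    rw [hN, hI, ← integral_halfDisc_mul ha h2a (p := fun t => hat a t ^ 2)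
      (q := fun t => hat a t ^ 2 * f (√β * t) ^ 2) (fun t ht => by simp [hz t ht])
      (fun t ht => by simp [hz t ht])]
    refine integral_congr_ae (Eventually.of_forall fun y => ?_)
    simp only [norm_mul, mul_pow, hnA, hun]
    ring
  have e2 : ∫ x in halfDisc ρ, ‖hatProd a x‖ ^ 2 * ‖magGrad β u (cgrad u) x‖ ^ 2 = N * E := by
    rw [hN, hE, ← integral_halfDisc_mul ha h2a (p := fun t => hat a t ^ 2)
      (q := fun t => hat a t ^ 2 * (√β ^ 2 * ((√β * t - k) ^ 2 * f (√β * t) ^ 2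
        + f' (√β * t) ^ 2))) (fun t ht => by simp [hz t ht]) (fun t ht => by simp [hz t ht])]
    refine integral_congr_ae (Eventually.of_forall fun y => ?_)
    simp only [hnA, huG, hb2]
    ring
  have e3 : ∫ x in halfDisc ρ, ‖u x‖ ^ 2 * ‖cgrad (hatProd a) x‖ ^ 2 = N' * I + N * I' := by
    rw [hN, hN', hI, hI', ← integral_halfDisc_mul ha h2a (p := fun t => hatDeriv a t ^ 2)
      (q := fun t => hat a t ^ 2 * f (√β * t) ^ 2) (fun t ht => by simp [hz' t ht])
      (fun t ht => by simp [hz t ht]), ← integral_halfDisc_mul ha h2a (p := fun t => hat a t ^ 2)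
      (q := fun t => hatDeriv a t ^ 2 * f (√β * t) ^ 2) (fun t ht => by simp [hz t ht])
      (fun t ht => by simp [hz' t ht]), ← integral_add (hint (by fun_prop)) (hint (by fun_prop))]
    refine integral_congr_ae (Eventually.of_forall fun y => ?_)
    simp only [norm_cgrad_hatProd_sq, hun]
    ring
  have i2 : IntegrableOn (fun x => ‖hatProd a x‖ ^ 2 * ‖magGrad β u (cgrad u) x‖ ^ 2)
      (halfDisc ρ) := by
    simp only [hnA, huG]
    exact hint (by fun_prop)
  have i3 : IntegrableOn (fun x => ‖u x‖ ^ 2 * ‖cgrad (hatProd a) x‖ ^ 2) (halfDisc ρ) := by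
    simp only [norm_cgrad_hatProd_sq, hun]
    exact hint (by fun_prop)
  refine ⟨_, _, hw, ?_, ?_, ?_⟩
  · intro x hx
    rw [mem_closedBall_zero_iff, not_le] at hx
    have : hatProd a x = 0 := by
      by_contra hne
      have h0 : |x 0| < a := by
        by_contra h
        exact hne (by simp [hatProd, hz _ (not_lt.1 h)])
      have h1 : |x 1| < a := by
        by_contra h
        exact hne (by simp [hatProd, hz _ (not_lt.1 h)])
      have := norm_lt_of_abs_lt h0 h1
      rw [ha4] at this
      linarith
    simp only [this, zero_mul]
  · rw [e1]; positivity
  · rw [e1]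
    calc ∫ x in halfDisc ρ, ‖magGrad β (fun x => hatProd a x * u x)
          (fun x => hatProd a x • cgrad u x + u x • cgrad (hatProd a) x) x‖ ^ 2
        ≤ ∫ x in halfDisc ρ, ((1 + δ) * (‖hatProd a x‖ ^ 2 * ‖magGrad β u (cgrad u) x‖ ^ 2)
          + (1 + δ⁻¹) * (‖u x‖ ^ 2 * ‖cgrad (hatProd a) x‖ ^ 2)) := by
          have hm := memLp_magGrad_of_isOpen hV hVb β hw
          refine setIntegral_mono_on ((memLp_two_iff_integrable_sq_norm hm.1).1 hm)
            ((i2.const_mul _).add (i3.const_mul _)) hV.measurableSet fun x _ => ?_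
          rw [magGrad_mul, ← mul_pow, ← mul_pow, ← norm_smul, ← norm_smul]
          exact norm_add_sq_le_of_pos _ _ hδ
      _ = (1 + δ) * (N * E) + (1 + δ⁻¹) * (N' * I + N * I') := by
          rw [integral_add (i2.const_mul _) (i3.const_mul _), integral_const_mul,
            integral_const_mul, e2, e3]
      _ ≤ (1 + δ) * (N * (deGennesConst * √β ^ 2 * I)) + (1 + δ⁻¹) * (N' * I + N * (c * I)) := by
          gcongr
      _ = _ := by
          rw [hb2]
          field_simp


theorem convex_halfDisc (ρ : ℝ) : Convex ℝ (halfDisc ρ) :=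
  (convex_ball 0 ρ).inter (t := {y : Plane | 0 < y 1})
    (convex_halfSpace_gt (f := fun y : Plane => y 1)
      (IsLinearMap.mk (fun _ _ => rfl) fun _ _ => rfl) 0)

/-- The half-disc is connected and its image avoids the boundary of `Ω`, so one of its points in `Ω`
brings in all of them. -/
theorem halfDisc_subset_of_straightens {Φ : Plane ≃ₜ Plane} {Ω : Set Plane} (hΩ : IsOpen Ω) {ρ : ℝ}
    (hb : ∀ y ∈ Metric.ball (0 : Plane) ρ, Φ.symm y ∈ frontier Ω ↔ y 1 = 0) {y₀ : Plane}
    (hy₀ : y₀ ∈ halfDisc ρ) (h₀ : Φ.symm y₀ ∈ Ω) :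
    Φ ⁻¹' halfDisc ρ ⊆ Ω ∧ ∀ x ∈ Ω, Φ x ∈ Metric.ball (0 : Plane) ρ →
      x ∈ closure (Φ ⁻¹' halfDisc ρ) → Φ x ∈ halfDisc ρ := by
  constructor
  · have hconn : IsPreconnected (Φ.symm '' halfDisc ρ) :=
      (convex_halfDisc ρ).isPreconnected.image _ Φ.symm.continuous.continuousOn
    intro x hx
    have hd : Disjoint (frontier Ω) (Φ.symm '' halfDisc ρ) := by
      rw [Set.disjoint_right]
      rintro _ ⟨y, hy, rfl⟩ hmem
      exact hy.2.ne' ((hb y hy.1).1 hmem)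
    exact (hconn.mem_iff_of_disjoint_frontier hΩ hd ⟨y₀, hy₀, rfl⟩
      ⟨Φ x, hx, Φ.symm_apply_apply x⟩).1 h₀
  · intro x hx hxb hxc
    have h1 : 0 ≤ Φ x 1 := by
      have hcl : IsClosed {x : Plane | 0 ≤ Φ x 1} :=
        isClosed_le continuous_const ((continuous_plane_apply 1).comp Φ.continuous)
      exact closure_minimal (fun x hx => (hx.2.le : 0 ≤ Φ x 1)) hcl hxc
    refine ⟨hxb, h1.lt_of_ne' fun h => ?_⟩
    have := (hb _ hxb).2 h
    rw [Φ.symm_apply_apply, hΩ.frontier_eq] at this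
    exact this.2 hx

/-- Any point of `Ω` near `p` lies on one side of the straightened boundary; a reflection makes it
the upper side. -/
theorem Straightens.exists_halfDisc {Φ : Plane ≃ₜ Plane} {Ω : Set Plane} {p : Plane} (hΩ : IsOpen Ω)
    (h : Straightens Φ (frontier Ω) p {x | x 1 = 0}) (hp : p ∈ closure Ω) {K : ℝ} (hK : 0 ≤ K)
    (hΦ : IsNearIsometry Φ K) :
    ∃ (Ψ : Plane ≃ₜ Plane) (ρ : ℝ), 0 < ρ ∧ IsNearIsometry Ψ K ∧ Ψ ⁻¹' halfDisc ρ ⊆ Ω ∧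
      ∀ x ∈ Ω, Ψ x ∈ Metric.ball (0 : Plane) ρ →
        x ∈ closure (Ψ ⁻¹' halfDisc ρ) → Ψ x ∈ halfDisc ρ := by
  obtain ⟨ρ, hρ, hb⟩ := h.exists_ball
  have hn : Φ ⁻¹' Metric.ball 0 ρ ∈ 𝓝 p :=
    Φ.continuous.continuousAt (by rw [h.1]; exact Metric.ball_mem_nhds _ hρ)
  obtain ⟨x, hxb, hx⟩ := mem_closure_iff_nhds.1 hp _ hn
  have hne : Φ x 1 ≠ 0 := by
    intro h0
    have := (hb _ hxb).2 h0
    rw [Φ.symm_apply_apply, hΩ.frontier_eq] at this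
    exact this.2 hx
  rcases hne.lt_or_gt with hlt | hgt
  · have hflip : ∀ y, (Φ.trans axisFlip.toHomeomorph).symm y = Φ.symm (axisFlip y) := by
      intro y
      rw [Homeomorph.symm_apply_eq]
      ext j
      fin_cases j
      · simp [axisFlip_zero]
      · simp [axisFlip_one]
    refine ⟨Φ.trans axisFlip.toHomeomorph, ρ, hρ,
      (hΦ.trans (isNearIsometry_linear axisFlip) hK zero_le_one).mono (mul_one _).le,
      halfDisc_subset_of_straightens hΩ ?_ (y₀ := axisFlip (Φ x)) ?_ ?_⟩
    · intro y hy
      rw [hflip, hb _ (by simpa using hy)]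
      change axisFlip y 1 = 0 ↔ _
      rw [axisFlip_one, neg_eq_zero]
    · refine ⟨by simpa using hxb, ?_⟩
      rw [axisFlip_one]
      linarith
    · rw [hflip]
      have : axisFlip (axisFlip (Φ x)) = Φ x := by
        ext j
        fin_cases j
        · simp [axisFlip_zero]
        · simp [axisFlip_one]
      rwa [this, Φ.symm_apply_apply]
  · exact ⟨Φ, ρ, hρ, hΦ, halfDisc_subset_of_straightens hΩ hb (y₀ := Φ x) ⟨hxb, hgt⟩
      (by rwa [Φ.symm_apply_apply])⟩

/-- The half-plane bound for the first eigenvalue of a curvilinear polygon. -/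
theorem IsCurvilinearPolygon.exists_lambda1_le {Ω : Set Plane} (hΩ : IsBoundedDomain Ω)
    (h : IsCurvilinearPolygon Ω) {η : ℝ} (hη : 0 < η) :
    ∃ C : ℝ, ∀ β : ℝ, 0 < β → lambda1 Ω β ≤ (deGennesConst + η) * β + C := by
  obtain ⟨n, γ, hγ, hreg, hcyc, hinj, hang, hF⟩ := h
  obtain ⟨ε, hε, hεη⟩ : ∃ ε : ℝ, 0 < ε ∧
      ((1 + ε) ^ 2) ^ 2 * ((1 + ε) * deGennesConst) < deGennesConst + η := by
    have hc : ContinuousAt (fun ε : ℝ => ((1 + ε) ^ 2) ^ 2 * ((1 + ε) * deGennesConst)) 0 := by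
      fun_prop
    have := hc.eventually (gt_mem_nhds (a := deGennesConst + η) (by simpa using hη))
    obtain ⟨r, hr, hb⟩ := Metric.eventually_nhds_iff_ball.1 this
    refine ⟨r / 2, by positivity, hb _ ?_⟩
    rw [Metric.mem_ball, Real.dist_eq, sub_zero, abs_of_pos (by positivity)]
    exact half_lt_self hr
  -- Any smooth boundary point will do; the middle of the first arc is chosen.
  obtain ⟨Φ, hΦ, hs⟩ := polygon_straightens_smooth hγ hreg hcyc hinj 0 (t := 1 / 2)
    ⟨by norm_num, by norm_num⟩ hε
  rw [← hF] at hs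
  have hp : γ 0 (1 / 2) ∈ closure Ω := by
    refine frontier_subset_closure ?_
    rw [hF]
    exact mem_iUnion.2 ⟨0, 1 / 2, ⟨by norm_num, by norm_num⟩, rfl⟩
  obtain ⟨Ψ, ρ, hρ, hΨ, hsub, hfr⟩ := hs.exists_halfDisc hΩ.isOpen hp (by positivity) hΦ
  obtain ⟨C, hC⟩ := exists_halfDisc_state hρ hε
  refine ⟨((1 + ε) ^ 2) ^ 2 * C, fun β hβ => ?_⟩
  obtain ⟨w, z, hw, hw0, hwpos, hle⟩ := hC β hβ
  have h1 := (hΨ β).1.lambda1_mul_le one_pos hΩ.isOpen (isOpen_halfDisc ρ) (isBounded_halfDisc ρ)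
    Metric.isClosed_closedBall Metric.isOpen_ball
    (Metric.closedBall_subset_ball (half_lt_self hρ)) hsub hfr hw hw0
  have h2 := h1.trans (mul_le_mul_of_nonneg_left hle (by positivity))
  rw [← mul_assoc] at h2
  refine (le_of_mul_le_mul_right h2 hwpos).trans ?_
  have := mul_le_mul_of_nonneg_right hεη.le hβ.le
  linarith

/-! ### Existence of the limit and comparison with `Θ₀`. -/

/-- The limit of `λ₁(Ω, β) / β` exists and is at most `Θ₀` for a curvilinear polygon. -/
theorem IsCurvilinearPolygon.exists_tendsto {Ω : Set Plane} (hΩ : IsBoundedDomain Ω)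
    (h : IsCurvilinearPolygon Ω) :
    ∃ Λ : ℝ, Tendsto (fun β : ℝ => lambda1 Ω β / β) atTop (𝓝 Λ) ∧ Λ ≤ deGennesConst := by
  set q : ℝ → ℝ := fun β => lambda1 Ω β / β with hq
  have hq0 : ∀ β, 0 < β → 0 ≤ q β := fun β hβ => div_nonneg (lambda1_nonneg Ω β) hβ.le
  have hub : ∀ η > 0, ∀ᶠ β in atTop, q β ≤ deGennesConst + η := by
    intro η hη
    obtain ⟨C, hC⟩ := h.exists_lambda1_le hΩ (half_pos hη)
    filter_upwards [eventually_gt_atTop 0, eventually_ge_atTop (2 * C / η)] with β hβ hβC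
    rw [hq, div_le_iff₀ hβ]
    rw [div_le_iff₀ hη] at hβC
    linarith [hC β hβ]
  have hbdd : IsBoundedUnder (· ≤ ·) atTop q := ⟨_, eventually_map.2 (hub 1 one_pos)⟩
  have hbdd' : IsBoundedUnder (· ≥ ·) atTop q :=
    ⟨0, eventually_map.2 ((eventually_gt_atTop 0).mono hq0)⟩
  -- At one large `β` where `q` is close to its lower limit, almost monotonicity bounds `q` at all
  -- later points by nearly the same value. The constant `C` is fixed before `β`, so that `C / β ≤
  -- ε` can be imposed.
  have hlim : limsup q atTop ≤ liminf q atTop := by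
    set l := liminf q atTop with hl
    have hl0 : 0 ≤ l := le_liminf_of_le hbdd.isCoboundedUnder_ge
      ((eventually_gt_atTop 0).mono hq0)
    refine le_of_forall_gt_imp_ge_of_dense fun m hm => ?_
    obtain ⟨ε, hε, hεm⟩ : ∃ ε : ℝ, 0 < ε ∧
        (((1 + ε) ^ 2) ^ 2) ^ 2 * ((1 + ε) * (l + ε) + ε) < m := by
      have hc : ContinuousAt
          (fun ε : ℝ => (((1 + ε) ^ 2) ^ 2) ^ 2 * ((1 + ε) * (l + ε) + ε)) 0 := by fun_prop
      have := hc.eventually (gt_mem_nhds (a := m) (by simpa using hm))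
      obtain ⟨r, hr, hb⟩ := Metric.eventually_nhds_iff_ball.1 this
      refine ⟨r / 2, by positivity, hb _ ?_⟩
      rw [Metric.mem_ball, Real.dist_eq, sub_zero, abs_of_pos (by positivity)]
      exact half_lt_self hr
    obtain ⟨C, hC0, hC⟩ := exists_lambda1_div_le hΩ (K := ((1 + ε) ^ 2) ^ 2) (by positivity)
      (fun p hp => by
        obtain ⟨Φ, h1, -, h2⟩ := h.exists_dilation_chart hΩ.isOpen hp hε
        exact ⟨Φ, h1, h2⟩) hε
    have hfreq : ∃ᶠ β in atTop, q β < l + ε :=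
      frequently_lt_of_liminf_lt hbdd.isCoboundedUnder_ge (by linarith)
    obtain ⟨β, hβl, hβ0, hβC⟩ := (hfreq.and_eventually ((eventually_gt_atTop 0).and
      (eventually_ge_atTop (C / ε)))).exists
    refine limsup_le_of_le hbdd'.isCoboundedUnder_le ?_
    filter_upwards [eventually_ge_atTop β] with β' hβ'
    refine (hC β β' hβ0 hβ').trans ((mul_le_mul_of_nonneg_left ?_ (by positivity)).trans hεm.le)
    rw [div_le_iff₀ hε] at hβC
    have h1 : C / β ≤ ε := by rw [div_le_iff₀ hβ0]; linarith
    have h2 := mul_le_mul_of_nonneg_left hβl.le (by positivity : 0 ≤ 1 + ε)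
    simp only [hq] at h2
    linarith
  refine ⟨liminf q atTop, ?_, ?_⟩
  · exact tendsto_of_le_liminf_of_limsup_le le_rfl hlim
  · refine le_of_forall_pos_le_add fun η hη => ?_
    exact (liminf_le_limsup hbdd hbdd').trans (limsup_le_of_le hbdd'.isCoboundedUnder_le (hub η hη))


/-! ### Self-tiling domains -/

/-- The arc is the image of a null segment of the plane under the differentiable map `x ↦ γ(x₁)`. -/
theorem volume_image_arc {γ : ℝ → Plane} (hγ : ContDiffOn ℝ ∞ γ (Icc 0 1)) :
    volume (γ '' Icc 0 1) = 0 := by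
  set S : Set Plane := {x | x 0 ∈ Icc (0 : ℝ) 1 ∧ x 1 = 0} with hS
  have hS0 : volume S = 0 := by
    let l : Plane →ₗ[ℝ] ℝ := (EuclideanSpace.proj (𝕜 := ℝ) (1 : Fin 2)).toLinearMap
    have h : volume (LinearMap.ker l : Set Plane) = 0 := by
      refine Measure.addHaar_submodule volume _ fun htop => ?_
      have : EuclideanSpace.single (1 : Fin 2) (1 : ℝ) ∈ LinearMap.ker l := by rw [htop]; trivial
      simp [l] at this
    exact measure_mono_null (fun x hx => by simpa [l] using hx.2) h
  have himg : γ '' Icc 0 1 = (fun x : Plane => γ (x 0)) '' S := by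
    ext y
    constructor
    · rintro ⟨t, ht, rfl⟩
      exact ⟨!₂[t, 0], ⟨ht, rfl⟩, rfl⟩
    · rintro ⟨x, hx, rfl⟩
      exact ⟨x 0, hx.1, rfl⟩
  rw [himg]
  refine addHaar_image_eq_zero_of_differentiableOn_of_addHaar_eq_zero volume ?_ hS0
  exact (hγ.differentiableOn (by simp)).comp
    (EuclideanSpace.proj (𝕜 := ℝ) (0 : Fin 2)).differentiable.differentiableOn fun x hx => hx.1

theorem IsCurvilinearPolygon.volume_frontier {Ω : Set Plane} (h : IsCurvilinearPolygon Ω) :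
    volume (frontier Ω) = 0 := by
  obtain ⟨n, γ, hγ, -, -, -, -, hF⟩ := h
  rw [hF]
  exact measure_iUnion_null fun s => volume_image_arc (hγ s)

theorem IsometryEquiv.volume_image (M : Plane ≃ᵢ Plane) (S : Set Plane) :
    volume (M '' S) = volume S := by
  have hM : ∀ x, M.symm x = M.symm.toRealLinearIsometryEquiv x + M.symm 0 := fun x => by
    rw [IsometryEquiv.toRealLinearIsometryEquiv_apply]; abel
  have h : MeasurePreserving M.symm.toHomeomorph volume volume := by
    have h1 : (M.symm.toHomeomorph : Plane → Plane)
        = fun x => M.symm.toRealLinearIsometryEquiv x + M.symm 0 := funext hM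
    rw [h1]
    exact (measurePreserving_add_right volume _).comp
      M.symm.toRealLinearIsometryEquiv.measurePreserving
  have := h.measure_preimage_emb M.symm.toHomeomorph.measurableEmbedding S
  rw [← this]
  congr 1
  exact M.toEquiv.image_eq_preimage_symm S

theorem volume_image_dilation (M : Plane ≃ᵢ Plane) {m : ℕ} (hm : 0 < m) (S : Set Plane) :
    volume (M '' ((√(m : ℝ))⁻¹ • S)) = ENNReal.ofReal (m : ℝ)⁻¹ * volume S := by
  rw [IsometryEquiv.volume_image, Measure.addHaar_smul, finrank_euclideanSpace, Fintype.card_fin,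
    inv_pow, Real.sq_sqrt (Nat.cast_nonneg m), abs_of_pos (by positivity)]

/-- The integrals over the tiles add up to the integral over the domain. -/
theorem sum_integral_tiles {Ω : Set Plane} (hΩ : IsBoundedDomain Ω)
    {m : ℕ} (hm : 0 < m) {T : Fin m → Set Plane} (hto : ∀ i, IsOpen (T i)) (htΩ : ∀ i, T i ⊆ Ω)
    (hcov : Ω ⊆ ⋃ i, closure (T i)) (hfr : ∀ i, volume (frontier (T i)) = 0)
    (hvol : ∀ i, volume (T i) = ENNReal.ofReal (m : ℝ)⁻¹ * volume Ω) {F : Plane → ℝ}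
    (hF : IntegrableOn F Ω) : ∑ i, ∫ x in T i, F x = ∫ x in Ω, F x := by
  have hfin : IsFiniteMeasure (volume.restrict Ω) := ⟨by
    rw [Measure.restrict_apply_univ]; exact hΩ.isBounded.measure_lt_top⟩
  have hind : ∀ (G : Plane → ℝ) i, ∫ x in T i, G x = ∫ x in Ω, (T i).indicator G x := fun G i => by
    rw [setIntegral_indicator (hto i).measurableSet, inter_eq_right.2 (htΩ i)]
  have hiind : ∀ {G : Plane → ℝ}, IntegrableOn G Ω → ∀ i, IntegrableOn ((T i).indicator G) Ω :=
    fun hG i => hG.indicator (hto i).measurableSet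
  have i1 : IntegrableOn (fun _ : Plane => (1 : ℝ)) Ω := integrable_const 1
  -- `g` counts the tiles that contain a point. Disjointness of the tiles is not assumed: it follows
  -- almost everywhere from `g ≥ 1`, a consequence of the covering, and from the equality of the
  -- total areas.
  set g : Plane → ℝ := fun x => ∑ i, (T i).indicator (fun _ => (1 : ℝ)) x with hg
  have ig : IntegrableOn g Ω := integrable_finsetSum _ fun i _ => hiind i1 i
  have hge : ∀ᵐ x ∂volume.restrict Ω, 1 ≤ g x := by
    have hnull : volume (⋃ i, frontier (T i)) = 0 := measure_iUnion_null hfr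
    filter_upwards [ae_restrict_mem hΩ.isOpen.measurableSet,
      ae_restrict_of_ae (compl_mem_ae_iff.2 hnull)] with x hx hxf
    obtain ⟨i, hi⟩ := mem_iUnion.1 (hcov hx)
    rw [closure_eq_self_union_frontier] at hi
    have hxi : x ∈ T i := hi.resolve_right fun h => hxf (mem_iUnion.2 ⟨i, h⟩)
    have := Finset.single_le_sum (f := fun i => (T i).indicator (fun _ => (1 : ℝ)) x)
      (fun j _ => indicator_nonneg (fun _ _ => zero_le_one) x) (Finset.mem_univ i)
    simpa [hxi] using this
  have hint : ∫ x in Ω, (g x - 1) = 0 := by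
    rw [integral_sub ig i1, integral_finsetSum _ fun i _ => hiind i1 i]
    simp only [← hind]
    simp only [integral_const, smul_eq_mul, mul_one, Measure.real, Measure.restrict_apply_univ, hvol,
      ENNReal.toReal_mul]
    rw [ENNReal.toReal_ofReal (by positivity), Finset.sum_const, Finset.card_univ, Fintype.card_fin,
      nsmul_eq_mul, ← mul_assoc, mul_inv_cancel₀ (by positivity), one_mul, sub_self]
  have heq : ∀ᵐ x ∂volume.restrict Ω, g x = 1 := by
    have := (integral_eq_zero_iff_of_nonneg_ae (hge.mono fun x hx => sub_nonneg.2 hx)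
      (ig.sub i1)).1 hint
    filter_upwards [this] with x hx
    exact sub_eq_zero.1 hx
  simp only [hind F]
  rw [← integral_finsetSum _ fun i _ => hiind hF i]
  refine integral_congr_ae ?_
  filter_upwards [heq] with x hx
  calc ∑ i, (T i).indicator F x = ∑ i, (T i).indicator (fun _ => (1 : ℝ)) x * F x := by
        refine Finset.sum_congr rfl fun i _ => ?_
        by_cases hxi : x ∈ T i <;> simp [hxi]
    _ = g x * F x := by rw [hg, Finset.sum_mul]
    _ = F x := by rw [hx, one_mul]

/-- Rescaling a tile to `Ω` turns the field `mβ` into `β` and divides Rayleigh quotients by `m`. -/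
theorem lambda1_tile_le (Ω : Set Plane) (M : Plane ≃ᵢ Plane) {m : ℕ} (hm : 0 < m)
    {β : ℝ} {u : Plane → ℂ} {v : Plane → CVec} (hΩ : IsBoundedDomain Ω)
    (h : IsH1 (M '' ((√(m : ℝ))⁻¹ • Ω)) u v) :
    m * lambda1 Ω β * ∫ x in M '' ((√(m : ℝ))⁻¹ • Ω), ‖u x‖ ^ 2
      ≤ ∫ x in M '' ((√(m : ℝ))⁻¹ • Ω), ‖magGrad (m * β) u v x‖ ^ 2 := by
  have hm' : (0 : ℝ) < m := Nat.cast_pos.2 hm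
  set s := (√(m : ℝ))⁻¹ with hs
  have hs0 : 0 < s := inv_pos.2 (Real.sqrt_pos.2 hm')
  have hs2 : s ^ 2 = (m : ℝ)⁻¹ := by rw [hs, inv_pow, Real.sq_sqrt hm'.le]
  have hT := (transports_dilation hs0 (m * β)).trans (transports_isometry M (m * β))
    (by rw [inv_mul_cancel₀ (by positivity)]; exact zero_le_one)
  rw [hs2, inv_inv, inv_mul_cancel_left₀ hm'.ne', mul_one, mul_one] at hT
  set Ψ := (dilation s hs0.ne').trans M.toHomeomorph with hΨ
  have himg : Ψ '' Ω = M '' (s • Ω) := by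
    rw [← image_smul, image_image]; rfl
  have hpre : Ψ ⁻¹' (M '' (s • Ω)) = Ω := by rw [← himg, Ψ.preimage_image]
  have ho : IsOpen (M '' (s • Ω)) := by rw [← himg]; exact Ψ.isOpenMap _ hΩ.isOpen
  have hb : Bornology.IsBounded (M '' (s • Ω)) := by
    rw [← himg]
    exact (hΩ.isBounded.isCompact_closure.image Ψ.continuous).isBounded.subset
      (image_mono subset_closure)
  obtain ⟨u', v', h1, -, h2, h3⟩ := hT _ ho hb u v h
  rw [hpre] at h1 h2 h3
  have h4 := h1.lambda1_mul_le (β := β)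
  rw [h2] at h4
  have h5 := h4.trans h3
  rw [mul_inv_cancel₀ hm'.ne', one_mul] at h5
  refine le_of_eq_of_le ?_ h5
  ring

/-- The restriction of an `H¹` function to a tile is admissible there because the condition at the
boundary is Neumann; summing the tile inequalities bounds the Rayleigh quotient on `Ω`. -/
theorem IsSelfTiling.exists_lambda1_mul_le {Ω : Set Plane} (hΩ : IsBoundedDomain Ω)
    (h0 : volume (frontier Ω) = 0) (h : IsSelfTiling Ω) :
    ∃ m : ℕ, 2 ≤ m ∧ ∀ β : ℝ, m * lambda1 Ω β ≤ lambda1 Ω (m * β) := by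
  obtain ⟨m, M, hm, hTl⟩ := h
  have hm0 : 0 < m := by omega
  have hs0 : (√(m : ℝ))⁻¹ ≠ 0 := (inv_pos.2 (Real.sqrt_pos.2 (Nat.cast_pos.2 hm0))).ne'
  let Ψ : Fin m → Plane ≃ₜ Plane := fun i => (dilation _ hs0).trans (M i).toHomeomorph
  have himg : ∀ i S, Ψ i '' S = M i '' ((√(m : ℝ))⁻¹ • S) := fun i S => by
    rw [← image_smul, image_image]; rfl
  set T : Fin m → Set Plane := fun i => M i '' ((√(m : ℝ))⁻¹ • Ω) with ht
  have hto : ∀ i, IsOpen (T i) := fun i => by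
    simp only [ht, ← himg]
    exact (Ψ i).isOpenMap _ hΩ.isOpen
  have htΩ : ∀ i, T i ⊆ Ω := fun i => by
    rw [hTl]
    exact interior_maximal (subset_closure.trans (subset_iUnion (fun i => closure (T i)) i)) (hto i)
  have hcov : Ω ⊆ ⋃ i, closure (T i) := by
    conv_lhs => rw [hTl]
    exact interior_subset
  have hfr : ∀ i, volume (frontier (T i)) = 0 := fun i => by
    simp only [ht, ← himg]
    rw [← (Ψ i).image_frontier, himg, volume_image_dilation _ hm0, h0, mul_zero]
  refine ⟨m, hm, fun β => le_lambda1 hΩ.isOpen hΩ.isBounded hΩ.isConnected.nonempty fun u v hu => ?_⟩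
  have hmg := memLp_magGrad_of_isOpen hΩ.isOpen hΩ.isBounded (m * β) hu
  have hsum : ∀ {F : Plane → ℝ}, IntegrableOn F Ω → ∑ i, ∫ x in T i, F x = ∫ x in Ω, F x := fun hF =>
    sum_integral_tiles hΩ hm0 hto htΩ hcov hfr (fun i => volume_image_dilation _ hm0 Ω) hF
  rw [← hsum ((memLp_two_iff_integrable_sq_norm hu.memLp.1).1 hu.memLp),
    ← hsum ((memLp_two_iff_integrable_sq_norm hmg.1).1 hmg), Finset.mul_sum]
  exact Finset.sum_le_sum fun i _ => lambda1_tile_le Ω (M i) hm0 hΩ (hu.mono (htΩ i))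

/-- Iterating `m λ₁(β) ≤ λ₁(mβ)` compares `λ₁(β)/β` with its values along `mᵏ β`, which converge to
`Λ`. -/
theorem IsSelfTiling.lambda1_div_le_limit {Ω : Set Plane} (hΩ : IsBoundedDomain Ω)
    (h0 : volume (frontier Ω) = 0) (h : IsSelfTiling Ω) {Λ : ℝ}
    (hΛ : Tendsto (fun β : ℝ => lambda1 Ω β / β) atTop (𝓝 Λ)) {β : ℝ} (hβ : 0 < β) :
    lambda1 Ω β ≤ Λ * β := by
  obtain ⟨m, hm, hle⟩ := h.exists_lambda1_mul_le hΩ h0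
  have hm0 : (0 : ℝ) < m := by exact_mod_cast (by omega : 0 < m)
  have hm1 : (1 : ℝ) < m := by exact_mod_cast (by omega : 1 < m)
  have hk : ∀ k : ℕ, lambda1 Ω β / β ≤ lambda1 Ω ((m : ℝ) ^ k * β) / ((m : ℝ) ^ k * β) := by
    intro k
    induction k with
    | zero => simp
    | succ k ih =>
      refine ih.trans ?_
      have := hle ((m : ℝ) ^ k * β)
      rw [← mul_assoc, ← pow_succ'] at this
      rw [div_le_div_iff₀ (by positivity) (by positivity)]
      calc lambda1 Ω ((m : ℝ) ^ k * β) * ((m : ℝ) ^ (k + 1) * β)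
          = m * lambda1 Ω ((m : ℝ) ^ k * β) * ((m : ℝ) ^ k * β) := by ring
        _ ≤ _ := mul_le_mul_of_nonneg_right this (by positivity)
  have hlim : Tendsto (fun k : ℕ => (m : ℝ) ^ k * β) atTop atTop :=
    (tendsto_pow_atTop_atTop_of_one_lt hm1).atTop_mul_const hβ
  rw [← div_le_iff₀ hβ]
  exact ge_of_tendsto' (hΛ.comp hlim) hk

/-! ### The main theorem. -/

theorem mainTheorem2 :
    (∀ (Ω : Set Plane) (β : ℝ), IsBoundedDomain Ω → 0 < β →
      (∃ M : Plane ≃ᵢ Plane, IsSubgraph (M '' Ω) ∨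
        FillsHalfStripTo (2 * Real.sqrt (deGennesConst / β)) (M '' Ω)) →
      lambda1 Ω β < deGennesConst * β) ∧
    (∀ Ω : Set Plane, IsBoundedDomain Ω → IsCurvilinearPolygon Ω → IsSelfTiling Ω →
      ∃ Λ : ℝ, Tendsto (fun β : ℝ => lambda1 Ω β / β) atTop (𝓝 Λ) ∧
        (∀ β : ℝ, 0 < β → lambda1 Ω β ≤ Λ * β) ∧
        (∀ β : ℝ, 0 < β → Λ * β ≤ deGennesConst * β)) := by
  refine ⟨fun Ω β hΩ hβ ⟨M, h⟩ => lambda1_lt_of_isometry hΩ hβ M h, fun Ω hΩ hP hT => ?_⟩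
  obtain ⟨Λ, hΛ, hle⟩ := hP.exists_tendsto hΩ
  exact ⟨Λ, hΛ, fun β hβ => hT.lambda1_div_le_limit hΩ hP.volume_frontier hΛ hβ,
    fun β hβ => mul_le_mul_of_nonneg_right hle hβ.le⟩
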